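/- **Definitions.** A weighted bi-colored plane tree is a finite tree with properly 2-colored (black/white) vertices and positive integer edge weights, embedded in the oriented plane up to orientation-preserving homeomorphism; that is, it carries a cyclic (counterclockwise) order of the edges at every vertex. The weight of a vertex is the sum of the weights of its incident edges. A labeled passport $\Xi=(\Xi^+,\Xi^-)$ is a pair of multisets of labeled weights $K_k=(K,k)$, with $K\in\mathbb Z_{>0}$ and $k$ a label; $K^m$ denotes $K$ repeated $m$ times with the default label $0$. $\mathrm{Tree}(\Xi)$ is the set of such trees whose black (white) vertices are put in bijection with the multiset $\Xi^+$ ($\Xi^-$) so that the weight of each vertex is the weight of its labeled weight; two trees are identified if there is an isomorphism that preserves colors, edge weights, cyclic orders and labels. $\mathrm{Fill}(\Xi)$ replaces each $K_k$ of multiplicity $m$ by the $m$ distinct labeled weights $K_{(k,1)},\dots,K_{(k,m)}$, and $\mathrm{FTree}(\Xi)=\mathrm{Tree}(\mathrm{Fill}(\Xi))$. $p(\Xi)$ is the product of the factorials of all multiplicities in $\Xi^+$ and $\Xi^-$. A passport is decomposable if, for some $n\ge2$, it is the disjoint union of $n$ nonempty passports, each of which has equal sums of black and of white weights; otherwise it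 is nondecomposable. Put $\Xi/1=\Xi$. For $d>1$, the divided passport $\Xi/d$ exists if some labeled weight $K_k$ on one side has $d\mid K$ and multiplicity $m$ on that side with $d\mid m-1$, and all other multiplicities, on both sides, are divisible by $d$. Then $\Xi/d$ consists, on the side of $K_k$, of one weight $(K/d)_*$ with a new label $*$ and of $K_k$ with multiplicity $(m-1)/d$, and all other multiplicities are divided by $d$ (this is unique if it exists). If $\Xi/d$ exists, put $G(d)=\dfrac{\#\mathrm{FTree}(\Xi/d)}{d\,p(\Xi/d)}$. **Proposition.** Let $p>q\ge1$ be integers, $\Xi=(q^p,p^q)$ (that is, $p$ black vertices of weight $q$ and $q$ white vertices of weight $p$), $g_0=\gcd(p,q)$, $g_1=\gcd(p-1,q)$, $g_2=\gcd(p,q-1)$. Then $\Xi/d$ exists if and only if $d\mid g_1$ or $d\mid g_2$, and $g_0=1$ if and only if $\mathrm{Fill}(\Xi/d)$ is nondecomposable for all $d$ for which $\Xi/d$ exists. If $g_0=1$, then: 1. for every $d$ for which $\Xi/d$ exists, $d\mid p+q-1$ and $$\#\mathrm{FTree}(\Xi/d)=\Bigl(\frac{p+q-1}{d}-1\Bigr)!\,;$$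 2. $$G(d)=\begin{cases}\dfrac{(p+q-2)!}{p!\,q!}&\text{if } d=1,\\[2mm] \dfrac1{p+q-1}\dbinom{(p+q-1)/d}{q/d}&\text{if } 1<d\mid g_1,\\[2mm] \dfrac1{p+q-1}\dbinom{(p+q-1)/d}{p/d}&\text{if } 1<d\mid g_2;\end{cases}$$ 3. with $\varphi$ Euler's totient function, $$\#\mathrm{Tree}(\Xi)=\frac{(p+q-2)!}{p!\,q!}+\frac1{p+q-1}\Biggl(\sum_{1<d\mid g_1}\varphi(d)\binom{(p+q-1)/d}{q/d}+\sum_{1<d\mid g_2}\varphi(d)\binom{(p+q-1)/d}{p/d}\Biggr).$$ -/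

import Mathlib

open scoped Nat

/-- A labeled passport: a pair of multisets of labeled weights `K_k = (K, k)`, with `K` a positive
integer and `k` a label in `S`. The multiset `pos` is for black vertices, `neg` for white ones. -/
@[ext] structure LabeledPassport (S : Type) where
  pos : Multiset (ℕ+ × S)
  neg : Multiset (ℕ+ × S)

namespace LabeledPassport

variable {S : Type}

/-- The total number of points. -/
def size (Ξ : LabeledPassport S) : ℕ := Multiset.card Ξ.pos + Multiset.card Ξ.neg

/-- The sum of the weights of a multiset of labeled weights. -/
def weightSum (M : Multiset (ℕ+ × S)) : ℕ := (M.map fun x => (x.1 : ℕ)).sum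

/-- An `n`-partition of `Ξ`: `n` nonempty passports, each with equal black and white total weight,
whose disjoint union (sum of multisets) is `Ξ`. -/
def IsPartition (Ξ : LabeledPassport S) (n : ℕ) (P : Fin n → LabeledPassport S) : Prop :=
  Ξ.pos = ∑ i, (P i).pos ∧ Ξ.neg = ∑ i, (P i).neg ∧
    ∀ i, 0 < (P i).size ∧ weightSum (P i).pos = weightSum (P i).neg

/-- A passport is decomposable if it has a partition other than the trivial `1`-partition. -/
def Decomposable (Ξ : LabeledPassport S) : Prop :=
  ∃ n : ℕ, 1 < n ∧ ∃ P : Fin n → LabeledPassport S, Ξ.IsPartition n P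

/-- The filling of one side: a labeled weight `K_k` of multiplicity `m` is replaced by the
`m` distinct labeled weights `K_(k,s)`, `1 ≤ s ≤ m`. -/
def fillSide [DecidableEq S] (M : Multiset (ℕ+ × S)) : Multiset (ℕ+ × (S × ℕ)) :=
  M.toEnumFinset.val.map fun y => (y.1.1, (y.1.2, y.2 + 1))

/-- The filling of a labeled passport. -/
def fill [DecidableEq S] (Ξ : LabeledPassport S) : LabeledPassport (S × ℕ) :=
  ⟨fillSide Ξ.pos, fillSide Ξ.neg⟩

/-- The product of the factorials of all multiplicities in `Ξ`. -/
def multFactorial [DecidableEq S] (Ξ : LabeledPassport S) : ℕ :=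
  (∏ x ∈ Ξ.pos.toFinset, (Ξ.pos.count x)!) * ∏ x ∈ Ξ.neg.toFinset, (Ξ.neg.count x)!

/-- Old labels are kept as `some k`; the new label `none` is the star label. -/
def starLift (M : Multiset (ℕ+ × S)) : Multiset (ℕ+ × Option S) :=
  M.map fun x => (x.1, some x.2)

/-- `Ξ.IsDivided d Δ` says that the divided passport `Ξ / d` exists and is `Δ`.
For `d = 1` it is `Ξ`. For `d > 1`, one labeled weight `x = K_k` (the centre, black or white) has
`d ∣ K` and multiplicity `≡ 1` modulo `d`, and all the other multiplicities, on both sides, are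
divisible by `d`; then `Ξ / d` has the starred weight `(K / d)_*`, and the multiplicities left
after the removal of one copy of `x` are divided by `d`. -/
def IsDivided (Ξ : LabeledPassport S) (d : ℕ) (Δ : LabeledPassport (Option S)) : Prop :=
  (d = 1 ∧ Δ = ⟨starLift Ξ.pos, starLift Ξ.neg⟩) ∨
  (1 < d ∧ ∃ (x : ℕ+ × S) (K : ℕ+) (M N : Multiset (ℕ+ × S)),
    (x.1 : ℕ) = d * K ∧ Ξ.pos = x ::ₘ d • M ∧ Ξ.neg = d • N ∧
      Δ = ⟨(K, none) ::ₘ starLift M, starLift N⟩) ∨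
  (1 < d ∧ ∃ (x : ℕ+ × S) (K : ℕ+) (M N : Multiset (ℕ+ × S)),
    (x.1 : ℕ) = d * K ∧ Ξ.pos = d • M ∧ Ξ.neg = x ::ₘ d • N ∧
      Δ = ⟨starLift M, (K, none) ::ₘ starLift N⟩)

theorem smul_left_cancel {α : Type} {d : ℕ} (hd : 1 < d) {M N : Multiset α}
    (h : d • M = d • N) : M = N := by
  classical
  ext a
  have h1 := congrArg (Multiset.count a) h
  simp only [Multiset.count_nsmul] at h1
  exact Nat.eq_of_mul_eq_mul_left (by omega) h1

theorem cons_smul_ne {α : Type} {d : ℕ} (hd : 1 < d) {x : α} {M N : Multiset α} :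
    x ::ₘ d • M ≠ d • N := by
  classical
  intro h
  have h1 := congrArg (Multiset.count x) h
  simp only [Multiset.count_nsmul, Multiset.count_cons_self] at h1
  have h2 : d ∣ d * Multiset.count x M + 1 := h1 ▸ Dvd.intro _ rfl
  have h3 : d ∣ 1 := (Nat.dvd_add_right (Dvd.intro _ rfl)).1 h2
  have := Nat.le_of_dvd one_pos h3
  omega

theorem cons_smul_inj {α : Type} {d : ℕ} (hd : 1 < d) {x y : α} {M N : Multiset α}
    (h : x ::ₘ d • M = y ::ₘ d • N) : x = y ∧ M = N := by
  classical
  have hxy : x = y := by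
    by_contra hne
    have h1 := congrArg (Multiset.count x) h
    simp only [Multiset.count_nsmul, Multiset.count_cons_self,
      Multiset.count_cons_of_ne hne] at h1
    have h2 : d ∣ d * Multiset.count x M + 1 := h1 ▸ Dvd.intro _ rfl
    have h3 : d ∣ 1 := (Nat.dvd_add_right (Dvd.intro _ rfl)).1 h2
    have := Nat.le_of_dvd one_pos h3
    omega
  subst hxy
  exact ⟨rfl, smul_left_cancel hd ((Multiset.cons_inj_right x).1 h)⟩

/-- The divided passport is unique when it exists. -/
theorem IsDivided.unique {Ξ : LabeledPassport S} {d : ℕ} {Δ Δ' : LabeledPassport (Option S)}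
    (h : Ξ.IsDivided d Δ) (h' : Ξ.IsDivided d Δ') : Δ = Δ' := by
  rcases h with ⟨h1, h⟩ | ⟨h1, x, K, M, N, hK, hp, hn, h⟩ | ⟨h1, x, K, M, N, hK, hp, hn, h⟩ <;>
  rcases h' with ⟨h1', h'⟩ | ⟨h1', x', K', M', N', hK', hp', hn', h'⟩ |
    ⟨h1', x', K', M', N', hK', hp', hn', h'⟩
  · rw [h, h']
  · omega
  · omega
  · omega
  · obtain ⟨rfl, rfl⟩ := cons_smul_inj h1 (hp ▸ hp')
    obtain rfl := smul_left_cancel h1 (hn ▸ hn')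
    have : K = K' := PNat.eq (Nat.eq_of_mul_eq_mul_left (by omega) (hK.symm.trans hK'))
    rw [h, h', this]
  · exact absurd (hp.symm.trans hp') (cons_smul_ne h1)
  · omega
  · exact absurd (hp'.symm.trans hp) (cons_smul_ne h1)
  · obtain ⟨rfl, rfl⟩ := cons_smul_inj h1 (hn ▸ hn')
    obtain rfl := smul_left_cancel h1 (hp ▸ hp')
    have : K = K' := PNat.eq (Nat.eq_of_mul_eq_mul_left (by omega) (hK.symm.trans hK'))
    rw [h, h', this]

end LabeledPassport

/-- A weighted bi-colored plane tree: a finite tree with a plane structure, recorded by the rotation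
`rot` that sends each half-edge (dart) to the next one in counterclockwise order around its
starting vertex, with a proper 2-coloring (`black` is the set of black vertices, its complement the
set of white vertices) and positive integer edge weights. -/
structure WBPTree where
  V : Type
  finite : Finite V
  graph : SimpleGraph V
  isTree : graph.IsTree
  black : Set V
  bicolored : ∀ u v, graph.Adj u v → (u ∈ black ↔ v ∉ black)
  weight : graph.edgeSet → ℕ+
  rot : Equiv.Perm graph.Dart
  rot_cycle : ∀ a b : graph.Dart, rot.SameCycle a b ↔ a.fst = b.fst

/-- The weight of a vertex: the sum of the weights of its incident edges. -/
noncomputable def WBPTree.wt (T : WBPTree) (v : T.V) : ℕ :=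
  ∑ᶠ (e : T.graph.edgeSet) (_ : v ∈ (e : Sym2 T.V)), (T.weight e : ℕ)

/-- A labeled weighted bi-colored plane tree with labeled passport `Ξ`. The labeling is a pair of
bijections from the vertex sets onto the multisets `Ξ.pos`, `Ξ.neg`, that is, every element has as
many preimages as its multiplicity; its weight part is the weight of the vertex. -/
structure LWBPTree {S : Type} [DecidableEq S] (Ξ : LabeledPassport S) extends WBPTree where
  lab : V → ℕ+ × S
  lab_weight : ∀ v, ((lab v).1 : ℕ) = toWBPTree.wt v
  lab_black : ∀ x, {v | v ∈ black ∧ lab v = x}.ncard = Ξ.pos.count x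
  lab_white : ∀ x, {v | v ∉ black ∧ lab v = x}.ncard = Ξ.neg.count x

namespace LWBPTree

variable {S : Type} [DecidableEq S] {Ξ : LabeledPassport S}

/-- Two labeled trees are the same: there is a graph isomorphism that respects the colors, the edge
weights, the counterclockwise rotation at every vertex, and the labels. -/
def Same (T T' : LWBPTree Ξ) : Prop :=
  ∃ f : T.graph ≃g T'.graph,
    (∀ v, f v ∈ T'.black ↔ v ∈ T.black) ∧
    (∀ e, T'.weight (f.mapEdgeSet e) = T.weight e) ∧
    (∀ a, T'.rot (f.toHom.mapDart a) = f.toHom.mapDart (T.rot a)) ∧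
    (∀ v, T'.lab (f v) = T.lab v)

theorem Same.refl (T : LWBPTree Ξ) : Same T T := by
  refine ⟨SimpleGraph.Iso.refl, fun _ => Iff.rfl, fun e => ?_, fun a => rfl, fun _ => rfl⟩
  congr 1
  ext1
  simp [SimpleGraph.Iso.mapEdgeSet, SimpleGraph.Hom.mapEdgeSet]

theorem Same.symm {T T' : LWBPTree Ξ} (h : Same T T') : Same T' T := by
  obtain ⟨f, hb, hw, hr, hl⟩ := h
  have key : ∀ a, f.toHom.mapDart (f.symm.toHom.mapDart a) = a := by
    intro a
    ext <;> simp [SimpleGraph.Hom.mapDart]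
  have key' : ∀ a, f.symm.toHom.mapDart (f.toHom.mapDart a) = a := by
    intro a
    ext <;> simp [SimpleGraph.Hom.mapDart]
  refine ⟨f.symm, fun v => ?_, fun e => ?_, fun a => ?_, fun v => ?_⟩
  · have := hb (f.symm v)
    rw [f.apply_symm_apply] at this
    exact this.symm
  · have := hw (f.mapEdgeSet.symm e)
    rw [Equiv.apply_symm_apply] at this
    exact this.symm
  · have := hr (f.symm.toHom.mapDart a)
    rw [key] at this
    rw [this, key']
  · have := hl (f.symm v)
    rw [f.apply_symm_apply] at this
    exact this.symm

theorem Same.trans {T T' T'' : LWBPTree Ξ} (h : Same T T') (h' : Same T' T'') : Same T T'' := by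
  obtain ⟨f, hb, hw, hr, hl⟩ := h
  obtain ⟨g, hb', hw', hr', hl'⟩ := h'
  refine ⟨f.trans g, fun v => (hb' (f v)).trans (hb v), fun e => ?_, fun a => ?_,
    fun v => (hl' (f v)).trans (hl v)⟩
  · have := (hw' (f.mapEdgeSet e)).trans (hw e)
    rw [← this]
    congr 1
    ext1
    simp [SimpleGraph.Iso.mapEdgeSet, SimpleGraph.Hom.mapEdgeSet, Sym2.map_map]
  · have h1 := hr' (f.toHom.mapDart a)
    rw [hr a] at h1
    exact h1

instance setoid (Ξ : LabeledPassport S) : Setoid (LWBPTree Ξ) :=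
  ⟨Same, Same.refl, Same.symm, Same.trans⟩

end LWBPTree

namespace LabeledPassport

variable {S : Type} [DecidableEq S]

/-- The set of labeled trees with labeled passport `Ξ`, two equal ones being identified. -/
def Tree (Ξ : LabeledPassport S) : Type 1 := Quotient (LWBPTree.setoid Ξ)

/-- The set of labeled trees whose passport is the filling of `Ξ`. -/
def FTree (Ξ : LabeledPassport S) : Type 1 := Tree Ξ.fill

open Classical in
/-- `G(d) = #FTree(Ξ / d) / (d p(Ξ / d))`, where `p` is the product of the factorials of the
multiplicities; the value is `0` when `Ξ / d` does not exist. -/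
noncomputable def G (Ξ : LabeledPassport S) (d : ℕ) : ℚ :=
  if h : ∃ Δ, Ξ.IsDivided d Δ then
    (Nat.card h.choose.FTree : ℚ) / ((d : ℚ) * (h.choose.multFactorial : ℚ))
  else 0

/-- The unlabeled passport `(q^p, p^q)`: `p` black points of weight `q` and `q` white points of
weight `p`, all with the default label `0`. -/
def pq (p q : ℕ+) : LabeledPassport ℕ :=
  ⟨Multiset.replicate p (q, 0), Multiset.replicate q (p, 0)⟩

end LabeledPassport

/-! A plane tree with `n` edges and a chosen root edge is a `TreeCode`: number the edges along the
contour; then the rotations around white and around black vertices are permutations `white` and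
`compl white` of `Fin n` whose composite is `i ↦ i + 1`. Such a pair has `n + 1` weak descents in
all (`descents_card`), every cycle has at least one, and a tree has `n + 1` vertices; hence every
cycle is traversed increasingly and the pair is noncrossing.

Writing black vertices in preorder and white ones in postorder, with weights counted positively and
negatively, turns the code into a lattice path. Its height is the total weight of the edges
currently open (`height_word_succ`), so it is positive in between, and the code can be recovered
from it (`word_injective`). Conversely every path that is positive with distinct heights comes from
a code (`exists_word_eq`). If the passport is primitive, that is, if no proper nonempty sub-passport
is balanced, then all words have distinct heights, and exactly one of the `n + 1` rotations of a
word is positive (`card_words`). So the number of codes is `n!` divided by the product of the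
factorials of the multiplicities (`card_mul`).

Plane trees are the orbits of codes under the action of `Fin n` that moves the root edge
(`card_tree`). For a filled passport the action is free, which gives `(n - 1)!` trees; together with
the explicit form of the divided passports (`isDivided_pq_iff`) this yields the counts for `Ξ / d`
and the values of `G`.

For `(q ^ p, p ^ q)` itself Burnside's lemma is used. A code fixed by a shift of order `d > 1` is a
`d`-fold cyclic cover of a code with `m = n / d` edges. The quotient has at most `m + 1` vertices,
while `p + q = d m + 1` vertices lie above them, so exactly one vertex is fixed and the others lie
in orbits of size `d` (`ramification`). Fixed codes therefore correspond to codes of the divided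
passport (`card_periodic`), whose number is a binomial coefficient. Black centres are treated
directly, white ones by reflection (`mirror`).

Coprimality of `p` and `q` makes all these passports primitive; if `g = gcd p q > 1`, then `p / g`
black and `q / g` white vertices already split off from the filling. -/

set_option linter.unusedSectionVars false

/-! ### Noncrossing permutations of `Fin n` and their complements. -/

section

namespace CyclePerm

open Equiv Finset

variable {n : ℕ}

/-- The largest element of the cycle of `i`. -/
def top (σ : Perm (Fin n)) (i : Fin n) : Fin n :=
  (univ.filter fun j => σ.SameCycle i j).max' ⟨i, by simp [Perm.SameCycle.refl]⟩

theorem top_sameCycle (σ : Perm (Fin n)) (i : Fin n) : σ.SameCycle i (top σ i) :=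
  (Finset.mem_filter.1 (Finset.max'_mem (univ.filter fun j => σ.SameCycle i j)
    ⟨i, by simp [Perm.SameCycle.refl]⟩)).2

theorem le_top {σ : Perm (Fin n)} {i j : Fin n} (h : σ.SameCycle i j) : j ≤ top σ i :=
  Finset.le_max' _ _ (by simpa using h)

theorem self_le_top (σ : Perm (Fin n)) (i : Fin n) : i ≤ top σ i := le_top (Perm.SameCycle.refl _ _)

theorem top_eq_iff {σ : Perm (Fin n)} {i j : Fin n} : top σ i = top σ j ↔ σ.SameCycle i j := by
  constructor
  · intro h
    have h1 := top_sameCycle σ i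
    rw [h] at h1
    exact h1.trans (top_sameCycle σ j).symm
  · intro h
    refine le_antisymm (le_top (h.symm.trans (top_sameCycle σ i))) (le_top (h.trans (top_sameCycle σ j)))

@[simp] theorem top_top (σ : Perm (Fin n)) (i : Fin n) : top σ (top σ i) = top σ i :=
  top_eq_iff.2 (top_sameCycle σ i).symm

theorem top_apply (σ : Perm (Fin n)) (i : Fin n) : top σ (σ i) = top σ i :=
  top_eq_iff.2 (by simp [Perm.SameCycle.refl])

theorem apply_le_of_top {σ : Perm (Fin n)} {i : Fin n} (h : top σ i = i) : σ i ≤ i := by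
  have h1 : σ i ≤ top σ i := le_top (by simp [Perm.SameCycle.refl])
  rwa [h] at h1

/-- Every weak descent of `σ` is the top of its cycle. -/
def SingleDescent (σ : Perm (Fin n)) : Prop := ∀ i, σ i ≤ i → top σ i = i

namespace SingleDescent

variable {σ : Perm (Fin n)} (h : SingleDescent σ)
include h

theorem lt_apply {i j : Fin n} (hc : σ.SameCycle i j) (hij : i < j) : i < σ i := by
  by_contra hle
  have h1 := h i (not_lt.1 hle)
  have := le_top hc
  omega

/-- The preimage of the least element of the cycle is a weak descent, hence the top; so the top is
sent to the least element. -/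
theorem apply_top_le {i j : Fin n} (hc : σ.SameCycle i j) : σ (top σ i) ≤ j := by
  set s := univ.filter fun k => σ.SameCycle i k
  have hs : s.Nonempty := ⟨i, by simp [s, Perm.SameCycle.refl]⟩
  have hm : σ.SameCycle i (s.min' hs) := by simpa [s] using s.min'_mem hs
  have hl : ∀ k, σ.SameCycle i k → s.min' hs ≤ k := fun k hk => s.min'_le k (by simpa [s] using hk)
  have h1 : σ.SameCycle i (σ⁻¹ (s.min' hs)) := by simpa using hm
  have h2 := h (σ⁻¹ (s.min' hs)) (by simpa using hl _ h1)
  have h3 : top σ i = σ⁻¹ (s.min' hs) := by rw [← h2]; exact top_eq_iff.2 h1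
  rw [h3]
  simpa using hl j hc

/-- Between `a` and `k`, if the cycle of `k` starts at or before `a < k`, some step of the cycle
jumps over `a`. -/
theorem exists_step {k y a : Fin n} (hc : σ.SameCycle k y) (hy : y ≤ a) (ha : a < k) :
    ∃ b, σ.SameCycle k b ∧ b ≤ a ∧ a < σ b ∧ σ b ≤ k := by
  set s := univ.filter fun z => σ.SameCycle k z ∧ a < z
  have hs : s.Nonempty := ⟨k, by simp [s, Perm.SameCycle.refl, ha]⟩
  have hm : σ.SameCycle k (s.min' hs) ∧ a < s.min' hs := by simpa [s] using s.min'_mem hs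
  have hl : ∀ z, σ.SameCycle k z → a < z → s.min' hs ≤ z :=
    fun z hz hz' => s.min'_le z (by simpa [s] using ⟨hz, hz'⟩)
  set m := s.min' hs
  have h1 : σ.SameCycle k (σ⁻¹ m) := by simpa using hm.1
  refine ⟨σ⁻¹ m, h1, ?_, by simpa using hm.2, by simpa using hl k (Perm.SameCycle.refl _ _) ha⟩
  by_contra hlt
  have h2 := h (σ⁻¹ m) (by simpa using hl _ h1 (not_le.1 hlt))
  have h3 := h.apply_top_le (h1.symm.trans hc)
  rw [h2] at h3
  simp at h3
  omega

/-- The next element of the cycle is the least larger one. -/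
theorem not_between {b z : Fin n} (hc : σ.SameCycle b z) (h1 : b < z) (h2 : z < σ b) : False := by
  -- Let `m` be the least element of the cycle above `b`. Its preimage is not `b`, because `m ≤ z <
  -- σ b`. It is not above `b`, because it would be a weak descent and `m` would be the least
  -- element of the cycle. If it is below `b`, its step to `m` jumps over `b`, which the induction
  -- hypothesis forbids.
  induction b using WellFoundedLT.induction generalizing z with
  | ind b ih =>
    set s := univ.filter fun z => σ.SameCycle b z ∧ b < z
    have hs : s.Nonempty := ⟨z, by simp [s, hc, h1]⟩
    have hm : σ.SameCycle b (s.min' hs) ∧ b < s.min' hs := by simpa [s] using s.min'_mem hs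
    have hl : ∀ z, σ.SameCycle b z → b < z → s.min' hs ≤ z :=
      fun z hz hz' => s.min'_le z (by simpa [s] using ⟨hz, hz'⟩)
    set m := s.min' hs
    have hmz := hl z hc h1
    have h3 : σ.SameCycle b (σ⁻¹ m) := by simpa using hm.1
    rcases lt_trichotomy (σ⁻¹ m) b with h4 | h4 | h4
    · exact ih _ h4 (z := b) h3.symm h4 (by simpa using hm.2)
    · have : m = σ b := by rw [← h4]; simp
      omega
    · have h5 := h (σ⁻¹ m) (by simpa using hl _ h3 h4)
      have h6 := h.apply_top_le h3.symm
      rw [h5] at h6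
      simp at h6
      omega

end SingleDescent

/-- Both permutations send the top of a cycle to its least element and any other element to the next
larger one, so the partition into cycles determines them. -/
theorem SingleDescent.eq_of_sameCycle {σ τ : Perm (Fin n)} (hσ : SingleDescent σ)
    (hτ : SingleDescent τ) (h : ∀ i j, σ.SameCycle i j ↔ τ.SameCycle i j) : σ = τ := by
  have ht : ∀ i, top σ i = top τ i := fun i =>
    le_antisymm (le_top ((h _ _).1 (top_sameCycle σ i))) (le_top ((h _ _).2 (top_sameCycle τ i)))
  have h1 : ∀ i, σ.SameCycle i (σ i) := fun i => by simp [Perm.SameCycle.refl]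
  have h2 : ∀ i, τ.SameCycle i (τ i) := fun i => by simp [Perm.SameCycle.refl]
  ext i
  congr 1
  by_cases hi : top σ i = i
  · have hi' : top τ i = i := (ht i).symm.trans hi
    have e1 := hσ.apply_top_le ((h _ _).2 (h2 i))
    have e2 := hτ.apply_top_le ((h _ _).1 (h1 i))
    rw [hi] at e1; rw [hi'] at e2
    exact le_antisymm e1 e2
  · have e1 : i < σ i := by
      by_contra hc
      exact hi (hσ i (not_lt.1 hc))
    have e2 : i < τ i := by
      by_contra hc
      exact hi ((ht i).trans (hτ i (not_lt.1 hc)))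
    rcases lt_trichotomy (σ i) (τ i) with e | e | e
    · exact (hτ.not_between ((h _ _).1 (h1 i)) e1 e).elim
    · exact e
    · exact (hσ.not_between ((h _ _).2 (h2 i)) e2 e).elim

variable [NeZero n]

/-- The permutation whose composite with `τ` is the rotation `i ↦ i + 1`. -/
def compl (τ : Perm (Fin n)) : Perm (Fin n) := Equiv.addRight 1 * τ⁻¹

@[simp] theorem compl_apply (τ : Perm (Fin n)) (i : Fin n) : compl τ (τ i) = i + 1 := by
  simp [compl]

theorem val_add_one {i : Fin n} (h : i.val + 1 < n) : (i + 1).val = i.val + 1 := by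
  rw [Fin.val_add, Fin.val_one']
  rw [Nat.mod_eq_of_lt (a := 1) (by omega), Nat.mod_eq_of_lt h]

theorem val_add_one_last {i : Fin n} (h : i.val + 1 = n) : (i + 1).val = 0 := by
  rw [Fin.val_add, Fin.val_one', Nat.add_mod_mod, h, Nat.mod_self]

/-- After reindexing by `τ`, a weak descent of the complement is an `i` with `i + 1 ≤ τ i`. For `i +
1 < n` this is the negation of `τ i ≤ i`, so `i` counts once; for the last `i`, where `i + 1 = 0`,
both conditions hold and it counts twice. -/
theorem descents_card (τ : Perm (Fin n)) :
    (univ.filter fun i => τ i ≤ i).card + (univ.filter fun j => compl τ j ≤ j).card = n + 1 := by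
  have hn := NeZero.pos n
  have h1 : (univ.filter fun j => compl τ j ≤ j).card = (univ.filter fun i => i + 1 ≤ τ i).card := by
    rw [Finset.card_filter, Finset.card_filter, ← Equiv.sum_comp τ]
    simp
  have h2 : (univ.filter fun i : Fin n => i.val + 1 = n).card = 1 := by
    rw [Finset.card_eq_one]
    refine ⟨⟨n - 1, by omega⟩, ?_⟩
    ext i
    simp [Fin.ext_iff]
    omega
  rw [h1, ← h2, Finset.card_filter, Finset.card_filter, Finset.card_filter, ← Finset.sum_add_distrib]
  calc _ = ∑ i : Fin n, (1 + if i.val + 1 = n then 1 else 0) := by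
        refine Finset.sum_congr rfl fun i _ => ?_
        by_cases hi : i.val + 1 = n
        · have e1 := val_add_one_last hi
          have e2 := (τ i).isLt
          rw [if_pos (Fin.le_def.2 (by omega)), if_pos (Fin.le_def.2 (by omega)), if_pos hi]
        · have e1 := val_add_one (i := i) (by omega)
          rw [if_neg hi]
          by_cases hc : τ i ≤ i
          · rw [if_pos hc, if_neg]
            rw [Fin.le_def] at *; omega
          · rw [if_neg hc, if_pos]
            rw [Fin.le_def] at *; omega
    _ = _ := by simp [Finset.sum_add_distrib]

/-- `τ` and its complement both have a single descent on each cycle: `τ` is noncrossing. -/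
structure Noncrossing (τ : Perm (Fin n)) : Prop where
  left : SingleDescent τ
  right : SingleDescent (compl τ)

namespace Noncrossing

variable {τ : Perm (Fin n)} (h : Noncrossing τ)
include h

/-- A nontrivial step of the complement covers exactly the span of a cycle. -/
theorem top_of_step {b : Fin n} (hb : b < compl τ b) :
    (top τ b).val + 1 = (compl τ b).val := by
  obtain ⟨y, rfl⟩ := τ.surjective b
  rw [compl_apply] at *
  have hlt : y.val + 1 < n := by
    by_contra hc
    have := val_add_one_last (i := y) (by omega)
    rw [Fin.lt_def] at hb; omega
  rw [val_add_one hlt, top_apply]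
  rw [Fin.lt_def, val_add_one hlt] at hb
  rw [h.left y (Fin.le_def.2 (by omega))]

/-- The span of a cycle contains the rest of every cycle it meets. -/
theorem top_le_top {f a : Fin n} (h1 : f ≤ a) (h2 : a ≤ top τ f) : top τ a ≤ top τ f := by
  induction hd : (top τ f).val - f.val using Nat.strong_induction_on generalizing f a with
  | _ d ih =>
  rcases eq_or_lt_of_le h1 with rfl | h1
  · rfl
  have hf : f < τ f := h.left.lt_apply (top_sameCycle τ f) (h1.trans_le h2)
  have hle : τ f ≤ top τ f := le_top (by simp [Perm.SameCycle.refl])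
  rcases le_or_gt (τ f) a with h3 | h3
  · have := ih ((top τ (τ f)).val - (τ f).val) (by rw [top_apply]; simp only [Fin.lt_def, Fin.le_def] at *; omega)
      h3 (by rwa [top_apply]) rfl
    rwa [top_apply] at this
  · have hlt : f.val + 1 < n := by
      have := (τ f).isLt; rw [Fin.lt_def] at hf; omega
    -- Now `f < a < τ f`. The complement sends its top `τ f` to `f + 1`, so this complement cycle
    -- runs from `f + 1` up to `τ f` and one of its steps jumps over `a`. The `τ`-cycle of the start
    -- `b` of that step ends just before the end of the step, and the induction applies to `b > f`.
    have h4 : (compl τ).SameCycle (τ f) (f + 1) := ⟨1, by simp⟩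
    obtain ⟨b, hb1, hb2, hb3, hb4⟩ := h.right.exists_step (a := a) h4
      (by rw [Fin.le_def, val_add_one hlt]; exact h1) h3
    have h5 := h.top_of_step (hb2.trans_lt hb3)
    have h6 : f + 1 ≤ b := by
      have h7 := h.right.apply_top_le (h4.symm.trans (hb1))
      have h8 : compl τ (τ f) = f + 1 := compl_apply _ _
      have h9 := h.right (τ f) (by
        rw [h8, Fin.le_def, val_add_one hlt]; exact hf)
      rw [← top_eq_iff.2 h4, h9, h8] at h7
      exact h7
    rw [Fin.le_def, val_add_one hlt] at h6
    have := ih ((top τ b).val - b.val) (by simp only [Fin.lt_def, Fin.le_def] at *; omega) hb2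
      (by simp only [Fin.lt_def, Fin.le_def] at *; omega) rfl
    simp only [Fin.lt_def, Fin.le_def] at *; omega

/-- If the complement cycle of `k` begins at or before `a < k`, then the cycle of `a` ends
before `k`. -/
theorem top_lt {k y a : Fin n} (hc : (compl τ).SameCycle k y) (hy : y ≤ a) (ha : a < k) :
    top τ a < k := by
  obtain ⟨b, hb1, hb2, hb3, hb4⟩ := h.right.exists_step hc hy ha
  have h5 := h.top_of_step (hb2.trans_lt hb3)
  have h6 := h.top_le_top (f := b) (a := a) hb2 (by simp only [Fin.lt_def, Fin.le_def] at *; omega)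
  simp only [Fin.lt_def, Fin.le_def] at *; omega

/-- If `i < j` are in one complement cycle, the `τ`-cycle of `i` ends before `j`. For codes this
says that two edges cannot share both end vertices. -/
theorem eq_of_sameCycle {i j : Fin n} (h1 : τ.SameCycle i j) (h2 : (compl τ).SameCycle i j) :
    i = j := by
  rcases lt_trichotomy i j with hij | hij | hij
  · have := h.top_lt h2.symm le_rfl hij
    exact absurd (le_top h1) (not_le.2 this)
  · exact hij
  · have := h.top_lt h2 le_rfl hij
    exact absurd (le_top h1.symm) (not_le.2 this)

end Noncrossing

end CyclePerm

end

/-! ### Codes of rooted plane trees, their words and the heights of these words. -/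

section

namespace CyclePerm

open Equiv Finset

variable {n : ℕ} {S : Type} [DecidableEq S]

/-- Edge weights `wt` and labels `l` of the edges around the vertices (the cycles of `σ`) realize
the multiset `M` of labeled weights. -/
structure IsLabeling (σ : Perm (Fin n)) (wt : Fin n → ℕ+) (l : Fin n → ℕ+ × S)
    (M : Multiset (ℕ+ × S)) : Prop where
  apply_eq : ∀ i, l (σ i) = l i
  sum_cycle : ∀ i, ∑ j with σ.SameCycle i j, (wt j : ℕ) = (l i).1
  sum_label : ∀ x, ∑ j with l j = x, (wt j : ℕ) = x.1 * M.count x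

namespace IsLabeling

variable {σ : Perm (Fin n)} {wt : Fin n → ℕ+} {l : Fin n → ℕ+ × S} {M : Multiset (ℕ+ × S)}
  (h : IsLabeling σ wt l M)
include h

theorem eq_of_sameCycle {i j : Fin n} (hc : σ.SameCycle i j) : l i = l j := by
  obtain ⟨k, -, rfl⟩ := hc.exists_pow_eq'
  induction k with
  | zero => rfl
  | succ k ih => rw [pow_succ', Perm.mul_apply, h.apply_eq, ← ih ⟨k, by simp⟩]

/-- Edges labeled `x` fall into whole cycles, each of total weight `x.1`, so `sum_label` counts
these cycles; each is represented by its top. -/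
theorem card_tops_label (x : ℕ+ × S) :
    (univ.filter fun i => top σ i = i ∧ l i = x).card = M.count x := by
  have h1 := h.sum_label x
  rw [← Finset.sum_fiberwise_of_maps_to (g := top σ)
    (t := univ.filter fun i => top σ i = i ∧ l i = x)] at h1
  · rw [Finset.sum_congr rfl (g := fun _ => (x.1 : ℕ))] at h1
    · rw [Finset.sum_const, smul_eq_mul, mul_comm] at h1
      exact Nat.eq_of_mul_eq_mul_left x.1.pos h1
    · intro i hi
      simp only [mem_filter, mem_univ, true_and] at hi
      rw [← hi.2, ← h.sum_cycle i]
      refine Finset.sum_congr ?_ fun _ _ => rfl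
      ext j
      simp only [mem_filter, mem_univ, true_and]
      constructor
      · rintro ⟨h2, h3⟩
        rw [← top_eq_iff, h3, hi.1]
      · intro hc
        refine ⟨(h.eq_of_sameCycle hc).symm, ?_⟩
        rw [← top_eq_iff.2 hc, hi.1]
  · intro j hj
    simp only [mem_filter, mem_univ, true_and, top_top] at hj ⊢
    rw [← hj]
    exact (h.eq_of_sameCycle (top_sameCycle σ j)).symm

theorem mem (i : Fin n) : l i ∈ M := by
  rw [← Multiset.count_pos, ← h.card_tops_label, Finset.card_pos]
  exact ⟨top σ i, by simp [(h.eq_of_sameCycle (top_sameCycle σ i)).symm]⟩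

theorem card_tops : (univ.filter fun i => top σ i = i).card = Multiset.card M := by
  rw [← Multiset.toFinset_sum_count_eq, Finset.card_eq_sum_card_fiberwise (f := l)
    (t := M.toFinset)]
  · refine Finset.sum_congr rfl fun x _ => ?_
    rw [← h.card_tops_label x, Finset.filter_filter]
  · intro i _
    simpa using h.mem i

theorem card_le_descents : Multiset.card M ≤ (univ.filter fun i => σ i ≤ i).card := by
  rw [← h.card_tops]
  refine Finset.card_le_card fun i hi => ?_
  simp only [mem_filter, mem_univ, true_and] at hi ⊢
  exact apply_le_of_top hi

theorem singleDescent (hM : (univ.filter fun i => σ i ≤ i).card ≤ Multiset.card M) :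
    SingleDescent σ := by
  rw [← h.card_tops] at hM
  intro i hi
  have := Finset.eq_of_subset_of_card_le (s := univ.filter fun i => top σ i = i)
    (t := univ.filter fun i => σ i ≤ i) (fun i hi => by
      simp only [mem_filter, mem_univ, true_and] at hi ⊢
      exact apply_le_of_top hi) hM
  have h2 : i ∈ univ.filter fun i => σ i ≤ i := by simpa using hi
  rw [← this] at h2
  simpa using h2

end IsLabeling

/-- On either side there are at most as many vertices as weak descents. Both totals are `n + 1`, so
equality holds on each side and every weak descent is a top. -/
theorem IsLabeling.noncrossing [NeZero n] {τ : Perm (Fin n)} {wt : Fin n → ℕ+}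
    {lw lb : Fin n → ℕ+ × S} {M N : Multiset (ℕ+ × S)} (hw : IsLabeling τ wt lw N)
    (hb : IsLabeling (compl τ) wt lb M) (hc : Multiset.card M + Multiset.card N = n + 1) :
    Noncrossing τ := by
  have h1 := descents_card τ
  have h2 := hw.card_le_descents
  have h3 := hb.card_le_descents
  exact ⟨hw.singleDescent (by omega), hb.singleDescent (by omega)⟩

end CyclePerm

open CyclePerm Finset

/-- An edge-rooted plane tree with labeled passport `Ξ`, its `n` edges being numbered along the
contour from the root edge: `white` is the rotation around the white vertices, and then
`compl white` is the rotation around the black ones. -/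
@[ext] structure TreeCode {S : Type} [DecidableEq S] (Ξ : LabeledPassport S) (n : ℕ) [NeZero n] where
  white : Equiv.Perm (Fin n)
  wt : Fin n → ℕ+
  lw : Fin n → ℕ+ × S
  lb : Fin n → ℕ+ × S
  labeling_white : IsLabeling white wt lw Ξ.neg
  labeling_black : IsLabeling (compl white) wt lb Ξ.pos

/-- The signed weight of a letter. -/
def letterSign {S : Type} : (ℕ+ × S) ⊕ (ℕ+ × S) → ℤ := Sum.elim (fun x => (x.1 : ℤ)) fun x => -(x.1 : ℤ)

/-- The sum of the signed weights of the first `k` letters. -/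
def height {S : Type} {N : ℕ} (u : Fin N → (ℕ+ × S) ⊕ (ℕ+ × S)) (k : ℕ) : ℤ :=
  ∑ i : Fin N with i.val < k, letterSign (u i)

theorem height_zero {S : Type} {N : ℕ} (u : Fin N → (ℕ+ × S) ⊕ (ℕ+ × S)) : height u 0 = 0 := by
  simp [height]

theorem height_succ {S : Type} {N : ℕ} (u : Fin N → (ℕ+ × S) ⊕ (ℕ+ × S)) (k : Fin N) :
    height u (k + 1) = height u k + letterSign (u k) := by
  unfold height
  rw [show (univ.filter fun i : Fin N => i.val < k + 1) =
    insert k (univ.filter fun i : Fin N => i.val < k) by ext i; simp [Fin.ext_iff]; omega]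
  rw [Finset.sum_insert (by simp), add_comm]

namespace TreeCode

variable {S : Type} [DecidableEq S] {Ξ : LabeledPassport S} {n : ℕ} [NeZero n]

/-- The letters: black vertices in preorder and white vertices in postorder. -/
def word (X : TreeCode Ξ n) : Fin (n + 1) → (ℕ+ × S) ⊕ (ℕ+ × S) :=
  Fin.cases (Sum.inl (X.lb 0))
    fun i => if X.white i ≤ i then Sum.inr (X.lw i) else Sum.inl (X.lb (i + 1))

theorem noncrossing (X : TreeCode Ξ n) (hn : Ξ.size = n + 1) : Noncrossing X.white :=
  X.labeling_white.noncrossing X.labeling_black hn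

/-- The smallest edge at the black vertex of `i`. -/
def bot (X : TreeCode Ξ n) (i : Fin n) : Fin n := compl X.white (top (compl X.white) i)

theorem bot_sameCycle (X : TreeCode Ξ n) (i : Fin n) : (compl X.white).SameCycle i (X.bot i) :=
  (top_sameCycle _ i).trans (by simp [bot, Equiv.Perm.SameCycle.refl])

variable (X : TreeCode Ξ n) (hn : Ξ.size = n + 1)
include hn

theorem bot_le {i j : Fin n} (h : (compl X.white).SameCycle i j) : X.bot i ≤ j :=
  (X.noncrossing hn).right.apply_top_le h

theorem bot_congr {i j : Fin n} (h : (compl X.white).SameCycle i j) : X.bot i = X.bot j :=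
  le_antisymm (X.bot_le hn (h.trans (X.bot_sameCycle j)))
    (X.bot_le hn (h.symm.trans (X.bot_sameCycle i)))

theorem bot_zero : X.bot 0 = 0 :=
  le_antisymm (X.bot_le hn (Equiv.Perm.SameCycle.refl _ _)) (Fin.zero_le _)

omit hn in
theorem white_sameCycle_add_one (i : Fin n) : (compl X.white).SameCycle (X.white i) (i + 1) :=
  ⟨1, by simp⟩

/-- The black rotation sends `white i` to `i + 1`; if `i < white i`, this is a weak descent, so
`white i` is the top and `i + 1` the bottom of their black vertex. Hence passing from `i` to `i + 1`
either finishes a white vertex or enters a new black one, the dichotomy in `word`. -/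
theorem bot_add_one_eq_iff {i : Fin n} (hi : i.val + 1 < n) :
    X.bot (i + 1) = i + 1 ↔ i < X.white i := by
  have hr := (X.noncrossing hn).right
  have h1 := (X.white_sameCycle_add_one i).symm
  constructor
  · intro h
    have := X.bot_le hn h1
    rw [h, Fin.le_def, val_add_one hi] at this
    exact this
  · intro h
    have h2 := hr (X.white i) (by rw [compl_apply, Fin.le_def, val_add_one hi]; exact h)
    rw [bot, top_eq_iff.2 h1, h2, compl_apply]

/-- The sum is over the edges open at `k`: their black vertex has been entered and their white
vertex is not yet past. A black letter opens all edges of a new black vertex, a white letter closes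
all edges of a finished white one. -/
theorem height_word_succ (k : ℕ) (hk : k < n) : height X.word (k + 1) =
    ∑ f with X.bot f ≤ ⟨k, hk⟩ ∧ ⟨k, hk⟩ ≤ top X.white f, (X.wt f : ℤ) := by
  induction k with
  | zero =>
    have h1 := height_succ X.word 0
    rw [show ((0 : Fin (n + 1)) : ℕ) = 0 from rfl, height_zero, zero_add, zero_add] at h1
    rw [zero_add, h1]
    have h2 := X.labeling_black.sum_cycle 0
    simp only [word, letterSign, Fin.cases_zero, Sum.elim_inl]
    rw [← Nat.cast_sum, ← h2]
    congr 1
    refine Finset.sum_congr ?_ fun _ _ => rfl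
    ext f
    have h0 : (⟨0, hk⟩ : Fin n) = 0 := by ext; simp
    simp only [mem_filter, mem_univ, true_and, h0, Fin.zero_le, and_true]
    constructor
    · intro h
      exact X.bot_le hn h.symm
    · intro h
      have h3 : X.bot f = 0 := le_antisymm h (Fin.zero_le _)
      exact h3 ▸ (X.bot_sameCycle f).symm
  | succ k ih =>
    have hk' : k < n := by omega
    have h1 := height_succ X.word ⟨k + 1, by omega⟩
    simp only at h1
    rw [h1, ih hk']
    have h3 : (⟨k + 1, by omega⟩ : Fin (n + 1)) = Fin.succ ⟨k, hk'⟩ := rfl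
    have h4 : (⟨k, hk'⟩ : Fin n) + 1 = ⟨k + 1, hk⟩ := by
      ext; rw [val_add_one]; exact hk
    rw [h3]
    have h5 := X.bot_add_one_eq_iff hn (i := ⟨k, hk'⟩) hk
    simp only [word, Fin.cases_succ]
    rw [h4] at *
    have hnc := X.noncrossing hn
    by_cases h6 : X.white ⟨k, hk'⟩ ≤ ⟨k, hk'⟩
    · rw [if_pos h6]
      have h7 := hnc.left _ h6
      have h8 := X.labeling_white.sum_cycle ⟨k, hk'⟩
      have h9 : ∀ f, X.bot f ≠ ⟨k + 1, hk⟩ := by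
        intro f hf
        have := X.bot_congr hn (X.bot_sameCycle f)
        rw [hf] at this
        exact absurd (h5.1 this.symm) (not_lt.2 h6)
      simp only [letterSign, Sum.elim_inr]
      rw [← h8, Nat.cast_sum, Finset.sum_filter, Finset.sum_filter, Finset.sum_filter,
        ← sub_eq_add_neg, ← Finset.sum_sub_distrib]
      refine Finset.sum_congr rfl fun f _ => ?_
      have h10 := h9 f
      have h11 : X.white.SameCycle ⟨k, hk'⟩ f ↔ top X.white f = ⟨k, hk'⟩ := by
        rw [← top_eq_iff, h7]; exact eq_comm
      have h12 := X.bot_le hn (Equiv.Perm.SameCycle.refl _ f)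
      have h13 := self_le_top X.white f
      simp only [h11]
      simp only [Fin.le_def, Fin.ext_iff, ne_eq] at *
      split_ifs <;> omega
    · rw [if_neg h6]
      have h7 := h5.2 (not_le.1 h6)
      have h8 := X.labeling_black.sum_cycle ⟨k + 1, hk⟩
      have h9 : ∀ f, top X.white f ≠ ⟨k, hk'⟩ := by
        intro f hf
        have := top_top X.white f
        rw [hf] at this
        exact h6 (apply_le_of_top this)
      simp only [letterSign, Sum.elim_inl]
      rw [← h8, Nat.cast_sum, Finset.sum_filter, Finset.sum_filter, Finset.sum_filter,
        ← Finset.sum_add_distrib]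
      refine Finset.sum_congr rfl fun f _ => ?_
      have h10 := h9 f
      have h11 : (compl X.white).SameCycle ⟨k + 1, hk⟩ f ↔ X.bot f = ⟨k + 1, hk⟩ := by
        constructor
        · intro h; rw [← h7]; exact (X.bot_congr hn h.symm).trans rfl
        · intro h; exact h ▸ (X.bot_sameCycle f).symm
      have h12 := X.bot_le hn (Equiv.Perm.SameCycle.refl _ f)
      have h13 := self_le_top X.white f
      simp only [h11]
      simp only [Fin.le_def, Fin.ext_iff, ne_eq] at *
      split_ifs <;> omega

theorem height_word_pos (k : ℕ) (hk : k < n) : 0 < height X.word (k + 1) := by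
  rw [X.height_word_succ hn k hk]
  refine Finset.sum_pos (fun f _ => by exact_mod_cast (X.wt f).pos) ⟨⟨k, hk⟩, ?_⟩
  simpa using ⟨X.bot_le hn (Equiv.Perm.SameCycle.refl _ _), self_le_top _ _⟩

end TreeCode

end

/-! ### A code is determined by its word. -/

section

open CyclePerm Finset

namespace TreeCode

variable {S : Type} [DecidableEq S] {Ξ : LabeledPassport S} {n : ℕ} [NeZero n]

section
variable (X : TreeCode Ξ n) (hn : Ξ.size = n + 1)
include hn

theorem height_lt_of_subset {e k : Fin n}
    (h : ∀ f, X.bot f ≤ e → e ≤ top X.white f → X.bot f ≤ k ∧ k ≤ top X.white f)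
    (h' : ¬ (X.bot k ≤ e ∧ e ≤ top X.white k)) :
    height X.word (e + 1) < height X.word (k + 1) := by
  rw [X.height_word_succ hn e e.isLt, X.height_word_succ hn k k.isLt]
  refine Finset.sum_lt_sum_of_subset (i := k) ?_ ?_ ?_ ?_ ?_
  · intro f
    simpa using h f
  · simpa using ⟨X.bot_le hn (Equiv.Perm.SameCycle.refl _ _), self_le_top _ _⟩
  · simpa using h'
  · exact_mod_cast (X.wt k).pos
  · intro f _ _
    positivity

/-- Every edge open at `e` stays open until the white vertex of `e` is finished, and `k` opens in
between. With `height_top_lt` this shows that the end of a white vertex is where the height first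
drops below its value at one of the edges. -/
theorem height_lt_of_le_top {e k : Fin n} (h1 : e < k) (h2 : k ≤ top X.white e) :
    height X.word (e + 1) < height X.word (k + 1) := by
  have hnc := X.noncrossing hn
  refine X.height_lt_of_subset hn (fun f hf hf' => ⟨hf.trans h1.le, ?_⟩) fun h3 => ?_
  · rcases le_or_gt f e with h3 | h3
    · exact h2.trans (hnc.top_le_top h3 hf')
    · exact h2.trans ((hnc.top_lt (X.bot_sameCycle f) hf h3).le.trans (self_le_top _ _))
  · exact absurd (hnc.top_lt (X.bot_sameCycle k) h3.1 h1) (not_lt.2 h2)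

theorem height_lt_of_bot_le {e k : Fin n} (h1 : k < e) (h2 : X.bot e ≤ k) :
    height X.word (e + 1) < height X.word (k + 1) := by
  have hnc := X.noncrossing hn
  refine X.height_lt_of_subset hn (fun f hf hf' => ⟨?_, h1.le.trans hf'⟩) fun h3 => ?_
  · by_contra hc
    rw [not_le] at hc
    have hb : (X.bot f).val ≠ 0 := by rw [Fin.lt_def] at hc; omega
    -- The edge just before the black vertex of `f` begins. Since that vertex is new, `white y` is
    -- its top edge, so the whole vertex lies in the span of the white vertex of `y`. That span ends
    -- before `e`, so `f` cannot be open at `e`.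
    set y : Fin n := ⟨(X.bot f).val - 1, by omega⟩ with hy
    have hy1 : y.val + 1 < n := by simp only [hy]; omega
    have hy2 : y + 1 = X.bot f := by ext; rw [val_add_one hy1]; simp only [hy]; omega
    have hy3 : y < X.white y := by
      rw [← X.bot_add_one_eq_iff hn hy1, hy2]
      exact (X.bot_congr hn (X.bot_sameCycle f)).symm
    have hy4 : top X.white y < e := by
      have hke : y < e := by simp only [hy, Fin.lt_def, Fin.le_def] at *; omega
      have hky : k ≤ y := by simp only [hy, Fin.lt_def, Fin.le_def] at *; omega
      exact hnc.top_lt (X.bot_sameCycle e) (h2.trans hky) hke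
    have hy5 : top (compl X.white) f = X.white y := by
      have h5 := hnc.right (X.white y) (by
        rw [compl_apply, Fin.le_def, val_add_one hy1]; exact hy3)
      rw [← h5, top_eq_iff]
      exact (X.bot_sameCycle f).trans (hy2 ▸ (X.white_sameCycle_add_one y).symm)
    have hy6 : X.white y ≤ top X.white y := le_top (by simp [Equiv.Perm.SameCycle.refl])
    have hy7 := self_le_top (compl X.white) f
    have hy8 := X.bot_le hn (Equiv.Perm.SameCycle.refl _ f)
    have hy9 := hnc.top_le_top (f := y) (a := f) (by simp only [hy, Fin.lt_def, Fin.le_def] at *; omega)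
      (by rw [hy5] at hy7; exact hy7.trans hy6)
    exact absurd (hf'.trans hy9) (not_le.2 hy4)
  · exact absurd (hnc.top_lt (X.bot_sameCycle e) h2 h1) (not_lt.2 h3.2)

/-- No black vertex is entered at `M + 1`, because a white one has just been finished at `M`. An
edge open at `M + 1` whose black vertex began after `e` would lie in the span of the white vertex of
`e` and be closed by then. So all edges open at `M + 1` were open at `e`, but `e` itself is closed.
-/
theorem height_top_lt {e : Fin n} (h : (top X.white e).val + 1 < n) :
    height X.word (top X.white e + 2) < height X.word (e + 1) := by
  have hnc := X.noncrossing hn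
  set M := top X.white e with hM
  have h0 := X.bot_add_one_eq_iff hn h
  have hM' : X.white M ≤ M := apply_le_of_top (top_top _ _)
  have heM : e ≤ M := self_le_top _ _
  have h1 := X.height_lt_of_subset hn (e := M + 1) (k := e)
  rw [val_add_one h] at h1
  refine h1 (fun f hf hf' => ⟨?_, ?_⟩) fun h3 => ?_
  · by_contra hc
    rw [not_le] at hc
    have hb : (X.bot f).val ≠ 0 := by rw [Fin.lt_def] at hc; omega
    have hbM : X.bot f ≠ M + 1 := by
      intro h2
      have h3 := X.bot_congr hn (X.bot_sameCycle f)
      rw [h2] at h3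
      exact absurd (h0.1 h3.symm) (not_lt.2 hM')
    set y : Fin n := ⟨(X.bot f).val - 1, by omega⟩ with hy
    have hy1 : y.val + 1 < n := by simp only [hy]; omega
    have hy2 : y + 1 = X.bot f := by ext; rw [val_add_one hy1]; simp only [hy]; omega
    have hy3 : y < X.white y := by
      rw [← X.bot_add_one_eq_iff hn hy1, hy2]
      exact (X.bot_congr hn (X.bot_sameCycle f)).symm
    have hyM : y ≤ M := by
      simp only [hy, Fin.lt_def, Fin.le_def, Fin.ext_iff, ne_eq, val_add_one h] at *; omega
    have hey : e ≤ y := by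
      simp only [hy, Fin.lt_def, Fin.le_def, Fin.ext_iff, ne_eq, val_add_one h] at *; omega
    have hy4 : top X.white y ≤ M := hnc.top_le_top hey hyM
    have hy5 : top (compl X.white) f = X.white y := by
      have h5 := hnc.right (X.white y) (by
        rw [compl_apply, Fin.le_def, val_add_one hy1]; exact hy3)
      rw [← h5, top_eq_iff]
      exact (X.bot_sameCycle f).trans (hy2 ▸ (X.white_sameCycle_add_one y).symm)
    have hy6 : X.white y ≤ top X.white y := le_top (by simp [Equiv.Perm.SameCycle.refl])
    have hy7 := self_le_top (compl X.white) f
    have hy8 := X.bot_le hn (Equiv.Perm.SameCycle.refl _ f)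
    have hy9 := hnc.top_le_top (f := e) (a := f) (hc.le.trans hy8)
      (by rw [hy5] at hy7; exact hy7.trans (hy6.trans hy4))
    rw [← hM] at hy9
    simp only [Fin.lt_def, Fin.le_def, Fin.ext_iff, ne_eq, val_add_one h] at *; omega
  · simp only [Fin.lt_def, Fin.le_def, Fin.ext_iff, val_add_one h] at *; omega
  · have := h3.2
    simp only [Fin.lt_def, Fin.le_def, Fin.ext_iff, val_add_one h] at *; omega

theorem word_bot (i : Fin n) : X.word (X.bot i).castSucc = Sum.inl (X.lb i) := by
  have h1 := X.labeling_black.eq_of_sameCycle (X.bot_sameCycle i)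
  rcases Nat.eq_zero_or_pos (X.bot i).val with h2 | h2
  · have h3 : X.bot i = 0 := by ext; simpa using h2
    rw [h1, h3]
    rfl
  · set y : Fin n := ⟨(X.bot i).val - 1, by omega⟩ with hy
    have hy1 : y.val + 1 < n := by simp only [hy]; omega
    have hy2 : y + 1 = X.bot i := by ext; rw [val_add_one hy1]; simp only [hy]; omega
    have hy3 : y < X.white y := by
      rw [← X.bot_add_one_eq_iff hn hy1, hy2]
      exact (X.bot_congr hn (X.bot_sameCycle i)).symm
    have hy4 : (X.bot i).castSucc = y.succ := by ext; simp [hy]; omega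
    rw [hy4]
    simp only [word, Fin.cases_succ]
    rw [if_neg (not_le.2 hy3), hy2, ← h1]

omit hn in
theorem word_top (i : Fin n) : X.word (top X.white i).succ = Sum.inr (X.lw i) := by
  simp only [word, Fin.cases_succ]
  rw [if_pos (apply_le_of_top (top_top _ _)),
    ← X.labeling_white.eq_of_sameCycle (top_sameCycle X.white i)]

end

theorem word_injective (hn : Ξ.size = n + 1) :
    Function.Injective (word : TreeCode Ξ n → _) := by
  intro X Y h
  -- If the white vertex of `e` ended later in `X` than in `Y`, the common height just past its end
  -- in `Y` would be above the value at `e` by `X` and below it by `Y`.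
  have key : ∀ X Y : TreeCode Ξ n, X.word = Y.word → ∀ e, top X.white e ≤ top Y.white e := by
    intro X Y h e
    by_contra hc
    rw [not_le] at hc
    have h1 := Y.height_top_lt hn (e := e) (by rw [Fin.lt_def] at hc; omega)
    have h3 : (top Y.white e).val + 1 < n := by rw [Fin.lt_def] at hc; omega
    have h2 := X.height_lt_of_le_top hn (e := e) (k := top Y.white e + 1)
      (by rw [Fin.lt_def, val_add_one h3]; have := self_le_top Y.white e; rw [Fin.le_def] at this; omega)
      (by rw [Fin.le_def, val_add_one h3]; exact hc)
    rw [val_add_one h3, h] at h2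
    exact lt_asymm h1 h2
  have ht : ∀ e, top X.white e = top Y.white e := fun e => le_antisymm (key X Y h e) (key Y X h.symm e)
  have hw : X.white = Y.white :=
    (X.noncrossing hn).left.eq_of_sameCycle (Y.noncrossing hn).left fun i j => by
      rw [← top_eq_iff, ← top_eq_iff, ht, ht]
  have hbot : ∀ e, X.bot e = Y.bot e := fun e => by rw [bot, bot, hw]
  have hlw : X.lw = Y.lw := by
    funext e
    have h1 := X.word_top e
    have h2 := Y.word_top e
    rw [h, ht, h2] at h1
    exact (Sum.inr.inj h1).symm
  have hlb : X.lb = Y.lb := by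
    funext e
    have h1 := X.word_bot hn e
    have h2 := Y.word_bot hn e
    rw [h, hbot, h2] at h1
    exact (Sum.inl.inj h1).symm
  -- The height at `e` is `wt e` plus the weights of the other edges open there, and these have
  -- smaller heights; so the weights are recovered by induction on the height.
  have hwt : ∀ (N : ℕ) (e : Fin n), (height X.word (e + 1)).toNat = N → X.wt e = Y.wt e := by
    intro N
    induction N using Nat.strong_induction_on with
    | _ N ih =>
    intro e he
    have h1 := X.height_word_succ hn e e.isLt
    have h2 := Y.height_word_succ hn e e.isLt
    rw [← h, ← hw] at h2
    simp only [← hbot] at h2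
    have hmem : e ∈ univ.filter fun f => X.bot f ≤ ⟨e.val, e.isLt⟩ ∧ ⟨e.val, e.isLt⟩ ≤ top X.white f := by
      simpa using ⟨X.bot_le hn (Equiv.Perm.SameCycle.refl _ _), self_le_top _ _⟩
    rw [← Finset.add_sum_erase _ _ hmem] at h1 h2
    have h3 : ∀ f ∈ (univ.filter fun f => X.bot f ≤ ⟨e.val, e.isLt⟩ ∧ ⟨e.val, e.isLt⟩ ≤ top X.white f).erase e,
        (X.wt f : ℤ) = Y.wt f := by
      intro f hf
      simp only [mem_erase, mem_filter, mem_univ, true_and] at hf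
      have h4 : height X.word (f + 1) < height X.word (e + 1) := by
        rcases lt_or_gt_of_ne hf.1 with h5 | h5
        · exact X.height_lt_of_le_top hn h5 hf.2.2
        · exact X.height_lt_of_bot_le hn h5 hf.2.1
      have h5 := X.height_word_pos hn f f.isLt
      rw [ih _ (by omega) f rfl]
    rw [Finset.sum_congr rfl h3] at h1
    have h4 : (X.wt e : ℤ) = Y.wt e := by
      have := h1.symm.trans h2
      exact add_right_cancel this
    exact PNat.eq (by exact_mod_cast h4)
  exact TreeCode.ext hw (funext fun e => hwt _ e rfl) hlw hlb

end TreeCode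

end

/-! ### Contours: openings, closings and edge weights read off a height function. -/

section

open CyclePerm Finset

namespace CyclePerm

variable {n : ℕ}

theorem SingleDescent.apply_eq_of_next {σ : Equiv.Perm (Fin n)} (h : SingleDescent σ) {i j : Fin n}
    (hc : σ.SameCycle i j) (hij : i < j) (hk : ∀ k, σ.SameCycle i k → i < k → j ≤ k) : σ i = j := by
  have h1 := h.lt_apply hc hij
  have h2 := hk (σ i) (by simp [Equiv.Perm.SameCycle.refl]) h1
  rcases eq_or_lt_of_le h2 with h3 | h3
  · exact h3.symm
  · exact (h.not_between hc hij h3).elim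

theorem SingleDescent.apply_eq_of_wrap {σ : Equiv.Perm (Fin n)} (h : SingleDescent σ) {i j : Fin n}
    (hc : σ.SameCycle i j) (h1 : ∀ k, σ.SameCycle i k → k ≤ i) (h2 : ∀ k, σ.SameCycle i k → j ≤ k) :
    σ i = j := by
  have h3 : top σ i = i := le_antisymm (h1 _ (top_sameCycle σ i)) (self_le_top _ _)
  have h4 := h.apply_top_le hc
  rw [h3] at h4
  exact le_antisymm h4 (h2 _ (by simp [Equiv.Perm.SameCycle.refl]))

/-- There is a permutation whose cycles are the fibres of `g`, traversed increasingly. -/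
theorem exists_perm_fibers {α : Type*} (g : Fin n → α) : ∃ σ : Equiv.Perm (Fin n),
    (∀ i j, σ.SameCycle i j ↔ g i = g j) ∧ SingleDescent σ := by
  classical
  have hex : ∀ i, ∃ j, g j = g i ∧ ((i < j ∧ ∀ k, g k = g i → i < k → j ≤ k) ∨
      ((∀ k, g k = g i → k ≤ i) ∧ ∀ k, g k = g i → j ≤ k)) := by
    intro i
    by_cases h : (univ.filter fun j => g j = g i ∧ i < j).Nonempty
    · have h1 := Finset.min'_mem _ h
      simp only [mem_filter, mem_univ, true_and] at h1
      refine ⟨_, h1.1, Or.inl ⟨h1.2, fun k hk hk' => Finset.min'_le _ _ (by simpa using ⟨hk, hk'⟩)⟩⟩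
    · have h2 : (univ.filter fun j => g j = g i).Nonempty := ⟨i, by simp⟩
      have h1 := Finset.min'_mem _ h2
      simp only [mem_filter, mem_univ, true_and] at h1
      refine ⟨_, h1, Or.inr ⟨fun k hk => ?_, fun k hk => Finset.min'_le _ _ (by simpa using hk)⟩⟩
      by_contra hc
      exact h ⟨k, by simpa using ⟨hk, not_le.1 hc⟩⟩
  choose f hf hf' using hex
  have hinj : Function.Injective f := by
    intro i j hij
    have hgij : g i = g j := by rw [← hf i, ← hf j, hij]
    rcases hf' i with ⟨h1, h2⟩ | ⟨h1, h2⟩ <;> rcases hf' j with ⟨h3, h4⟩ | ⟨h3, h4⟩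
    · rcases lt_trichotomy i j with h | h | h
      · have := h2 j hgij.symm h; omega
      · exact h
      · have := h4 i hgij h; omega
    · have := h4 i hgij; omega
    · have := h2 j hgij.symm; omega
    · have := h1 j hgij.symm; have := h3 i hgij; omega
  let σ : Equiv.Perm (Fin n) := Equiv.ofBijective f (Finite.injective_iff_bijective.1 hinj)
  have hσ : ∀ i, σ i = f i := fun _ => rfl
  have hg : ∀ i j, σ.SameCycle i j → g i = g j := by
    intro i j hc
    obtain ⟨k, -, rfl⟩ := hc.exists_pow_eq'
    clear hc
    induction k with
    | zero => rfl
    | succ k ih => rw [pow_succ', Equiv.Perm.mul_apply, hσ, hf, ← ih]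
  -- Iterating `σ` climbs to the maximum of the fibre, so all elements of a fibre lie in the cycle
  -- of its maximum.
  have hmax : ∀ (d : ℕ) (i : Fin n), n - i.val = d →
      ∃ m, σ.SameCycle i m ∧ ∀ k, g k = g i → k ≤ m := by
    intro d
    induction d using Nat.strong_induction_on with
    | _ d ih =>
    intro i hd
    rcases hf' i with ⟨h1, h2⟩ | ⟨h1, h2⟩
    · obtain ⟨m, hm, hm'⟩ := ih (n - (f i).val) (by rw [Fin.lt_def] at h1; omega) (f i) rfl
      refine ⟨m, ?_, fun k hk => hm' k (hk.trans (hf i).symm)⟩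
      rw [← hσ] at hm
      simpa using hm
    · exact ⟨i, Equiv.Perm.SameCycle.refl _ _, h1⟩
  refine ⟨σ, fun i j => ⟨hg i j, fun hij => ?_⟩, fun i hi => ?_⟩
  · obtain ⟨a, ha, ha'⟩ := hmax _ i rfl
    obtain ⟨b, hb, hb'⟩ := hmax _ j rfl
    have : a = b := le_antisymm (hb' a ((hg _ _ ha).symm.trans hij))
      (ha' b ((hg _ _ hb).symm.trans hij.symm))
    exact ha.trans (this ▸ hb.symm)
  · rcases hf' i with ⟨h1, h2⟩ | ⟨h1, h2⟩
    · rw [hσ] at hi; omega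
    · exact le_antisymm (h1 _ (hg _ _ (top_sameCycle σ i)).symm) (self_le_top _ _)

end CyclePerm

/-- A height function that is positive and injective strictly between its zeros `0`, `n + 1`. -/
structure IsContour (H : ℕ → ℤ) (n : ℕ) : Prop where
  zero : H 0 = 0
  last : H (n + 1) = 0
  pos : ∀ k, 1 ≤ k → k ≤ n → 0 < H k
  inj : ∀ j k, 1 ≤ j → j ≤ n → 1 ≤ k → k ≤ n → H j = H k → j = k

/-- The step `N ↦ N + 1` is the first one that goes below the height at `e + 1`. -/
def ClosesAt (H : ℕ → ℤ) {n : ℕ} (e : Fin n) (N : Fin (n + 1)) : Prop :=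
  e.val < N.val ∧ H (N + 1) < H (e + 1) ∧ ∀ k, e.val + 1 < k → k ≤ N.val → H (e + 1) < H k

/-- The step `K ↦ K + 1` is the last one before `e + 1` that starts below its height. -/
def OpensAt (H : ℕ → ℤ) {n : ℕ} (e : Fin n) (K : Fin (n + 1)) : Prop :=
  K.val ≤ e.val ∧ H K < H (e + 1) ∧ ∀ k, K.val < k → k ≤ e.val → H (e + 1) < H k

theorem ClosesAt.unique {H : ℕ → ℤ} {n : ℕ} {e : Fin n} {N N' : Fin (n + 1)} (h : ClosesAt H e N)
    (h' : ClosesAt H e N') : N = N' := by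
  obtain ⟨a, b, c⟩ := h
  obtain ⟨a', b', c'⟩ := h'
  rcases lt_trichotomy N.val N'.val with h | h | h
  · have := c' (N + 1) (by omega) (by omega); omega
  · exact Fin.ext h
  · have := c (N' + 1) (by omega) (by omega); omega

theorem OpensAt.unique {H : ℕ → ℤ} {n : ℕ} {e : Fin n} {N N' : Fin (n + 1)} (h : OpensAt H e N)
    (h' : OpensAt H e N') : N = N' := by
  obtain ⟨a, b, c⟩ := h
  obtain ⟨a', b', c'⟩ := h'
  rcases lt_trichotomy N.val N'.val with h | h | h
  · have := c N' h a'; omega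
  · exact Fin.ext h
  · have := c' N h a; omega

namespace IsContour

variable {H : ℕ → ℤ} {n : ℕ}

/-- Reading a contour backwards exchanges openings and closings, so statements on `OpensAt` follow
from those on `ClosesAt`. -/
theorem reverse (h : IsContour H n) : IsContour (fun k => H (n + 1 - k)) n where
  zero := h.last
  last := by simpa using h.zero
  pos := fun k h1 h2 => h.pos _ (by omega) (by omega)
  inj := fun j k h1 h2 h3 h4 h5 => by
    have := h.inj _ _ (by omega) (by omega) (by omega) (by omega) h5
    omega

theorem closesAt_reverse {e : Fin n} {K : Fin (n + 1)} :
    ClosesAt (fun k => H (n + 1 - k)) e.rev K.rev ↔ OpensAt H e K := by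
  have h1 : n + 1 - (n - (e.val + 1) + 1) = e.val + 1 := by omega
  have h2 : n + 1 - (n + 1 - (K.val + 1) + 1) = K.val := by omega
  simp only [ClosesAt, OpensAt, Fin.val_rev, h1, h2]
  refine and_congr (by omega) (and_congr Iff.rfl ⟨fun h k hk hk' => ?_, fun h k hk hk' => ?_⟩)
  · have := h (n + 1 - k) (by omega) (by omega)
    rwa [show n + 1 - (n + 1 - k) = k by omega] at this
  · exact h (n + 1 - k) (by omega) (by omega)

theorem opensAt_reverse {e : Fin n} {K : Fin (n + 1)} :
    OpensAt (fun k => H (n + 1 - k)) e.rev K.rev ↔ ClosesAt H e K := by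
  have h1 : n + 1 - (n - (e.val + 1) + 1) = e.val + 1 := by omega
  have h2 : n + 1 - (n + 1 - (K.val + 1)) = K.val + 1 := by omega
  simp only [ClosesAt, OpensAt, Fin.val_rev, h1, h2]
  refine and_congr (by omega) (and_congr Iff.rfl ⟨fun h k hk hk' => ?_, fun h k hk hk' => ?_⟩)
  · have := h (n + 1 - k) (by omega) (by omega)
    rwa [show n + 1 - (n + 1 - k) = k by omega] at this
  · exact h (n + 1 - k) (by omega) (by omega)

variable (h : IsContour H n)
include h

theorem nonneg {k : ℕ} (hk : k ≤ n + 1) : 0 ≤ H k := by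
  rcases Nat.eq_zero_or_pos k with rfl | h1
  · exact h.zero.ge
  · rcases eq_or_lt_of_le hk with rfl | h2
    · exact h.last.ge
    · exact (h.pos k h1 (by omega)).le

theorem exists_closesAt (e : Fin n) : ∃ N, ClosesAt H e N := by
  classical
  have hex : ∃ k, e.val < k ∧ H (k + 1) < H (e + 1) :=
    ⟨n, e.isLt, by rw [h.last]; exact h.pos _ (by omega) (by omega)⟩
  have h1 := Nat.find_spec hex
  have h2 : Nat.find hex ≤ n :=
    Nat.find_le ⟨e.isLt, by rw [h.last]; exact h.pos _ (by omega) (by omega)⟩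
  refine ⟨⟨Nat.find hex, by omega⟩, h1.1, h1.2, fun k hk hk' => ?_⟩
  have h3 := Nat.find_min hex (m := k - 1) (by simp only at hk'; omega)
  simp only at hk'
  rw [show k - 1 + 1 = k by omega] at h3
  have h4 : H (e + 1) ≤ H k := by
    by_contra hc
    exact h3 ⟨by omega, not_le.1 hc⟩
  refine lt_of_le_of_ne h4 fun h5 => ?_
  have := h.inj _ _ (by omega) (by omega) (by omega) (by omega) h5
  omega

theorem exists_opensAt (e : Fin n) : ∃ K, OpensAt H e K := by
  obtain ⟨N, hN⟩ := h.reverse.exists_closesAt e.rev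
  refine ⟨N.rev, ?_⟩
  rw [← closesAt_reverse, Fin.rev_rev]
  exact hN

/-- The lowest point of a nonempty open interval. -/
theorem exists_lowest {a b : ℕ} (hab : a + 1 < b) (hb : b ≤ n + 1) :
    ∃ e : Fin n, a < e.val + 1 ∧ e.val + 1 < b ∧
      ∀ k, a < k → k < b → k ≠ e.val + 1 → H (e + 1) < H k := by
  obtain ⟨m, hm, hmin⟩ := (Finset.Ioo a b).exists_min_image H ⟨a + 1, by simp; omega⟩
  simp only [Finset.mem_Ioo] at hm hmin
  refine ⟨⟨m - 1, by omega⟩, by simp only; omega, by simp only; omega, fun k h1 h2 h3 => ?_⟩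
  simp only at h3
  simp only [show m - 1 + 1 = m by omega] at h3 ⊢
  refine lt_of_le_of_ne (hmin k ⟨h1, h2⟩) fun h4 => h3 ?_
  exact (h.inj _ _ (by omega) (by omega) (by omega) (by omega) h4).symm

/-- The last point before `N` that is at height at most `l`. -/
theorem exists_last_le {N : ℕ} {l : ℤ} (hl : 0 ≤ l) (hN : 0 < N) :
    ∃ K, K < N ∧ H K ≤ l ∧ ∀ k, K < k → k < N → l < H k := by
  have hne : ((Finset.range N).filter fun k => H k ≤ l).Nonempty :=
    ⟨0, by simp [h.zero, hl, hN]⟩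
  have h1 := Finset.max'_mem _ hne
  simp only [mem_filter, mem_range] at h1
  refine ⟨_, h1.1, h1.2, fun k hk hk' => ?_⟩
  by_contra hc
  have := Finset.le_max' ((Finset.range N).filter fun k => H k ≤ l) k (by
    simp only [mem_filter, mem_range]; exact ⟨hk', not_lt.1 hc⟩)
  omega

/-- The summand will be the weight of the edge `e`. The down step at `N` crosses the levels in `(H
(N + 1), H N]`; each level `l` is assigned to the lowest point of the excursion above `l - 1` that
ends at `N`. The levels assigned to an edge `e` closing at `N` form the interval from the larger of
its two neighbouring lower heights up to `H (e + 1)`. -/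
theorem sum_closesAt {nx pv : Fin n → Fin (n + 1)} (hnx : ∀ e, ClosesAt H e (nx e))
    (hpv : ∀ e, OpensAt H e (pv e)) {N : Fin (n + 1)} (hN : 0 < N.val) (hd : H (N + 1) < H N) :
    ∑ e with nx e = N, (H (e + 1) - max (H (pv e)) (H (nx e + 1))) = H N - H (N + 1) := by
  classical
  have hNn := N.isLt
  have h0 : 0 ≤ H (N + 1) := h.nonneg (by omega)
  have h1 : Finset.Ioc (H (N + 1)) (H N) = (univ.filter fun e => nx e = N).biUnion
      fun e => Finset.Ioc (max (H (pv e)) (H (nx e + 1))) (H (e + 1)) := by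
    ext l
    simp only [Finset.mem_Ioc, mem_biUnion, mem_filter, mem_univ, true_and, sup_lt_iff]
    constructor
    · rintro ⟨h2, h3⟩
      obtain ⟨K, hK1, hK2, hK3⟩ := h.exists_last_le (N := N + 1) (l := l - 1) (by omega) (by omega)
      have hKN : K + 1 < N + 1 := by
        rcases eq_or_ne K N.val with h4 | h4
        · rw [h4] at hK2; omega
        · omega
      obtain ⟨e, he1, he2, he3⟩ := h.exists_lowest (a := K) (b := N + 1) hKN (by omega)
      have he4 := hK3 (e + 1) he1 he2
      have hcl : ClosesAt H e N := ⟨by omega, by omega, fun k hk hk' =>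
        he3 k (by omega) (by omega) (by omega)⟩
      have hop : OpensAt H e ⟨K, by omega⟩ := ⟨by simp only; omega, by simp only; omega,
        fun k hk hk' => he3 k hk (by omega) (by omega)⟩
      have e1 := (hnx e).unique hcl
      have e2 := (hpv e).unique hop
      refine ⟨e, e1, ?_⟩
      rw [e1, e2]
      exact ⟨⟨by simp only; omega, h2⟩, by omega⟩
    · rintro ⟨e, rfl, ⟨h2, h3⟩, h4⟩
      obtain ⟨a, b, c⟩ := hnx e
      refine ⟨h3, ?_⟩
      rcases eq_or_ne (e.val + 1) (nx e).val with h5 | h5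
      · rw [← h5]; exact h4
      · have := c (nx e) (by omega) le_rfl; omega
  have h2 := congrArg Finset.card h1
  rw [Finset.card_biUnion] at h2
  · simp only [Int.card_Ioc] at h2
    have h3 := congrArg (Nat.cast : ℕ → ℤ) h2
    rw [Nat.cast_sum, Int.toNat_of_nonneg (by omega)] at h3
    rw [h3]
    refine Finset.sum_congr rfl fun e _ => ?_
    rw [Int.toNat_of_nonneg]
    have := (hnx e).2.1
    have := (hpv e).2.1
    omega
  · intro e he e' he' hne
    simp only [coe_filter, mem_univ, true_and, Set.mem_ofPred_eq] at he he'
    rw [Function.onFun, Finset.disjoint_left]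
    intro l hl hl'
    simp only [Finset.mem_Ioc, sup_lt_iff] at hl hl'
    obtain ⟨a, b, c⟩ := hnx e
    obtain ⟨a', b', c'⟩ := hnx e'
    obtain ⟨x, y, z⟩ := hpv e
    obtain ⟨x', y', z'⟩ := hpv e'
    rw [he] at *; rw [he'] at *
    have hv : e.val ≠ e'.val := fun hc => hne (Fin.ext hc)
    -- For edges `e < e'` closing at the same step, `e'` opens no lower than the height of `e`, so
    -- their level intervals are stacked without overlap.
    have key : ∀ (e e' : Fin n), e.val < e'.val → e'.val < N.val →
        (∀ k, e.val + 1 < k → k ≤ N.val → H (e + 1) < H k) → H (pv e') < H (e' + 1) →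
        (∀ k, (pv e').val < k → k ≤ e'.val → H (e' + 1) < H k) → (pv e').val ≤ e'.val →
        H (e + 1) ≤ H (pv e') := by
      intro e e' h1 h2 h3 h4 h5 h6
      have h7 := h3 (e' + 1) (by omega) (by omega)
      have h8 : e.val + 1 ≤ (pv e').val := by
        by_contra hc
        have := h5 (e + 1) (by omega) (by omega)
        omega
      rcases eq_or_lt_of_le h8 with h9 | h9
      · rw [h9]
      · exact (h3 _ h9 (by omega)).le
    rcases lt_or_gt_of_ne hv with h5 | h5
    · have := key e e' h5 a' c y' z' x'; omega
    · have := key e' e h5 a c' y z x; omega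

theorem sum_opensAt {nx pv : Fin n → Fin (n + 1)} (hnx : ∀ e, ClosesAt H e (nx e))
    (hpv : ∀ e, OpensAt H e (pv e)) {K : Fin (n + 1)} (hK : K.val < n) (hd : H K < H (K + 1)) :
    ∑ e with pv e = K, (H (e + 1) - max (H (pv e)) (H (nx e + 1))) = H (K + 1) - H K := by
  have h1 := h.reverse.sum_closesAt (nx := fun e => (pv e.rev).rev) (pv := fun e => (nx e.rev).rev)
    (fun e => by have := closesAt_reverse.2 (hpv e.rev); rwa [Fin.rev_rev] at this)
    (fun e => by have := opensAt_reverse.2 (hnx e.rev); rwa [Fin.rev_rev] at this)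
    (N := K.rev) (by rw [Fin.val_rev]; omega) (by
      rw [Fin.val_rev]
      rwa [show n + 1 - (n + 1 - (K.val + 1) + 1) = K.val by omega,
        show n + 1 - (n + 1 - (K.val + 1)) = K.val + 1 by omega])
  rw [Fin.val_rev, show n + 1 - (n + 1 - (K.val + 1) + 1) = K.val by omega,
        show n + 1 - (n + 1 - (K.val + 1)) = K.val + 1 by omega] at h1
  rw [← h1, Finset.sum_filter, Finset.sum_filter, ← Equiv.sum_comp Fin.revPerm]
  refine Finset.sum_congr rfl fun e _ => ?_
  simp only [Fin.revPerm_apply, Fin.rev_inj, Fin.val_rev]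
  have h2 := (pv e.rev).isLt
  have h3 := (nx e.rev).isLt
  rw [show n + 1 - (e.val + 1) = n - (e.val + 1) + 1 by omega,
    show n + 1 - (n + 1 - ((pv e.rev).val + 1) + 1) = (pv e.rev).val by omega,
    show n + 1 - (n + 1 - ((nx e.rev).val + 1)) = (nx e.rev).val + 1 by omega, max_comm, max_comm]

end IsContour

end

/-! ### Every positive path with distinct heights comes from a code. -/

section

open CyclePerm Finset

namespace IsContour

variable {H : ℕ → ℤ} {n : ℕ} [NeZero n] (h : IsContour H n) {nx pv : Fin n → Fin (n + 1)}
  (hnx : ∀ e, ClosesAt H e (nx e)) (hpv : ∀ e, OpensAt H e (pv e)) {σ τ : Equiv.Perm (Fin n)}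
  (hσ : ∀ i j, σ.SameCycle i j ↔ nx i = nx j) (hσ' : SingleDescent σ)
  (hτ : ∀ i j, τ.SameCycle i j ↔ pv i = pv j) (hτ' : SingleDescent τ)
include h hnx hpv hσ hσ' hτ hτ'

/-- The edge `σ e` is the lowest point `f` between `e + 1` and the step closing `e`: it is the next
edge closing there. Both `f` and `e + 1` open at the up step from `e + 1`, as its last and its first
edge, so `τ` wraps from `f` to `e + 1`. -/
theorem apply_of_lt {e : Fin n} (hn : e.val + 1 < n) (hlt : H (e + 1) < H (e + 1 + 1)) :
    e < σ e ∧ τ (σ e) = e + 1 := by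
  obtain ⟨a1, a2, a3⟩ := hnx e
  have hne : e.val + 1 < (nx e).val := by
    rcases eq_or_lt_of_le (show e.val + 1 ≤ (nx e).val from a1) with h1 | h1
    · rw [← h1] at a2; omega
    · exact h1
  have hN := (nx e).isLt
  obtain ⟨f, f1, f2, f3⟩ := h.exists_lowest (a := e.val + 1) (b := (nx e).val + 1)
    (by omega) (by omega)
  have f4 : nx f = nx e := (hnx f).unique ⟨by omega, by have := a3 (f + 1) (by omega) (by omega); omega,
    fun k hk hk' => f3 k (by omega) (by omega) (by omega)⟩
  have hef : e < f := by rw [Fin.lt_def]; omega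
  have h1 : σ e = f := hσ'.apply_eq_of_next ((hσ _ _).2 f4.symm) hef fun k hk hk' => by
    rw [hσ] at hk
    by_contra hc
    rw [Fin.lt_def] at hk'
    rw [not_le, Fin.lt_def] at hc
    obtain ⟨b1, b2, b3⟩ := hnx k
    have := b3 (f + 1) (by omega) (by rw [← hk]; omega)
    have := f3 (k + 1) (by omega) (by omega) (by omega)
    omega
  refine ⟨h1 ▸ hef, ?_⟩
  have hv := val_add_one hn
  have f5 : pv f = ⟨e + 1, by omega⟩ := (hpv f).unique ⟨by simp only; omega,
    by have := a3 (f + 1) (by omega) (by omega); exact this,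
    fun k hk hk' => f3 k hk (by omega) (by omega)⟩
  have f6 : pv (e + 1) = ⟨e + 1, by omega⟩ := (hpv (e + 1)).unique ⟨by rw [hv],
    by rw [hv]; exact hlt, fun k hk hk' => by simp only at hk; omega⟩
  rw [h1]
  refine hτ'.apply_eq_of_wrap ((hτ _ _).2 (f5.trans f6.symm)) (fun k hk => ?_) fun k hk => ?_
  · rw [hτ, f5] at hk
    obtain ⟨b1, b2, b3⟩ := hpv k
    rw [← hk] at b1 b2 b3
    simp only at b1 b2 b3
    rw [Fin.le_def]
    by_contra hc
    have b4 := b3 (f + 1) (by omega) (by omega)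
    rcases le_or_gt (k.val + 1) (nx e).val with h5 | h5
    · have := f3 (k + 1) (by omega) (by omega) (by omega); omega
    · have := b3 (nx e + 1) (by omega)
      rcases eq_or_lt_of_le (show (nx e).val + 1 ≤ k.val + 1 by omega) with h6 | h6
      · rw [h6] at a2; omega
      · have := this (by omega); omega
  · rw [hτ, f5] at hk
    have := (hpv k).1
    rw [← hk] at this
    rw [Fin.le_def, hv]; exact this

/-- The edge `e` is the last one closed by this down step, so `σ` wraps to the first one: the lowest
point `f` after the last position `K` whose height is at most the level reached. Both `f` and `e +
1` open at `K` and are consecutive there, except at the end of the contour. -/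
theorem apply_of_gt {e : Fin n} (hlt : H (e + 1 + 1) < H (e + 1)) :
    σ e ≤ e ∧ τ (σ e) = e + 1 := by
  have hnxe : nx e = e.succ := (hnx e).unique ⟨by simp, by simpa using hlt, fun k hk hk' => by
    simp at hk'; omega⟩
  have hpos : 0 ≤ H (e + 1 + 1) := h.nonneg (by omega)
  obtain ⟨K, K1, K2, K3⟩ := h.exists_last_le (N := e + 1 + 1) hpos (by omega)
  have hK : K + 1 < e + 1 + 1 := by
    rcases eq_or_ne K (e + 1) with h1 | h1
    · rw [h1] at K2; omega
    · omega
  obtain ⟨f, f1, f2, f3⟩ := h.exists_lowest hK (by omega)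
  have hf := K3 (f + 1) f1 f2
  have f4 : nx f = e.succ := (hnx f).unique ⟨by simp only [Fin.val_succ]; omega,
    by simpa using hf, fun k hk hk' => by
      simp only [Fin.val_succ] at hk'
      exact f3 k (by omega) (by omega) (by omega)⟩
  have f5 : pv f = ⟨K, by omega⟩ := (hpv f).unique ⟨by simp only; omega, by simp only; omega,
    fun k hk hk' => f3 k hk (by omega) (by omega)⟩
  have hfe : f ≤ e := by rw [Fin.le_def]; omega
  have h1 : σ e = f := by
    refine hσ'.apply_eq_of_wrap ((hσ _ _).2 (hnxe.trans f4.symm)) (fun k hk => ?_) fun k hk => ?_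
    · rw [hσ, hnxe] at hk
      have := (hnx k).1
      rw [← hk, Fin.val_succ] at this
      rw [Fin.le_def]; omega
    · rw [hσ, hnxe] at hk
      obtain ⟨b1, b2, b3⟩ := hnx k
      rw [← hk, Fin.val_succ] at b1 b2 b3
      rw [Fin.le_def]
      by_contra hc
      have b4 := b3 (f + 1) (by omega) (by omega)
      rcases lt_trichotomy K (k.val + 1) with h2 | h2 | h2
      · have := f3 (k + 1) h2 (by omega) (by omega); omega
      · rw [h2] at K2; omega
      · have := b3 K h2 (by omega); omega
  refine ⟨h1 ▸ hfe, ?_⟩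
  rw [h1]
  have hmax : ∀ k, pv k = ⟨K, by omega⟩ → k.val < e.val + 1 → k ≤ f := by
    intro k hk hk'
    obtain ⟨b1, b2, b3⟩ := hpv k
    rw [hk] at b1 b2 b3
    simp only at b1 b2 b3
    rw [Fin.le_def]
    by_contra hc
    have := f3 (k + 1) (by omega) (by omega) (by omega)
    have := b3 (f + 1) (by omega) (by omega)
    omega
  -- For the last edge the path returns to level `0`, hence `K = 0`, and `e + 1` is the root edge
  -- `0`; so `τ` wraps around the root black vertex instead of moving up.
  rcases eq_or_lt_of_le (show e.val + 1 ≤ n by omega) with hn | hn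
  · have hv := val_add_one_last hn
    have hz : e + 1 = 0 := by ext; rw [hv]; simp
    have hl : H (e + 1 + 1) = 0 := by rw [hn]; exact h.last
    have hK0 : K = 0 := by
      by_contra hc
      have := h.pos K (by omega) (by omega)
      omega
    have f6 : pv (e + 1) = ⟨K, by omega⟩ := (hpv (e + 1)).unique ⟨by simp only; omega, by
      simp only [hv, hK0, h.zero]; exact h.pos _ le_rfl (by omega), fun k hk hk' => by
      simp only at hk; omega⟩
    refine hτ'.apply_eq_of_wrap ((hτ _ _).2 (f5.trans f6.symm)) (fun k hk => ?_) fun k hk => ?_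
    · rw [hτ, f5] at hk
      exact hmax k hk.symm (by omega)
    · rw [hz]; exact Fin.zero_le _
  · have hv := val_add_one hn
    have hlt' : H K < H (e + 1 + 1) := by
      refine lt_of_le_of_ne K2 fun hc => ?_
      rcases Nat.eq_zero_or_pos K with h2 | h2
      · have := h.pos (e + 1 + 1) (by omega) (by omega)
        rw [h2, h.zero] at hc; omega
      · have := h.inj _ _ h2 (by omega) (by omega) (by omega) hc
        omega
    have f6 : pv (e + 1) = ⟨K, by omega⟩ := (hpv (e + 1)).unique ⟨by simp only; omega, by
      simp only [hv]; exact hlt', fun k hk hk' => by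
      simp only [hv] at *; exact K3 k hk (by omega)⟩
    refine hτ'.apply_eq_of_next ((hτ _ _).2 (f5.trans f6.symm))
      (by rw [Fin.lt_def, hv]; omega) fun k hk hk' => ?_
    rw [hτ, f5] at hk
    by_contra hc
    rw [not_le, Fin.lt_def, hv] at hc
    exact absurd (hmax k hk.symm hc) (not_le.2 hk')

end IsContour

/-- The letters of `u` are the labeled weights of `Ξ`, the black ones on the left. -/
def IsWordOf {S : Type} {N : ℕ} (Ξ : LabeledPassport S) (u : Fin N → (ℕ+ × S) ⊕ (ℕ+ × S)) : Prop :=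
  (univ.val.map u) = Ξ.pos.map Sum.inl + Ξ.neg.map Sum.inr

section
variable {S : Type} [DecidableEq S] {N : ℕ} {Ξ : LabeledPassport S} {u : Fin N → (ℕ+ × S) ⊕ (ℕ+ × S)}

theorem isWordOf_iff : IsWordOf Ξ u ↔
    (∀ x, (univ.filter fun i => u i = Sum.inl x).card = Ξ.pos.count x) ∧
    (∀ x, (univ.filter fun i => u i = Sum.inr x).card = Ξ.neg.count x) := by
  have h1 : ∀ y, (univ.val.map u).count y = (univ.filter fun i => u i = y).card := by
    intro y
    rw [Multiset.count_map, Finset.card_def, Finset.filter_val]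
    simp only [eq_comm]
  have h2 : ∀ x : ℕ+ × S, (Ξ.pos.map Sum.inl + Ξ.neg.map (Sum.inr : _ → (ℕ+ × S) ⊕ (ℕ+ × S))).count (Sum.inl x) =
      Ξ.pos.count x := by
    intro x
    have h0 : (Ξ.neg.map (Sum.inr : _ → (ℕ+ × S) ⊕ (ℕ+ × S))).count (Sum.inl x) = 0 :=
      Multiset.count_eq_zero.2 (by simp)
    rw [Multiset.count_add, Multiset.count_map_eq_count' _ _ Sum.inl_injective, h0, add_zero]
  have h3 : ∀ x : ℕ+ × S, (Ξ.pos.map Sum.inl + Ξ.neg.map (Sum.inr : _ → (ℕ+ × S) ⊕ (ℕ+ × S))).count (Sum.inr x) =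
      Ξ.neg.count x := by
    intro x
    have h0 : (Ξ.pos.map (Sum.inl : _ → (ℕ+ × S) ⊕ (ℕ+ × S))).count (Sum.inr x) = 0 :=
      Multiset.count_eq_zero.2 (by simp)
    rw [Multiset.count_add, Multiset.count_map_eq_count' _ _ Sum.inr_injective, h0, zero_add]
  unfold IsWordOf
  rw [Multiset.ext]
  constructor
  · intro h
    exact ⟨fun x => by rw [← h1, h, h2], fun x => by rw [← h1, h, h3]⟩
  · rintro ⟨h4, h5⟩ (x | x)
    · rw [h1, h2, h4]
    · rw [h1, h3, h5]

end

namespace TreeCode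

variable {S : Type} [DecidableEq S] {Ξ : LabeledPassport S} {n : ℕ} [NeZero n]

/-- Black letters stand at the bottoms of the black cycles and white letters just after the tops of
the white ones, so each vertex is written once. -/
theorem isWordOf_word (X : TreeCode Ξ n) (hn : Ξ.size = n + 1) : IsWordOf Ξ X.word := by
  have hnc := X.noncrossing hn
  rw [isWordOf_iff]
  constructor
  · intro x
    rw [← X.labeling_black.card_tops_label x]
    symm
    refine Finset.card_bij (fun i _ => (X.bot i).castSucc) ?_ ?_ ?_
    · intro i hi
      simp only [mem_filter, mem_univ, true_and] at hi ⊢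
      rw [X.word_bot hn, hi.2]
    · intro i hi j hj hij
      simp only [mem_filter, mem_univ, true_and] at hi hj
      have h1 := (Fin.castSucc_injective n) hij
      rw [← hi.1, ← hj.1, top_eq_iff]
      exact (X.bot_sameCycle i).trans (h1 ▸ (X.bot_sameCycle j).symm)
    · intro k hk
      simp only [mem_filter, mem_univ, true_and] at hk
      have : ∃ y : Fin n, y.castSucc = k ∧ X.bot y = y := by
        revert hk
        refine Fin.cases ?_ (fun i => ?_) k
        · intro hk
          exact ⟨0, by simp, X.bot_zero hn⟩
        · intro hk
          simp only [word, Fin.cases_succ] at hk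
          split_ifs at hk with h1
          have h2 : i.val + 1 < n := by
            have := (X.white i).isLt
            rw [not_le, Fin.lt_def] at h1; omega
          refine ⟨i + 1, ?_, (X.bot_add_one_eq_iff hn h2).2 (not_le.1 h1)⟩
          ext; simp [val_add_one h2]
      obtain ⟨y, rfl, hy⟩ := this
      refine ⟨top (compl X.white) y, ?_, ?_⟩
      · simp only [mem_filter, mem_univ, true_and, top_top]
        rw [← X.labeling_black.eq_of_sameCycle (top_sameCycle _ y)]
        have := X.word_bot hn y
        rw [hy, hk] at this
        exact (Sum.inl.inj this).symm
      · rw [← X.bot_congr hn (top_sameCycle _ y), hy]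
  · intro x
    rw [← X.labeling_white.card_tops_label x]
    symm
    refine Finset.card_bij (fun i _ => i.succ) ?_ ?_ ?_
    · intro i hi
      simp only [mem_filter, mem_univ, true_and] at hi ⊢
      have := X.word_top i
      rwa [hi.1, hi.2] at this
    · intro i hi j hj hij
      exact Fin.succ_injective n hij
    · intro k hk
      simp only [mem_filter, mem_univ, true_and] at hk
      revert hk
      refine Fin.cases ?_ (fun i => ?_) k
      · intro hk
        simp [word] at hk
      · intro hk
        simp only [word, Fin.cases_succ] at hk
        split_ifs at hk with h1
        refine ⟨i, ?_, rfl⟩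
        simp only [mem_filter, mem_univ, true_and]
        exact ⟨hnc.left i h1, Sum.inr.inj hk⟩

/-- Every word with positive distinct heights comes from a tree. -/
theorem exists_word_eq {u : Fin (n + 1) → (ℕ+ × S) ⊕ (ℕ+ × S)} (hu : IsWordOf Ξ u)
    (hc : IsContour (height u) n) : ∃ X : TreeCode Ξ n, X.word = u := by
  obtain ⟨hu1, hu2⟩ := isWordOf_iff.1 hu
  choose nx hnx using hc.exists_closesAt
  choose pv hpv using hc.exists_opensAt
  obtain ⟨σ, hσ, hσ'⟩ := exists_perm_fibers nx
  obtain ⟨τ, hτ, hτ'⟩ := exists_perm_fibers pv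
  have hnxd : ∀ e, height u (nx e + 1) < height u (nx e) := by
    intro e
    obtain ⟨a, b, c⟩ := hnx e
    rcases eq_or_lt_of_le (show e.val + 1 ≤ (nx e).val from a) with h1 | h1
    · rwa [h1] at b
    · exact b.trans (c _ h1 le_rfl)
  have hpvd : ∀ e, height u (pv e) < height u (pv e + 1) := by
    intro e
    obtain ⟨a, b, c⟩ := hpv e
    rcases eq_or_lt_of_le a with h1 | h1
    · rw [← h1] at b; exact b
    · exact b.trans (c _ (by omega) (by omega))
  have hinr : ∀ e, u (nx e) = Sum.inr (Sum.elim id id (u (nx e))) := by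
    intro e
    have h1 := hnxd e
    rw [height_succ] at h1
    rcases hx : u (nx e) with x | x
    · rw [hx] at h1
      simp only [letterSign, Sum.elim_inl] at h1
      have := x.1.pos
      omega
    · rfl
  have hinl : ∀ e, u (pv e) = Sum.inl (Sum.elim id id (u (pv e))) := by
    intro e
    have h1 := hpvd e
    rw [height_succ] at h1
    rcases hx : u (pv e) with x | x
    · rfl
    · rw [hx] at h1
      simp only [letterSign, Sum.elim_inr] at h1
      have := x.1.pos
      omega
  have hpos : ∀ e : Fin n, 0 < height u (e + 1) - max (height u (pv e)) (height u (nx e + 1)) := by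
    intro e
    have := (hnx e).2.1
    have := (hpv e).2.1
    omega
  -- An edge gets the number of levels by which its height exceeds the higher of the two lower
  -- positions that bound its excursion.
  let wt : Fin n → ℕ+ := fun e =>
    ⟨(height u (e + 1) - max (height u (pv e)) (height u (nx e + 1))).toNat, by
      have := hpos e; omega⟩
  have hwt : ∀ e, ((wt e : ℕ) : ℤ) = height u (e + 1) - max (height u (pv e)) (height u (nx e + 1)) :=
    fun e => Int.toNat_of_nonneg (hpos e).le
  have hdir : ∀ e : Fin n, (height u (e + 1) < height u (e + 1 + 1) ∧ e.val + 1 < n) ∨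
      height u (e + 1 + 1) < height u (e + 1) := by
    intro e
    rcases eq_or_lt_of_le (show e.val + 1 ≤ n by omega) with h1 | h1
    · right
      have := hc.pos (e + 1) (by omega) (by omega)
      have h2 := (congrArg (height u) (show e.val + 1 + 1 = n + 1 by omega)).trans hc.last
      omega
    · rcases lt_trichotomy (height u (e + 1)) (height u (e + 1 + 1)) with h2 | h2 | h2
      · exact Or.inl ⟨h2, h1⟩
      · have := hc.inj _ _ (by omega) (by omega) (by omega) (by omega) h2; omega
      · exact Or.inr h2
  have hcompl : compl σ = τ := by
    ext i
    obtain ⟨e, rfl⟩ := σ.surjective i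
    rw [compl_apply]
    rcases hdir e with h1 | h1
    · rw [(hc.apply_of_lt hnx hpv hσ hσ' hτ hτ' h1.2 h1.1).2]
    · rw [(hc.apply_of_gt hnx hpv hσ hσ' hτ hτ' h1).2]
  have hsumw : ∀ e, ∑ j with nx j = nx e, (wt j : ℕ) = (Sum.elim id id (u (nx e)) : ℕ+ × S).1 := by
    intro e
    have h1 := hc.sum_closesAt hnx hpv (N := nx e) (by have := (hnx e).1; omega) (hnxd e)
    rw [height_succ, hinr] at h1
    simp only [letterSign, Sum.elim_inr, ← hwt] at h1
    zify
    rw [h1]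
    ring
  have hsumb : ∀ e, ∑ j with pv j = pv e, (wt j : ℕ) = (Sum.elim id id (u (pv e)) : ℕ+ × S).1 := by
    intro e
    have h1 := hc.sum_opensAt hnx hpv (K := pv e) (by have := (hpv e).1; omega) (hpvd e)
    rw [height_succ, hinl] at h1
    simp only [letterSign, Sum.elim_inl, ← hwt] at h1
    zify
    rw [h1]
    ring
  -- A white letter is a down step, so it closes the edge `k - 1` immediately before it; `k = 0` is
  -- impossible since heights are nonnegative.
  have hexw : ∀ (k : Fin (n + 1)) x, u k = Sum.inr x → ∃ e, nx e = k := by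
    intro k x hk
    have h1 := height_succ u k
    rw [hk] at h1
    simp only [letterSign, Sum.elim_inr] at h1
    have h3 := x.1.pos
    have h4 : k.val ≠ 0 := by
      intro h5
      have := hc.nonneg (k := k + 1) (by omega)
      rw [h5, hc.zero] at h1
      rw [h5] at this
      omega
    refine ⟨⟨k - 1, by omega⟩, (hnx _).unique ⟨by simp only; omega, ?_, fun j hj hj' => by
      simp only at hj; omega⟩⟩
    simp only [show k.val - 1 + 1 = k.val by omega]
    omega
  have hexb : ∀ (k : Fin (n + 1)) x, u k = Sum.inl x → ∃ e, pv e = k := by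
    intro k x hk
    have h1 := height_succ u k
    rw [hk] at h1
    simp only [letterSign, Sum.elim_inl] at h1
    have h3 := x.1.pos
    have h4 : k.val ≠ n := by
      intro h5
      have := hc.nonneg (k := k) (by omega)
      rw [h5, hc.last] at h1
      rw [h5] at this
      omega
    refine ⟨⟨k, by omega⟩, (hpv _).unique ⟨le_rfl, ?_, fun j hj hj' => by
      simp only at hj'; omega⟩⟩
    simp only
    omega
  have hw : IsLabeling σ wt (fun e => Sum.elim id id (u (nx e))) Ξ.neg := by
    refine ⟨fun i => ?_, fun i => ?_, fun x => ?_⟩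
    · rw [((hσ i (σ i)).1 (by simp [Equiv.Perm.SameCycle.refl]))]
    · simp only [hσ, ← hsumw i]
      exact Finset.sum_congr (Finset.filter_congr fun _ _ => eq_comm) fun _ _ => rfl
    · rw [← Finset.sum_fiberwise_of_maps_to (g := nx) (t := univ.filter fun k => u k = Sum.inr x)]
      · rw [← hu2, mul_comm, ← smul_eq_mul, ← Finset.sum_const]
        refine Finset.sum_congr rfl fun k hk => ?_
        simp only [mem_filter, mem_univ, true_and] at hk
        obtain ⟨e, rfl⟩ := hexw k x hk
        have h1 := hsumw e
        rw [hk] at h1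
        simp only [Sum.elim_inr, id] at h1
        rw [← h1, Finset.filter_filter]
        refine Finset.sum_congr (Finset.filter_congr fun j _ => ?_) fun _ _ => rfl
        constructor
        · exact fun h => h.2
        · intro h
          refine ⟨?_, h⟩
          rw [h, hk]; rfl
      · intro j hj
        simp only [mem_filter, mem_univ, true_and] at hj ⊢
        rw [hinr, hj]
  have hb : IsLabeling τ wt (fun e => Sum.elim id id (u (pv e))) Ξ.pos := by
    refine ⟨fun i => ?_, fun i => ?_, fun x => ?_⟩
    · rw [((hτ i (τ i)).1 (by simp [Equiv.Perm.SameCycle.refl]))]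
    · simp only [hτ, ← hsumb i]
      exact Finset.sum_congr (Finset.filter_congr fun _ _ => eq_comm) fun _ _ => rfl
    · rw [← Finset.sum_fiberwise_of_maps_to (g := pv) (t := univ.filter fun k => u k = Sum.inl x)]
      · rw [← hu1, mul_comm, ← smul_eq_mul, ← Finset.sum_const]
        refine Finset.sum_congr rfl fun k hk => ?_
        simp only [mem_filter, mem_univ, true_and] at hk
        obtain ⟨e, rfl⟩ := hexb k x hk
        have h1 := hsumb e
        rw [hk] at h1
        simp only [Sum.elim_inl, id] at h1
        rw [← h1, Finset.filter_filter]
        refine Finset.sum_congr (Finset.filter_congr fun j _ => ?_) fun _ _ => rfl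
        constructor
        · exact fun h => h.2
        · intro h
          refine ⟨?_, h⟩
          rw [h, hk]; rfl
      · intro j hj
        simp only [mem_filter, mem_univ, true_and] at hj ⊢
        rw [hinl, hj]
  refine ⟨⟨σ, wt, _, _, hw, hcompl ▸ hb⟩, ?_⟩
  funext k
  have hopen : ∀ (i : Fin n), height u i < height u (i + 1) → pv i = i.castSucc := fun i hi =>
    (hpv i).unique ⟨le_rfl, hi, fun j hj hj' => by simp only [Fin.val_castSucc] at hj; omega⟩
  refine Fin.cases ?_ (fun i => ?_) k
  · simp only [word, Fin.cases_zero]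
    rw [← hinl, hopen 0 (by
      have := hc.pos 1 le_rfl (NeZero.pos n)
      simpa [hc.zero] using this)]
    rfl
  · simp only [word, Fin.cases_succ]
    rcases hdir i with h1 | h1
    · have h2 := (hc.apply_of_lt hnx hpv hσ hσ' hτ hτ' h1.2 h1.1).1
      have h3 := val_add_one h1.2
      rw [if_neg (not_le.2 h2), ← hinl, hopen (i + 1) (by rw [h3]; exact h1.1)]
      congr 1
      ext; simp [h3]
    · have h2 := (hc.apply_of_gt hnx hpv hσ hσ' hτ hτ' h1).1
      rw [if_pos h2, ← hinr, (hnx i).unique (N' := i.succ) ⟨by simp, by simpa using h1, fun j hj hj' => by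
        simp only [Fin.val_succ] at hj'; omega⟩]

end TreeCode

end

/-! ### Counting words, and the cycle lemma for primitive passports. -/

section

open CyclePerm Finset

/-- Orbit and stabilizer for permutations of the positions: every rearrangement is `w ∘ g`, each one
for as many `g` as the stabilizer of `w` has elements. -/
theorem card_rearrangements {α : Type*} [DecidableEq α] {N : ℕ} (w : Fin N → α) :
    Nat.card {u : Fin N → α // univ.val.map u = univ.val.map w} *
      ∏ x ∈ univ.image w, ((univ.filter fun i => w i = x).card)! = N ! := by
  classical
  have hstab := DomMulAct.stabilizer_card' w
  simp only [Fintype.card_subtype] at hstab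
  rw [← hstab]
  have hmap : ∀ g : Equiv.Perm (Fin N), univ.val.map (w ∘ g) = univ.val.map w := by
    intro g
    rw [← Multiset.map_map]
    congr 1
    exact congrArg Finset.val (Finset.map_univ_equiv g)
  let F : Equiv.Perm (Fin N) → {u : Fin N → α // univ.val.map u = univ.val.map w} :=
    fun g => ⟨w ∘ g, hmap g⟩
  have hF : Function.Surjective F := by
    rintro ⟨u, hu⟩
    have hc : ∀ c, Nonempty ({a // u a = c} ≃ {a // w a = c}) := by
      intro c
      rw [← Fintype.card_eq, Fintype.card_subtype, Fintype.card_subtype]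
      have h1 := congrArg (Multiset.count c) hu
      rw [Multiset.count_map, Multiset.count_map] at h1
      simp only [@eq_comm _ c] at h1
      exact h1
    refine ⟨Equiv.ofFiberEquiv fun c => (hc c).some, Subtype.ext (funext fun i => ?_)⟩
    exact Equiv.ofFiberEquiv_map _ i
  have : Finite {u : Fin N → α // univ.val.map u = univ.val.map w} := Finite.of_surjective F hF
  have := Fintype.ofFinite {u : Fin N → α // univ.val.map u = univ.val.map w}
  have h1 : (univ : Finset (Equiv.Perm (Fin N))).card = N ! := by
    rw [Finset.card_univ, Fintype.card_perm, Fintype.card_fin]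
  have h2 : ∀ u ∈ (univ : Finset {u : Fin N → α // univ.val.map u = univ.val.map w}),
      (univ.filter fun g => F g = u).card = (univ.filter fun g : Equiv.Perm (Fin N) => w ∘ g = w).card := ?_
  · rw [← h1, Finset.card_eq_sum_card_fiberwise (f := F) (s := univ) (t := univ) (fun _ _ => by simp),
      Finset.sum_congr rfl h2, Finset.sum_const, smul_eq_mul, Nat.card_eq_fintype_card,
      Finset.card_univ]
  intro u _
  obtain ⟨g, rfl⟩ := hF u
  refine Finset.card_bij (fun a _ => a * g⁻¹) ?_ ?_ ?_
  · intro a ha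
    simp only [mem_filter, mem_univ, true_and, F, Subtype.mk.injEq] at ha ⊢
    funext i
    have := congrFun ha (g⁻¹ i)
    simpa using this
  · intro a _ b _ hab
    exact mul_right_cancel hab
  · intro b hb
    simp only [mem_filter, mem_univ, true_and] at hb
    refine ⟨b * g, ?_, by simp⟩
    simp only [mem_filter, mem_univ, true_and, F, Subtype.mk.injEq]
    funext i
    exact congrFun hb (g i)

namespace LabeledPassport

variable {S : Type}

/-- Only the trivial sub-passports have equal black and white weights. -/
structure IsPrimitive (Ξ : LabeledPassport S) : Prop where
  balanced : weightSum Ξ.pos = weightSum Ξ.neg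
  trivial : ∀ A ≤ Ξ.pos, ∀ B ≤ Ξ.neg, weightSum A = weightSum B →
    (A = 0 ∧ B = 0) ∨ (A = Ξ.pos ∧ B = Ξ.neg)

end LabeledPassport

open LabeledPassport

section words

variable {S : Type} {N : ℕ} {Ξ : LabeledPassport S} {u : Fin N → (ℕ+ × S) ⊕ (ℕ+ × S)}

theorem card_eq_card_filterMap (U : Multiset ((ℕ+ × S) ⊕ (ℕ+ × S))) :
    Multiset.card U = Multiset.card (U.filterMap Sum.getLeft?) + Multiset.card (U.filterMap Sum.getRight?) := by
  induction U using Multiset.induction with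
  | empty => simp
  | cons a s ih =>
    rcases a with a | a
    · rw [Multiset.filterMap_cons_some _ (Sum.inl a) s (b := a) rfl, Multiset.filterMap_cons_none _ s rfl]
      simp only [Multiset.card_cons, ih]; omega
    · rw [Multiset.filterMap_cons_none _ s rfl, Multiset.filterMap_cons_some _ (Sum.inr a) s (b := a) rfl]
      simp only [Multiset.card_cons, ih]; omega

theorem sum_letterSign (U : Multiset ((ℕ+ × S) ⊕ (ℕ+ × S))) :
    (U.map letterSign).sum = (weightSum (U.filterMap Sum.getLeft?) : ℤ) - weightSum (U.filterMap Sum.getRight?) := by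
  induction U using Multiset.induction with
  | empty => simp [weightSum]
  | cons a s ih =>
    rcases a with a | a
    · rw [Multiset.filterMap_cons_some _ (Sum.inl a) s (b := a) rfl, Multiset.filterMap_cons_none _ s rfl]
      rw [Multiset.map_cons, Multiset.sum_cons, ih]
      simp only [weightSum, Multiset.map_cons, Multiset.sum_cons, letterSign, Sum.elim_inl, Nat.cast_add]
      ring
    · rw [Multiset.filterMap_cons_none _ s rfl, Multiset.filterMap_cons_some _ (Sum.inr a) s (b := a) rfl]
      rw [Multiset.map_cons, Multiset.sum_cons, ih]
      simp only [weightSum, Multiset.map_cons, Multiset.sum_cons, letterSign, Sum.elim_inr, Nat.cast_add]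
      ring

theorem filterMap_getLeft (A B : Multiset (ℕ+ × S)) :
    (A.map Sum.inl + B.map Sum.inr).filterMap Sum.getLeft? = A := by
  have h1 : (A.map (Sum.inl : _ → (ℕ+ × S) ⊕ (ℕ+ × S))).filterMap Sum.getLeft? = A := by
    rw [Multiset.filterMap_map]
    exact Multiset.filterMap_some A
  have h2 : (B.map (Sum.inr : _ → (ℕ+ × S) ⊕ (ℕ+ × S))).filterMap Sum.getLeft? = 0 := by
    induction B using Multiset.induction with
    | empty => rfl
    | cons a s ih => rw [Multiset.map_cons, Multiset.filterMap_cons_none _ _ rfl, ih]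
  rw [Multiset.filterMap_add, h1, h2, add_zero]

theorem filterMap_getRight (A B : Multiset (ℕ+ × S)) :
    (A.map Sum.inl + B.map Sum.inr).filterMap Sum.getRight? = B := by
  have h1 : (B.map (Sum.inr : _ → (ℕ+ × S) ⊕ (ℕ+ × S))).filterMap Sum.getRight? = B := by
    rw [Multiset.filterMap_map]
    exact Multiset.filterMap_some B
  have h2 : (A.map (Sum.inl : _ → (ℕ+ × S) ⊕ (ℕ+ × S))).filterMap Sum.getRight? = 0 := by
    induction A using Multiset.induction with
    | empty => rfl
    | cons a s ih => rw [Multiset.map_cons, Multiset.filterMap_cons_none _ _ rfl, ih]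
  rw [Multiset.filterMap_add, h1, h2, zero_add]

theorem height_all (hΞ : Ξ.IsPrimitive) (hu : IsWordOf Ξ u) : height u N = 0 := by
  have h1 : height u N = ((univ.val.map u).map letterSign).sum := by
    rw [height, Finset.filter_true_of_mem (fun i _ => i.isLt), Multiset.map_map]; rfl
  rw [h1, sum_letterSign, hu, filterMap_getLeft, filterMap_getRight, hΞ.balanced, sub_self]

/-- Equal heights would make the letters from `i` to `j - 1` a balanced sub-passport, which is
nonempty because `i < j` and not everything because `j < N`. -/
theorem height_ne (hΞ : Ξ.IsPrimitive) (hu : IsWordOf Ξ u) {i j : ℕ} (hij : i < j) (hj : j < N) :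
    height u i ≠ height u j := by
  intro he
  set s : Finset (Fin N) := univ.filter fun k => i ≤ k.val ∧ k.val < j with hs
  have h1 : height u j = height u i + ((s.val.map u).map letterSign).sum := by
    rw [Multiset.map_map]
    change _ = _ + ∑ k ∈ s, letterSign (u k)
    rw [height, height, ← Finset.sum_union]
    · refine Finset.sum_congr ?_ fun _ _ => rfl
      ext k; simp [hs]; omega
    · rw [Finset.disjoint_left]; intro k; simp [hs]; omega
  have h2 : s.val.map u ≤ univ.val.map u := Multiset.map_le_map (Finset.val_le_iff.2 (subset_univ s))
  have h3 := Multiset.filterMap_le_filterMap Sum.getLeft? h2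
  have h4 := Multiset.filterMap_le_filterMap Sum.getRight? h2
  have h5 := sum_letterSign (s.val.map u)
  have h6 := card_eq_card_filterMap (s.val.map u)
  have h7 := card_eq_card_filterMap (univ.val.map u)
  have hsc : s.card = j - i := by
    rw [← Nat.card_Ico, ← Finset.card_map Fin.valEmbedding]
    congr 1
    ext k
    simp only [hs, mem_map, mem_filter, mem_univ, true_and, Fin.valEmbedding_apply, Finset.mem_Ico]
    constructor
    · rintro ⟨a, h, rfl⟩; exact h
    · intro h; exact ⟨⟨k, by omega⟩, h, rfl⟩
  rw [hu, filterMap_getLeft] at h3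
  rw [hu, filterMap_getRight] at h4
  rw [Multiset.card_map] at h6
  have hcs : Multiset.card s.val = j - i := hsc
  rcases hΞ.trivial _ h3 _ h4 (by omega) with ⟨h8, h9⟩ | ⟨h8, h9⟩
  · rw [h8, h9, hcs] at h6
    simp at h6; omega
  · rw [Multiset.card_map, hu, filterMap_getLeft, filterMap_getRight] at h7
    have : Multiset.card (univ : Finset (Fin N)).val = N := by
      change Finset.card _ = _; simp
    rw [h8, h9, hcs] at h6
    omega

end words

section rotation

variable {S : Type} {n : ℕ} {Ξ : LabeledPassport S} {u : Fin (n + 1) → (ℕ+ × S) ⊕ (ℕ+ × S)}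

theorem IsWordOf.rotate (hu : IsWordOf Ξ u) (k : Fin (n + 1)) : IsWordOf Ξ fun i => u (i + k) := by
  rw [IsWordOf, ← hu]
  have : (fun i => u (i + k)) = u ∘ Equiv.addRight k := rfl
  rw [this, ← Multiset.map_map]
  congr 1
  exact congrArg Finset.val (Finset.map_univ_equiv (Equiv.addRight k))

theorem height_rotate (h0 : height u (n + 1) = 0) (k : Fin (n + 1)) (j : ℕ) (hj : j ≤ n + 1) :
    height (fun i => u (i + k)) j = height u ((j + k) % (n + 1)) - height u k := by
  induction j with
  | zero => rw [height_zero, zero_add, Nat.mod_eq_of_lt k.isLt, sub_self]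
  | succ j ih =>
    have h1 := height_succ (fun i => u (i + k)) ⟨j, by omega⟩
    have h2 := height_succ u (⟨j, by omega⟩ + k)
    simp only [Fin.val_add] at h1 h2
    rw [h1, ih (by omega)]
    have h3 : height u ((j + 1 + k) % (n + 1)) = height u ((j + k) % (n + 1) + 1) := by
      have hlt := Nat.mod_lt (j + k) (Nat.succ_pos n)
      rcases eq_or_lt_of_le (Nat.succ_le_of_lt hlt) with h4 | h4
      · have h5 : ((j + k.val) % (n + 1) + 1) = n + 1 := h4
        rw [show j + 1 + k.val = j + k.val + 1 by ring, ← Nat.mod_add_mod, h5, h0, Nat.mod_self,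
          height_zero]
      · rw [show j + 1 + k.val = j + k.val + 1 by ring, ← Nat.mod_add_mod, Nat.mod_eq_of_lt h4]
    rw [h3, h2]; ring

theorem isContour_iff (hΞ : Ξ.IsPrimitive) (hu : IsWordOf Ξ u) :
    IsContour (height u) n ↔ ∀ k, 1 ≤ k → k ≤ n → 0 < height u k := by
  refine ⟨fun h => h.pos, fun h => ⟨height_zero u, height_all hΞ hu, h, fun j k h1 h2 h3 h4 h5 => ?_⟩⟩
  rcases lt_trichotomy j k with h6 | h6 | h6
  · exact (height_ne hΞ hu h6 (by omega) h5).elim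
  · exact h6
  · exact (height_ne hΞ hu h6 (by omega) h5.symm).elim

/-- Rotation by `k` subtracts `height u k` from all heights, read cyclically. -/
theorem isContour_rotate_iff (hΞ : Ξ.IsPrimitive) (hu : IsWordOf Ξ u) (k : Fin (n + 1)) :
    IsContour (height fun i => u (i + k)) n ↔
      ∀ m : Fin (n + 1), m ≠ k → height u k < height u m := by
  rw [isContour_iff hΞ (hu.rotate k)]
  have h0 := height_all hΞ hu
  constructor
  · intro h m hm
    have h1 := h (m - k).val (by
      rw [Nat.one_le_iff_ne_zero]
      intro hc
      exact hm (sub_eq_zero.1 (Fin.ext (by simpa using hc)))) (by omega)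
    rw [height_rotate h0 k _ (by omega)] at h1
    have h2 : ((m - k).val + k.val) % (n + 1) = m.val := by
      rw [← Fin.val_add, sub_add_cancel]
    rw [h2] at h1
    omega
  · intro h j h1 h2
    rw [height_rotate h0 k _ (by omega)]
    have h3 : (j + k.val) % (n + 1) = ((⟨j, by omega⟩ : Fin (n + 1)) + k).val := by rw [Fin.val_add]
    rw [h3]
    have := h (⟨j, by omega⟩ + k) (by
      intro hc
      have := add_eq_right.1 hc
      rw [Fin.ext_iff] at this
      simp at this
      omega)
    omega

/-- The cycle lemma: the heights at `0, …, n` are distinct, so there is one lowest position, and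
only the rotation starting there is a contour. -/
theorem card_words (hΞ : Ξ.IsPrimitive) :
    Nat.card {u : Fin (n + 1) → (ℕ+ × S) ⊕ (ℕ+ × S) // IsWordOf Ξ u} =
    Nat.card {u : Fin (n + 1) → (ℕ+ × S) ⊕ (ℕ+ × S) // IsWordOf Ξ u ∧ IsContour (height u) n} * (n + 1) := by
  have key : Nat.card ({u : Fin (n + 1) → (ℕ+ × S) ⊕ (ℕ+ × S) // IsWordOf Ξ u ∧
      IsContour (height u) n} × Fin (n + 1)) =
      Nat.card {u : Fin (n + 1) → (ℕ+ × S) ⊕ (ℕ+ × S) // IsWordOf Ξ u} := ?_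
  · rw [← key, Nat.card_prod, Nat.card_fin]
  refine Nat.card_congr (Equiv.ofBijective (fun x => ⟨fun i => x.1.1 (i + x.2), x.1.2.1.rotate x.2⟩) ⟨?_, ?_⟩)
  · rintro ⟨⟨u, hu, hu'⟩, k⟩ ⟨⟨v, hv, hv'⟩, l⟩ h
    simp only [Subtype.mk.injEq] at h
    set w := fun i => u (i + k) with hw
    have h1 : u = fun i => w (i + -k) := by funext i; simp [hw]
    have h2 : v = fun i => w (i + -l) := by funext i; rw [h]; simp
    have hw' : IsWordOf Ξ w := hu.rotate k
    rw [h1, isContour_rotate_iff hΞ hw'] at hu'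
    rw [h2, isContour_rotate_iff hΞ hw'] at hv'
    have hkl : k = l := by
      by_contra hc
      have hc' : -k ≠ -l := fun h => hc (neg_injective h)
      exact lt_asymm (hu' _ hc'.symm) (hv' _ hc')
    subst hkl
    have : u = v := h1.trans h2.symm
    subst this
    rfl
  · rintro ⟨w, hw⟩
    obtain ⟨k, -, hk⟩ := Finset.exists_min_image univ (fun k : Fin (n + 1) => height w k) ⟨0, by simp⟩
    have h1 : IsContour (height fun i => w (i + k)) n := by
      rw [isContour_rotate_iff hΞ hw]
      intro m hm
      refine lt_of_le_of_ne (hk m (by simp)) fun hc => ?_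
      rcases lt_trichotomy m.val k.val with h6 | h6 | h6
      · exact height_ne hΞ hw h6 k.isLt hc.symm
      · exact hm (Fin.ext h6)
      · exact height_ne hΞ hw h6 m.isLt hc
    refine ⟨⟨⟨_, hw.rotate k, h1⟩, -k⟩, ?_⟩
    simp

end rotation

theorem exists_isWordOf {S : Type} {N : ℕ} {Ξ : LabeledPassport S} (hN : Ξ.size = N) :
    ∃ u : Fin N → (ℕ+ × S) ⊕ (ℕ+ × S), IsWordOf Ξ u := by
  obtain ⟨l, hl⟩ : ∃ l : List ((ℕ+ × S) ⊕ (ℕ+ × S)),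
      (l : Multiset _) = Ξ.pos.map Sum.inl + Ξ.neg.map Sum.inr := Quot.exists_rep _
  have hlen : l.length = N := by
    have := congrArg Multiset.card hl
    rw [Multiset.coe_card, Multiset.card_add, Multiset.card_map, Multiset.card_map] at this
    rw [← hN]; exact this
  subst hlen
  refine ⟨l.get, ?_⟩
  rw [IsWordOf, ← hl, Fin.univ_val_map]
  simp [List.ofFn_get]

theorem card_words_mul {S : Type} [DecidableEq S] {N : ℕ} {Ξ : LabeledPassport S} (hN : Ξ.size = N) :
    Nat.card {u : Fin N → (ℕ+ × S) ⊕ (ℕ+ × S) // IsWordOf Ξ u} * Ξ.multFactorial = N ! := by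
  obtain ⟨w, hw⟩ := exists_isWordOf hN
  rw [← card_rearrangements w]
  congr 1
  · rw [IsWordOf] at hw
    rw [hw]; rfl
  · obtain ⟨h1, h2⟩ := isWordOf_iff.1 hw
    have himg : univ.image w = Ξ.pos.toFinset.disjSum Ξ.neg.toFinset := by
      ext x
      have : x ∈ univ.image w ↔ x ∈ univ.val.map w := by simp
      rw [this, hw]
      rcases x with x | x <;> simp
    rw [himg, Finset.prod_disjSum, multFactorial]
    simp only [h1, h2]

namespace TreeCode

variable {S : Type} [DecidableEq S] {Ξ : LabeledPassport S} {n : ℕ} [NeZero n]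

/-- Codes are the contours among the words. The number of words times `multFactorial` is `(n + 1)!`,
and one word in `n + 1` is a contour. -/
theorem card_mul (hΞ : Ξ.IsPrimitive) (hn : Ξ.size = n + 1) :
    Nat.card (TreeCode Ξ n) * Ξ.multFactorial = n ! := by
  have h1 : Nat.card (TreeCode Ξ n) =
      Nat.card {u : Fin (n + 1) → (ℕ+ × S) ⊕ (ℕ+ × S) // IsWordOf Ξ u ∧ IsContour (height u) n} := by
    refine Nat.card_congr (Equiv.ofBijective (fun X => ⟨X.word, X.isWordOf_word hn,
      (isContour_iff hΞ (X.isWordOf_word hn)).2 fun k h1 h2 => ?_⟩) ⟨?_, ?_⟩)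
    · have := X.height_word_pos hn (k - 1) (by omega)
      rwa [show k - 1 + 1 = k by omega] at this
    · intro X Y h
      exact word_injective hn (Subtype.ext_iff.1 h)
    · rintro ⟨u, hu, hu'⟩
      obtain ⟨X, hX⟩ := exists_word_eq hu hu'
      exact ⟨X, Subtype.ext hX⟩
  have h2 := card_words (n := n) hΞ
  have h3 := card_words_mul (Ξ := Ξ) hn
  rw [h2, ← h1, Nat.factorial_succ] at h3
  have : (n + 1) * (Nat.card (TreeCode Ξ n) * Ξ.multFactorial) = (n + 1) * n ! := by
    rw [← h3]; ring
  exact Nat.eq_of_mul_eq_mul_left (Nat.succ_pos n) this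

theorem finite (hΞ : Ξ.IsPrimitive) (hn : Ξ.size = n + 1) : Finite (TreeCode Ξ n) := by
  refine Nat.finite_of_card_ne_zero fun h => ?_
  have := card_mul hΞ hn
  rw [h, zero_mul] at this
  exact absurd this.symm (Nat.factorial_ne_zero n)

end TreeCode

end

/-! ### The action of `Fin n` on codes by change of the root edge. -/

section

open CyclePerm Finset

namespace CyclePerm

variable {n : ℕ} {S : Type} [DecidableEq S]

theorem IsLabeling.conj {σ : Equiv.Perm (Fin n)} {wt : Fin n → ℕ+} {l : Fin n → ℕ+ × S}
    {M : Multiset (ℕ+ × S)} (h : IsLabeling σ wt l M) (π : Equiv.Perm (Fin n)) :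
    IsLabeling (π⁻¹ * σ * π) (wt ∘ π) (l ∘ π) M where
  apply_eq i := by simp [h.apply_eq]
  sum_cycle i := by
    have h1 : ∀ j, (π⁻¹ * σ * π).SameCycle i j ↔ σ.SameCycle (π i) (π j) := fun j => by
      have := @Equiv.Perm.sameCycle_conj _ σ π⁻¹ i j
      simpa using this
    rw [Function.comp, ← h.sum_cycle (π i), Finset.sum_filter, Finset.sum_filter]
    simp only [h1]
    exact Equiv.sum_comp π (fun j => if σ.SameCycle (π i) j then (wt j : ℕ) else 0)
  sum_label x := by
    rw [← h.sum_label x, Finset.sum_filter, Finset.sum_filter]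
    exact Equiv.sum_comp π (fun j => if l j = x then (wt j : ℕ) else 0)

variable [NeZero n]

theorem compl_conj_addRight (τ : Equiv.Perm (Fin n)) (s : Fin n) :
    compl ((Equiv.addRight s)⁻¹ * τ * Equiv.addRight s) =
      (Equiv.addRight s)⁻¹ * compl τ * Equiv.addRight s := by
  ext i
  simp [compl, mul_assoc]
  abel_nf

end CyclePerm

namespace TreeCode

variable {S : Type} [DecidableEq S] {Ξ : LabeledPassport S} {n : ℕ} [NeZero n]

/-- Moving the root edge by `s` steps along the contour. -/
def shift (s : Fin n) (X : TreeCode Ξ n) : TreeCode Ξ n where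
  white := (Equiv.addRight s)⁻¹ * X.white * Equiv.addRight s
  wt := X.wt ∘ Equiv.addRight s
  lw := X.lw ∘ Equiv.addRight s
  lb := X.lb ∘ Equiv.addRight s
  labeling_white := X.labeling_white.conj _
  labeling_black := compl_conj_addRight X.white s ▸ X.labeling_black.conj _

theorem shift_white (s : Fin n) (X : TreeCode Ξ n) (i : Fin n) :
    (X.shift s).white i = X.white (i + s) - s := by
  simp [shift, sub_eq_add_neg]

theorem shift_wt (s : Fin n) (X : TreeCode Ξ n) (i : Fin n) : (X.shift s).wt i = X.wt (i + s) := rfl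
theorem shift_lw (s : Fin n) (X : TreeCode Ξ n) (i : Fin n) : (X.shift s).lw i = X.lw (i + s) := rfl
theorem shift_lb (s : Fin n) (X : TreeCode Ξ n) (i : Fin n) : (X.shift s).lb i = X.lb (i + s) := rfl

theorem ext_apply {X Y : TreeCode Ξ n} (h1 : ∀ i, X.white i = Y.white i) (h2 : ∀ i, X.wt i = Y.wt i)
    (h3 : ∀ i, X.lw i = Y.lw i) (h4 : ∀ i, X.lb i = Y.lb i) : X = Y :=
  TreeCode.ext (Equiv.ext h1) (funext h2) (funext h3) (funext h4)

instance : AddAction (Fin n) (TreeCode Ξ n) where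
  vadd := shift
  zero_vadd X := by
    change X.shift 0 = X
    refine ext_apply ?_ ?_ ?_ ?_ <;> intro i <;> simp [shift_white, shift_wt, shift_lw, shift_lb]
  add_vadd s t X := by
    change X.shift (s + t) = (X.shift t).shift s
    refine ext_apply ?_ ?_ ?_ ?_ <;> intro i <;>
      simp [shift_white, shift_wt, shift_lw, shift_lb, sub_sub, add_comm, add_left_comm]

/-- If all labels are distinct, then the shift action is free. -/
theorem eq_zero_of_shift_eq (hn : Ξ.size = n + 1) (hp : Ξ.pos.Nodup) (hq : Ξ.neg.Nodup)
    {X : TreeCode Ξ n} {s : Fin n} (h : X.shift s = X) : s = 0 := by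
  -- A label of multiplicity one belongs to a single cycle. An invariant shift by `s` thus gives the
  -- edges `0` and `s` the same white and the same black vertex.
  have key : ∀ (σ : Equiv.Perm (Fin n)) (l : Fin n → ℕ+ × S) (M : Multiset (ℕ+ × S)),
      IsLabeling σ X.wt l M → M.Nodup → ∀ i j, l i = l j → σ.SameCycle i j := by
    intro σ l M hl hM i j hij
    have h1 := hl.card_tops_label (l i)
    have h2 := Multiset.nodup_iff_count_le_one.1 hM (l i)
    rw [← h1, Finset.card_le_one] at h2
    have h3 := h2 (top σ i) (by simp [(hl.eq_of_sameCycle (top_sameCycle σ i)).symm])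
      (top σ j) (by simp [hij, (hl.eq_of_sameCycle (top_sameCycle σ j)).symm])
    exact top_eq_iff.1 h3
  have h1 := key _ _ _ X.labeling_white hq 0 s (by
    have := X.shift_lw s 0
    rw [h, zero_add] at this; exact this)
  have h2 := key _ _ _ X.labeling_black hp 0 s (by
    have := X.shift_lb s 0
    rw [h, zero_add] at this; exact this)
  exact ((X.noncrossing hn).eq_of_sameCycle h1 h2).symm

end TreeCode

end

/-! ### Plane trees have one face; vertex weights as sums over darts. -/

section

open CyclePerm Finset

theorem Equiv.Perm.SameCycle.of_forall_apply {α : Type*} {σ τ : Equiv.Perm α} [Finite α]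
    (h : ∀ a, τ.SameCycle a (σ a)) {a b : α} (hab : σ.SameCycle a b) : τ.SameCycle a b := by
  obtain ⟨k, -, rfl⟩ := hab.exists_pow_eq'
  clear hab
  induction k with
  | zero => exact Equiv.Perm.SameCycle.refl _ _
  | succ k ih => rw [pow_succ', Equiv.Perm.mul_apply]; exact ih.trans (h _)

/-- Geodesics to `w` and `w'` extended to `v` are both the unique path from `r` to `v`, so their
last but one vertices agree. -/
theorem SimpleGraph.IsTree.eq_of_dist_eq_add_one {V : Type*} {G : SimpleGraph V} (hG : G.IsTree)
    {r v w w' : V} (h : G.Adj w v) (h' : G.Adj w' v) (hd : G.dist r v = G.dist r w + 1)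
    (hd' : G.dist r v = G.dist r w' + 1) : w = w' := by
  obtain ⟨p, hp⟩ := (hG.connected r w).exists_walk_length_eq_dist
  obtain ⟨p', hp'⟩ := (hG.connected r w').exists_walk_length_eq_dist
  have h1 : (p.concat h).IsPath := SimpleGraph.Walk.isPath_of_length_eq_dist _ (by
    rw [SimpleGraph.Walk.length_concat, hp, hd])
  have h2 : (p'.concat h').IsPath := SimpleGraph.Walk.isPath_of_length_eq_dist _ (by
    rw [SimpleGraph.Walk.length_concat, hp', hd'])
  have h3 : p.concat h = p'.concat h' := (hG.existsUnique_path r v).unique h1 h2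
  have h4 := congrArg SimpleGraph.Walk.penultimate h3
  simpa using h4

namespace WBPTree

variable (T : WBPTree)

/-- The permutation of the darts that walks around the unique face. -/
def face : Equiv.Perm T.graph.Dart :=
  (Function.Involutive.toPerm _ SimpleGraph.Dart.symm_involutive).trans T.rot

@[simp] theorem face_apply (a : T.graph.Dart) : T.face a = T.rot a.symm := rfl

theorem finite_dart : Finite T.graph.Dart := by
  have := T.finite
  exact Finite.of_injective _ (SimpleGraph.Dart.toProd_injective (G := T.graph))

theorem rot_fst (a : T.graph.Dart) : (T.rot a).fst = a.fst :=
  ((T.rot_cycle a (T.rot a)).1 (by simp [Equiv.Perm.SameCycle.refl])).symm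

/-- Orient `a` away from a root `r`. The face walk enters the subtree beyond `a`, goes around the
branch behind each further edge there, and comes back along `a`. The induction is on how far the end
of `a` is from the maximal distance. -/
theorem face_sameCycle_symm (a : T.graph.Dart) : T.face.SameCycle a a.symm := by
  have hV := T.finite
  have hD := T.finite_dart
  obtain ⟨r⟩ := T.isTree.connected.nonempty
  obtain ⟨D, hD⟩ := (Set.finite_range fun v => T.graph.dist r v).bddAbove
  have hD' : ∀ v, T.graph.dist r v ≤ D := fun v => hD ⟨v, rfl⟩
  have key : ∀ (N : ℕ) (a : T.graph.Dart), D - T.graph.dist r a.snd = N →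
      T.graph.dist r a.snd = T.graph.dist r a.fst + 1 → T.face.SameCycle a a.symm := by
    intro N
    induction N using Nat.strong_induction_on with
    | _ N ih =>
    intro a hN ha
    -- The darts at the far end of `a` are visited in rotation order. Any such dart other than
    -- `a.symm` points away from the root, so the induction hypothesis leads to its reverse and the
    -- next face step to the next dart; when the rotation has completed its order, `a.symm` is
    -- reached.
    have hk : ∀ k : ℕ, T.face.SameCycle a ((T.rot ^ (k + 1)) a.symm) := by
      intro k
      induction k with
      | zero => exact ⟨1, by simp⟩
      | succ k ihk =>
        rw [pow_succ', Equiv.Perm.mul_apply]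
        set b := (T.rot ^ (k + 1)) a.symm with hb
        have hbf : a.snd = b.fst := (T.rot_cycle a.symm b).1 ⟨(k + 1 : ℕ), by rw [hb, zpow_natCast]⟩
        by_cases hba : b = a.symm
        · rw [hba]; exact ⟨1, by simp⟩
        · have h1 : T.graph.dist r b.snd = T.graph.dist r b.fst + 1 := by
            rcases T.isTree.dist_eq_dist_add_one_of_adj r b.adj with h | h
            · refine absurd ?_ hba
              have hs : a.fst = b.snd := T.isTree.eq_of_dist_eq_add_one (r := r) (v := b.fst)
                (hbf ▸ a.adj) b.adj.symm (hbf ▸ ha) h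
              ext
              · exact hbf.symm
              · exact hs.symm
            · exact h
          have h2 := ih (D - T.graph.dist r b.snd) (by
            have := hD' b.snd
            rw [← hbf] at h1; omega) b rfl h1
          exact (ihk.trans h2).trans ⟨1, by simp⟩
    have h1 := hk (orderOf T.rot - 1)
    have h2 : 0 < orderOf T.rot := orderOf_pos T.rot
    rw [Nat.sub_add_cancel h2, pow_orderOf_eq_one] at h1
    exact h1
  rcases T.isTree.dist_eq_dist_add_one_of_adj r a.adj with h | h
  · have := key _ a.symm rfl h
    rw [SimpleGraph.Dart.symm_symm] at this
    exact this.symm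
  · exact key _ a rfl h

/-- A plane tree has only one face. -/
theorem face_sameCycle (a b : T.graph.Dart) : T.face.SameCycle a b := by
  have hD := T.finite_dart
  have h1 : ∀ a, T.face.SameCycle a (T.rot a) := fun a =>
    (T.face_sameCycle_symm a).trans ⟨1, by simp⟩
  have h2 : ∀ a b : T.graph.Dart, a.fst = b.fst → T.face.SameCycle a b := fun a b hab =>
    Equiv.Perm.SameCycle.of_forall_apply h1 ((T.rot_cycle a b).2 hab)
  obtain ⟨p⟩ := T.isTree.connected a.fst b.fst
  have key : ∀ {u v : T.V} (p : T.graph.Walk u v) (a b : T.graph.Dart), a.fst = u → b.fst = v →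
      T.face.SameCycle a b := by
    intro u v p
    induction p with
    | nil => intro a b ha hb; exact h2 a b (ha.trans hb.symm)
    | @cons u w v h p ih =>
      intro a b ha hb
      have e1 := h2 a ⟨(u, w), h⟩ ha
      have e2 := T.face_sameCycle_symm ⟨(u, w), h⟩
      exact (e1.trans e2).trans (ih _ b rfl hb)
  exact key p a b rfl rfl

/-- Every edge has exactly one end with `P`, so the darts `g j`, which start there, enumerate the
edges. Taking for `P` either color serves both kinds of vertices. -/
theorem weight_sum {n : ℕ} {g : Fin n → T.graph.Dart} (hg : Function.Injective g) {P : T.V → Prop}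
    (hP : ∀ u v, T.graph.Adj u v → (P u ↔ ¬ P v)) (hr : ∀ a, a ∈ Set.range g ↔ P a.fst) {v : T.V}
    (hv : P v) [DecidablePred fun j => (g j).fst = v] :
    ∑ j with (g j).fst = v, (T.weight ⟨(g j).edge, (g j).edge_mem⟩ : ℕ) = T.wt v := by
  classical
  have hbij : Function.Bijective fun j => (⟨(g j).edge, (g j).edge_mem⟩ : T.graph.edgeSet) := by
    constructor
    · intro i j hij
      simp only [Subtype.mk.injEq] at hij
      rcases (SimpleGraph.dart_edge_eq_iff _ _).1 hij with h | h
      · exact hg h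
      · exfalso
        have h1 := (hr (g i)).1 ⟨i, rfl⟩
        have h2 := (hr (g j)).1 ⟨j, rfl⟩
        rw [h] at h1
        exact ((hP _ _ (g j).adj).1 h2) h1
    · rintro ⟨e, he⟩
      induction e using Sym2.ind with
      | _ u w =>
      by_cases hu : P u
      · obtain ⟨j, hj⟩ := (hr ⟨(u, w), he⟩).2 hu
        exact ⟨j, Subtype.ext (by simp only [hj]; rfl)⟩
      · have hw : P w := (hP _ _ (SimpleGraph.Adj.symm he)).2 hu
        obtain ⟨j, hj⟩ := (hr ⟨(w, u), SimpleGraph.Adj.symm he⟩).2 hw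
        exact ⟨j, Subtype.ext (by simp only [hj]; exact Sym2.eq_swap)⟩
  unfold wt
  rw [← finsum_comp_equiv (Equiv.ofBijective _ hbij), finsum_eq_sum_of_fintype, Finset.sum_filter]
  refine Finset.sum_congr rfl fun j _ => ?_
  rw [finsum_eq_if]
  have h1 : v ∈ (g j).edge ↔ (g j).fst = v := by
    simp only [SimpleGraph.Dart.edge, Sym2.mem_iff]
    constructor
    · rintro (h | h)
      · exact h.symm
      · exfalso
        have h2 := (hr (g j)).1 ⟨j, rfl⟩
        exact (hP _ _ (g j).adj).1 h2 (h ▸ hv)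
    · exact fun h => Or.inl h.symm
  simp only [Equiv.ofBijective_apply, h1]

end WBPTree

theorem Equiv.Perm.sameCycle_iff_of_semiconj {α β : Type*} {σ : Equiv.Perm α} {τ : Equiv.Perm β}
    {g : α → β} (hg : Function.Injective g) (h : ∀ a, τ (g a) = g (σ a)) {a b : α} :
    τ.SameCycle (g a) (g b) ↔ σ.SameCycle a b := by
  have h1 : ∀ (k : ℕ) a, (τ ^ k) (g a) = g ((σ ^ k) a) := by
    intro k
    induction k with
    | zero => intro a; rfl
    | succ k ih => intro a; rw [pow_succ, Equiv.Perm.mul_apply, h, ih, pow_succ, Equiv.Perm.mul_apply]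
  have h2 : ∀ (k : ℤ) a, (τ ^ k) (g a) = g ((σ ^ k) a) := by
    intro k a
    cases k with
    | ofNat k => exact h1 k a
    | negSucc k =>
      rw [zpow_negSucc, zpow_negSucc, Equiv.Perm.inv_eq_iff_eq, h1]
      simp
  exact exists_congr fun k => by rw [h2, hg.eq_iff]

namespace LWBPTree

variable {S : Type} [DecidableEq S] {Ξ : LabeledPassport S} {n : ℕ}

theorem isLabeling (T : LWBPTree Ξ) {g : Fin n → T.graph.Dart} (hg : Function.Injective g)
    {P : T.V → Prop} (hP : ∀ u v, T.graph.Adj u v → (P u ↔ ¬ P v))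
    (hr : ∀ a, a ∈ Set.range g ↔ P a.fst) {σ : Equiv.Perm (Fin n)}
    (hσ : ∀ i, T.rot (g i) = g (σ i)) {M : Multiset (ℕ+ × S)}
    (hM : ∀ x, {v | P v ∧ T.lab v = x}.ncard = M.count x) :
    IsLabeling σ (fun j => T.weight ⟨(g j).edge, (g j).edge_mem⟩) (fun j => T.lab (g j).fst) M := by
  classical
  have hV := T.finite
  have := Fintype.ofFinite T.V
  have hc : ∀ i j, σ.SameCycle i j ↔ (g i).fst = (g j).fst := fun i j => by
    rw [← T.rot_cycle, Equiv.Perm.sameCycle_iff_of_semiconj hg hσ]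
  have hPg : ∀ i, P (g i).fst := fun i => (hr _).1 ⟨i, rfl⟩
  refine ⟨fun i => ?_, fun i => ?_, fun x => ?_⟩
  · rw [← hσ, T.rot_fst]
  · rw [T.lab_weight, ← T.weight_sum hg hP hr (hPg i)]
    exact Finset.sum_congr (Finset.filter_congr fun j _ => by rw [hc, eq_comm]) fun _ _ => rfl
  · rw [← Finset.sum_fiberwise_of_maps_to (g := fun j => (g j).fst)
      (t := univ.filter fun v => P v ∧ T.lab v = x)]
    · rw [← hM, Set.ncard_eq_toFinset_card', mul_comm, ← smul_eq_mul, ← Finset.sum_const]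
      refine Finset.sum_congr (by ext; simp) fun v hv => ?_
      replace hv : P v ∧ T.lab v = x := by simpa using hv
      rw [← hv.2, T.lab_weight, ← T.weight_sum hg hP hr hv.1, Finset.filter_filter]
      refine Finset.sum_congr (Finset.filter_congr fun j _ => ?_) fun _ _ => rfl
      constructor
      · exact fun h => h.2
      · exact fun h => ⟨by rw [h], h⟩
    · intro j hj
      simp only [mem_filter, mem_univ, true_and] at hj ⊢
      exact ⟨hPg j, hj⟩

end LWBPTree

end

/-! ### Every labeled plane tree is realized by a code. -/

section

open CyclePerm Finset

variable {S : Type} [DecidableEq S] {Ξ : LabeledPassport S} {n : ℕ} [NeZero n]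

/-- The black darts of `T`, numbered by `ε` along the contour, give the code `X`. -/
structure Realizes (X : TreeCode Ξ n) (T : LWBPTree Ξ) (ε : Fin n → T.graph.Dart) : Prop where
  injective : Function.Injective ε
  range : ∀ a, a ∈ Set.range ε ↔ a.fst ∈ T.black
  rot_symm : ∀ i, T.rot (ε i).symm = (ε (X.white i)).symm
  rot_white : ∀ i, T.rot (ε (X.white i)) = ε (i + 1)
  weight : ∀ i, T.weight ⟨(ε i).edge, (ε i).edge_mem⟩ = X.wt i
  lab_fst : ∀ i, T.lab (ε i).fst = X.lb i
  lab_snd : ∀ i, T.lab (ε i).snd = X.lw i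

namespace LWBPTree

theorem card_V (T : LWBPTree Ξ) : Nat.card T.V = Ξ.size := by
  classical
  have hV := T.finite
  have := Fintype.ofFinite T.V
  have key : ∀ (P : T.V → Prop) [DecidablePred P] (M : Multiset (ℕ+ × S)),
      (∀ x, {v | P v ∧ T.lab v = x}.ncard = M.count x) →
      (univ.filter P).card = Multiset.card M := by
    intro P _ M hM
    rw [← Multiset.toFinset_sum_count_eq, Finset.card_eq_sum_card_fiberwise (f := T.lab)
      (t := M.toFinset)]
    · refine Finset.sum_congr rfl fun x _ => ?_
      rw [← hM, Set.ncard_eq_toFinset_card', Finset.filter_filter]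
      congr 1
      ext; simp
    · intro v hv
      have hv' : P v := by simpa using hv
      have h1 : 0 < {w | P w ∧ T.lab w = T.lab v}.ncard :=
        (Set.ncard_pos (Set.toFinite _)).2 ⟨v, hv', rfl⟩
      rw [hM, Multiset.count_pos] at h1
      simpa using h1
  rw [Nat.card_eq_fintype_card, ← Finset.card_univ,
    ← Finset.card_filter_add_card_filter_not (fun v => v ∈ T.black),
    key _ _ T.lab_black, key _ _ T.lab_white]
  rfl

/-- Every tree is realized by a code. -/
theorem exists_realizes (T : LWBPTree Ξ) (hn : Ξ.size = n + 1) :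
    ∃ (X : TreeCode Ξ n) (ε : _), Realizes X T ε := by
  classical
  have hV := T.finite
  have hD := T.finite_dart
  have hpos := NeZero.pos n
  have hcard : Nat.card T.graph.edgeSet = n := by
    have h1 := (SimpleGraph.isTree_iff_connected_and_card.1 T.isTree).2
    rw [T.card_V, hn] at h1
    omega
  let BD := {a : T.graph.Dart // a.fst ∈ T.black}
  have hflip : ∀ a : T.graph.Dart, a.symm.fst ∈ T.black ↔ ¬ a.fst ∈ T.black := fun a =>
    T.bicolored _ _ a.symm.adj
  have hBD : Nat.card BD = n := by
    rw [← hcard]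
    refine Nat.card_congr (Equiv.ofBijective
      (fun a => (⟨a.1.edge, a.1.edge_mem⟩ : T.graph.edgeSet)) ⟨?_, ?_⟩)
    · intro a b hab
      simp only [Subtype.mk.injEq] at hab
      rcases (SimpleGraph.dart_edge_eq_iff _ _).1 hab with h | h
      · exact Subtype.ext h
      · exfalso
        have h1 := a.2
        rw [h, hflip] at h1
        exact h1 b.2
    · rintro ⟨e, he⟩
      induction e using Sym2.ind with
      | _ u w =>
      by_cases hu : u ∈ T.black
      · exact ⟨⟨⟨(u, w), he⟩, hu⟩, rfl⟩
      · have hw : w ∈ T.black := (T.bicolored _ _ (SimpleGraph.Adj.symm he)).2 hu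
        exact ⟨⟨⟨(w, u), SimpleGraph.Adj.symm he⟩, hw⟩, Subtype.ext Sym2.eq_swap⟩
  let W : Equiv.Perm BD := Equiv.Perm.subtypePerm
    ((Function.Involutive.toPerm _ SimpleGraph.Dart.symm_involutive) * T.rot *
      (Function.Involutive.toPerm _ SimpleGraph.Dart.symm_involutive)) (fun a => by
        change (T.rot a.symm).symm.fst ∈ T.black ↔ a.fst ∈ T.black
        rw [hflip, T.rot_fst, hflip, not_not])
  let R : Equiv.Perm BD := Equiv.Perm.subtypePerm T.rot (fun a => by rw [T.rot_fst])
  have hW : ∀ a, (W a).1 = (T.rot a.1.symm).symm := fun _ => rfl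
  have hR : ∀ a, (R a).1 = T.rot a.1 := fun _ => rfl
  -- On black darts this is two steps along the face.
  let F : Equiv.Perm BD := R * W
  have hF : ∀ a, (F a).1 = T.face (T.face a.1) := fun _ => rfl
  -- The tree has one face, and colors alternate along it; so one black dart is reached from another
  -- after an even number of face steps, which is a power of `F`.
  have htrans : ∀ a b : BD, F.SameCycle a b := by
    intro a b
    obtain ⟨k, -, hk⟩ := (T.face_sameCycle a.1 b.1).exists_pow_eq'
    have hcol : ∀ (k : ℕ) (a : T.graph.Dart), ((T.face ^ k) a).fst ∈ T.black ↔
        (a.fst ∈ T.black ↔ Even k) := by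
      intro k
      induction k with
      | zero => simp
      | succ k ih =>
        intro a
        rw [pow_succ', Equiv.Perm.mul_apply, T.face_apply, T.rot_fst, hflip, ih, Nat.even_add_one]
        tauto
    have hF2 : ∀ (k : ℕ) (a : BD), ((F ^ k) a).1 = (T.face ^ (2 * k)) a.1 := by
      intro k
      induction k with
      | zero => intro a; rfl
      | succ k ih =>
        intro a
        rw [pow_succ', Equiv.Perm.mul_apply, hF, ih, mul_add, mul_one, pow_succ', pow_succ',
          Equiv.Perm.mul_apply, Equiv.Perm.mul_apply]
    have h1 := hcol k a.1
    rw [hk] at h1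
    obtain ⟨m, hm⟩ := (h1.1 b.2).1 a.2
    refine ⟨m, Subtype.ext ?_⟩
    rw [zpow_natCast, hF2, two_mul, ← hm, hk]
  have : Nonempty BD := by
    rw [← not_isEmpty_iff]
    intro h
    rw [Nat.card_of_isEmpty] at hBD
    omega
  obtain ⟨a0⟩ := this
  -- `F` is transitive on the `n` black darts, so the iterates of `a0` number them by `Fin n` with
  -- `F` acting as `i ↦ i + 1`.
  have hper : Function.minimalPeriod F a0 = n := by
    have := Fintype.ofFinite BD
    have h1 := Equiv.Perm.SameCycle.refl F a0
    have h2 := MulAction.minimalPeriod_eq_card (a := F) (b := a0)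
    have h3 : MulAction.orbit (Subgroup.zpowers F) a0 = Set.univ := by
      ext b
      simp only [Set.mem_univ, iff_true]
      obtain ⟨k, hk⟩ := htrans a0 b
      exact ⟨⟨F ^ k, k, rfl⟩, hk⟩
    have h4 : (F • · : BD → BD) = F := rfl
    rw [h4] at h2
    rw [h2, ← Nat.card_eq_fintype_card, h3, ← hBD]
    exact Nat.card_congr (Equiv.Set.univ _)
  let E0 : Fin n → BD := fun i => F^[i] a0
  have hE0 : Function.Injective E0 := by
    intro i j hij
    have := (Function.iterate_eq_iterate_iff_of_lt_minimalPeriod (f := F) (x := a0)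
      (by rw [hper]; exact i.isLt) (by rw [hper]; exact j.isLt)).1 hij
    exact Fin.ext this
  have hE0' : Function.Bijective E0 := by
    have := Fintype.ofFinite BD
    rw [Fintype.bijective_iff_injective_and_card]
    exact ⟨hE0, by rw [Fintype.card_fin, ← Nat.card_eq_fintype_card, hBD]⟩
  let E : Fin n ≃ BD := Equiv.ofBijective E0 hE0'
  have hEs : ∀ i, E (i + 1) = F (E i) := by
    intro i
    change F^[(i + 1).val] a0 = F (F^[i] a0)
    rw [← Function.iterate_succ_apply' F]
    rcases eq_or_lt_of_le (show i.val + 1 ≤ n by omega) with h | h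
    · rw [val_add_one_last h, Nat.succ_eq_add_one, h, ← hper, Function.iterate_minimalPeriod]; rfl
    · rw [val_add_one h]
  let τ : Equiv.Perm (Fin n) := (E.trans W).trans E.symm
  have hτ : ∀ i, E (τ i) = W (E i) := fun i => by simp [τ]
  have hτ' : ∀ i, E (i + 1) = R (E (τ i)) := fun i => by rw [hEs, hτ]; rfl
  let ε : Fin n → T.graph.Dart := fun i => (E i).1
  have hεi : Function.Injective ε := fun i j hij => E.injective (Subtype.ext hij)
  have hεr : ∀ a, a ∈ Set.range ε ↔ a.fst ∈ T.black := by
    intro a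
    constructor
    · rintro ⟨i, rfl⟩; exact (E i).2
    · intro ha; exact ⟨E.symm ⟨a, ha⟩, by simp [ε]⟩
  have h1 : ∀ i, T.rot (ε i).symm = (ε (τ i)).symm := fun i => by
    simp only [ε, hτ, hW, SimpleGraph.Dart.symm_symm]
  have h2 : ∀ i, T.rot (ε (τ i)) = ε (i + 1) := fun i => by
    simp only [ε, hτ', hR]
  have hb := T.isLabeling (g := ε) hεi (P := fun v => v ∈ T.black) T.bicolored hεr
    (σ := compl τ) (fun i => by
      obtain ⟨j, rfl⟩ := τ.surjective i
      rw [h2, compl_apply]) T.lab_black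
  have hw := T.isLabeling (g := fun i => (ε i).symm)
    (fun i j hij => hεi (SimpleGraph.Dart.symm_involutive.injective hij))
    (P := fun v => v ∉ T.black) (fun u v h => by
      rw [not_not]; exact (T.bicolored v u h.symm).symm)
    (fun a => by
      rw [← hflip]
      constructor
      · rintro ⟨i, rfl⟩
        rw [SimpleGraph.Dart.symm_symm]
        exact (E i).2
      · intro ha
        obtain ⟨i, hi⟩ := (hεr _).2 ha
        exact ⟨i, by simp only [hi, SimpleGraph.Dart.symm_symm]⟩) (σ := τ) h1 T.lab_white
  refine ⟨⟨τ, fun j => T.weight ⟨(ε j).edge, (ε j).edge_mem⟩, fun j => T.lab (ε j).snd,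
    fun j => T.lab (ε j).fst, ?_, hb⟩, ε, ⟨hεi, hεr, h1, h2, fun _ => rfl, fun _ => rfl, fun _ => rfl⟩⟩
  convert hw using 3
  · simp
  · rfl

end LWBPTree

end

/-! ### The labeled plane tree of a code. -/

section

open CyclePerm Finset

variable {S : Type} [DecidableEq S] {Ξ : LabeledPassport S} {n : ℕ} [NeZero n]

namespace TreeCode

variable (X : TreeCode Ξ n)

/-- White vertices and black vertices, each represented by the last one of its edges. -/
abbrev Vertex : Type := {i // top X.white i = i} ⊕ {i // top (compl X.white) i = i}

/-- The white vertex of an edge. -/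
def whiteVertex (i : Fin n) : X.Vertex := Sum.inl ⟨top X.white i, top_top _ _⟩

/-- The black vertex of an edge. -/
def blackVertex (i : Fin n) : X.Vertex := Sum.inr ⟨top (compl X.white) i, top_top _ _⟩

theorem whiteVertex_eq_iff {i j : Fin n} :
    X.whiteVertex i = X.whiteVertex j ↔ X.white.SameCycle i j := by
  simp [whiteVertex, top_eq_iff]

theorem blackVertex_eq_iff {i j : Fin n} :
    X.blackVertex i = X.blackVertex j ↔ (compl X.white).SameCycle i j := by
  simp [blackVertex, top_eq_iff]

theorem vertex_cases {p : X.Vertex → Prop} (hw : ∀ i, p (X.whiteVertex i))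
    (hb : ∀ i, p (X.blackVertex i)) (v : X.Vertex) : p v := by
  rcases v with ⟨i, hi⟩ | ⟨i, hi⟩
  · have := hw i; rwa [whiteVertex, show (⟨top X.white i, top_top _ _⟩ : {i // top X.white i = i}) = ⟨i, hi⟩ from Subtype.ext hi] at this
  · have := hb i; rwa [blackVertex, show (⟨top (compl X.white) i, top_top _ _⟩ : {i // top (compl X.white) i = i}) = ⟨i, hi⟩ from Subtype.ext hi] at this

/-- The tree of a code. -/
def graph : SimpleGraph X.Vertex where
  Adj u v := ∃ i, (u = X.blackVertex i ∧ v = X.whiteVertex i) ∨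
    (u = X.whiteVertex i ∧ v = X.blackVertex i)
  symm := ⟨fun u v ⟨i, h⟩ => ⟨i, h.symm.imp And.symm And.symm⟩⟩
  loopless := ⟨fun u ⟨i, h⟩ => by
    rcases h with ⟨h1, h2⟩ | ⟨h1, h2⟩ <;> rw [h1] at h2 <;> simp [whiteVertex, blackVertex] at h2⟩

theorem adj (i : Fin n) : X.graph.Adj (X.blackVertex i) (X.whiteVertex i) := ⟨i, Or.inl ⟨rfl, rfl⟩⟩

/-- The black vertices of `i` and `i + 1` are joined through the white vertex of `i`: it is also
that of `white i`, whose black vertex is that of `i + 1`. -/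
theorem graph_connected : X.graph.Connected := by
  have h1 : ∀ k (hk : k < n), X.graph.Reachable (X.blackVertex 0) (X.blackVertex ⟨k, hk⟩) := by
    intro k
    induction k with
    | zero => intro hk; exact SimpleGraph.Reachable.refl _
    | succ k ih =>
      intro hk
      refine (ih (by omega)).trans ?_
      set i : Fin n := ⟨k, by omega⟩
      have h2 : (⟨k + 1, hk⟩ : Fin n) = i + 1 := by ext; rw [val_add_one]; exact hk
      have h3 : X.whiteVertex i = X.whiteVertex (X.white i) :=
        X.whiteVertex_eq_iff.2 (by simp [Equiv.Perm.SameCycle.refl])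
      have h4 : X.blackVertex (X.white i) = X.blackVertex (i + 1) :=
        X.blackVertex_eq_iff.2 (X.white_sameCycle_add_one i)
      rw [h2, ← h4]
      refine (X.adj i).reachable.trans ?_
      rw [h3]
      exact (X.adj _).symm.reachable
  have h2 : ∀ v, X.graph.Reachable (X.blackVertex 0) v :=
    X.vertex_cases (fun i => (h1 i i.isLt).trans (X.adj i).reachable) fun i => h1 i i.isLt
  exact { preconnected := fun u v => (h2 u).symm.trans (h2 v), nonempty := ⟨X.blackVertex 0⟩ }

variable (hn : Ξ.size = n + 1)

/-- The darts of the tree of a code, from black to white if the flag is set. -/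
def dart (x : Fin n × Bool) : X.graph.Dart :=
  bif x.2 then ⟨(X.blackVertex x.1, X.whiteVertex x.1), X.adj x.1⟩
  else ⟨(X.whiteVertex x.1, X.blackVertex x.1), (X.adj x.1).symm⟩

-- Injectivity is the absence of multiple edges, that is, `Noncrossing.eq_of_sameCycle`.
include hn in
theorem dart_bijective : Function.Bijective X.dart := by
  constructor
  · rintro ⟨i, b⟩ ⟨j, c⟩ h
    have h1 := congrArg (fun d => d.fst) h
    have h2 := congrArg (fun d => d.snd) h
    cases b <;> cases c <;> simp only [dart, cond_true, cond_false] at h1 h2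
    · rw [X.whiteVertex_eq_iff] at h1
      rw [X.blackVertex_eq_iff] at h2
      rw [(X.noncrossing hn).eq_of_sameCycle h1 h2]
    · simp [whiteVertex, blackVertex] at h1
    · simp [whiteVertex, blackVertex] at h1
    · rw [X.blackVertex_eq_iff] at h1
      rw [X.whiteVertex_eq_iff] at h2
      rw [(X.noncrossing hn).eq_of_sameCycle h2 h1]
  · rintro ⟨⟨u, v⟩, h⟩
    have h' := h
    obtain ⟨i, ⟨rfl, rfl⟩ | ⟨rfl, rfl⟩⟩ := h'
    · exact ⟨(i, true), rfl⟩
    · exact ⟨(i, false), rfl⟩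

include hn in
theorem edge_bijective : Function.Bijective fun i =>
    (⟨(X.dart (i, true)).edge, (X.dart (i, true)).edge_mem⟩ : X.graph.edgeSet) := by
  constructor
  · intro i j hij
    simp only [Subtype.mk.injEq] at hij
    rcases (SimpleGraph.dart_edge_eq_iff _ _).1 hij with h | h
    · simpa using (X.dart_bijective hn).1 h
    · have : X.dart (i, true) = X.dart (j, false) := h
      simpa using (X.dart_bijective hn).1 this
  · rintro ⟨e, he⟩
    induction e using Sym2.ind with
    | _ u v =>
    have h' := he
    obtain ⟨i, ⟨rfl, rfl⟩ | ⟨rfl, rfl⟩⟩ := h'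
    · exact ⟨i, rfl⟩
    · exact ⟨i, Subtype.ext Sym2.eq_swap⟩

-- A connected graph with `n` edges and `n + 1` vertices, the vertices being counted by the tops of
-- the cycles.
include hn in
theorem graph_isTree : X.graph.IsTree := by
  rw [SimpleGraph.isTree_iff_connected_and_card]
  refine ⟨X.graph_connected, ?_⟩
  rw [← Nat.card_congr (Equiv.ofBijective _ (X.edge_bijective hn)), Nat.card_fin, ← hn,
    Nat.card_eq_fintype_card, Fintype.card_sum, Fintype.card_subtype, Fintype.card_subtype,
    X.labeling_white.card_tops, X.labeling_black.card_tops, LabeledPassport.size, add_comm]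

/-- The rotation on the index set of the darts. -/
def rotIndex : Equiv.Perm (Fin n × Bool) where
  toFun x := (bif x.2 then compl X.white x.1 else X.white x.1, x.2)
  invFun x := (bif x.2 then (compl X.white).symm x.1 else X.white.symm x.1, x.2)
  left_inv := by rintro ⟨i, b⟩; cases b <;> simp
  right_inv := by rintro ⟨i, b⟩; cases b <;> simp

/-- The plane tree of a code. -/
noncomputable def toWBPTree : WBPTree where
  V := X.Vertex
  finite := inferInstance
  graph := X.graph
  isTree := X.graph_isTree hn
  black := Set.range X.blackVertex
  bicolored := by
    have h1 : ∀ i, X.whiteVertex i ∉ Set.range X.blackVertex := by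
      rintro i ⟨j, hj⟩; simp [whiteVertex, blackVertex] at hj
    rintro u v ⟨i, ⟨rfl, rfl⟩ | ⟨rfl, rfl⟩⟩ <;> simp [h1]
  weight e := X.wt ((Equiv.ofBijective _ (X.edge_bijective hn)).symm e)
  rot := ((Equiv.ofBijective _ (X.dart_bijective hn)).symm.trans X.rotIndex).trans
    (Equiv.ofBijective _ (X.dart_bijective hn))
  rot_cycle := by
    intro a b
    obtain ⟨⟨i, b1⟩, rfl⟩ := (X.dart_bijective hn).2 a
    obtain ⟨⟨j, b2⟩, rfl⟩ := (X.dart_bijective hn).2 b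
    have h0 : ∀ x, (((Equiv.ofBijective _ (X.dart_bijective hn)).symm.trans X.rotIndex).trans
        (Equiv.ofBijective _ (X.dart_bijective hn))) (X.dart x) = X.dart (X.rotIndex x) := by
      intro x
      have : (Equiv.ofBijective _ (X.dart_bijective hn)).symm (X.dart x) = x := by
        rw [Equiv.symm_apply_eq]; rfl
      exact congrArg (fun y => X.dart (X.rotIndex y)) this
    rw [Equiv.Perm.sameCycle_iff_of_semiconj (X.dart_bijective hn).1 h0]
    have h1 : ∀ (x y : Fin n × Bool), X.rotIndex.SameCycle x y → x.2 = y.2 := by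
      intro x y hxy
      obtain ⟨k, -, rfl⟩ := hxy.exists_pow_eq'
      clear hxy
      induction k with
      | zero => rfl
      | succ k ih => rw [pow_succ', Equiv.Perm.mul_apply, ih]; rfl
    have h2 : X.rotIndex.SameCycle (i, true) (j, true) ↔ (compl X.white).SameCycle i j :=
      Equiv.Perm.sameCycle_iff_of_semiconj (g := fun i => (i, true))
        (fun a b h => by simpa using h) fun a => rfl
    have h3 : X.rotIndex.SameCycle (i, false) (j, false) ↔ X.white.SameCycle i j :=
      Equiv.Perm.sameCycle_iff_of_semiconj (g := fun i => (i, false))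
        (fun a b h => by simpa using h) fun a => rfl
    cases b1 <;> cases b2
    · rw [h3]; exact X.whiteVertex_eq_iff.symm
    · refine ⟨fun h => absurd (h1 _ _ h) (by simp), fun h => ?_⟩
      simp [dart, whiteVertex, blackVertex] at h
    · refine ⟨fun h => absurd (h1 _ _ h) (by simp), fun h => ?_⟩
      simp [dart, whiteVertex, blackVertex] at h
    · rw [h2]; exact X.blackVertex_eq_iff.symm

theorem rot_dart (x : Fin n × Bool) :
    (X.toWBPTree hn).rot (X.dart x) = X.dart (X.rotIndex x) := by
  have : (Equiv.ofBijective _ (X.dart_bijective hn)).symm (X.dart x) = x := by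
    rw [Equiv.symm_apply_eq]; rfl
  exact congrArg (fun y => X.dart (X.rotIndex y)) this

theorem weight_dart (i : Fin n) : (X.toWBPTree hn).weight
    ⟨(X.dart (i, true)).edge, (X.dart (i, true)).edge_mem⟩ = X.wt i := by
  have : (Equiv.ofBijective _ (X.edge_bijective hn)).symm
    ⟨(X.dart (i, true)).edge, (X.dart (i, true)).edge_mem⟩ = i := by
    rw [Equiv.symm_apply_eq]; rfl
  exact congrArg X.wt this

theorem whiteVertex_notMem (i : Fin n) : X.whiteVertex i ∉ (X.toWBPTree hn).black := by
  rintro ⟨j, hj⟩; simp [whiteVertex, blackVertex] at hj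

theorem blackVertex_mem (i : Fin n) : X.blackVertex i ∈ (X.toWBPTree hn).black := ⟨i, rfl⟩

theorem wt_blackVertex (i : Fin n) : (X.toWBPTree hn).wt (X.blackVertex i) = (X.lb i).1 := by
  classical
  rw [← X.labeling_black.sum_cycle i, ← WBPTree.weight_sum (X.toWBPTree hn)
    (g := fun j => X.dart (j, true)) (P := fun v => v ∈ (X.toWBPTree hn).black)
    (fun a b h => by simpa using (X.dart_bijective hn).1 h) (X.toWBPTree hn).bicolored
    (fun a => ?_) (X.blackVertex_mem hn i)]
  · refine Finset.sum_congr (Finset.filter_congr fun j _ => ?_) fun j _ => ?_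
    · rw [Equiv.Perm.sameCycle_comm]; exact X.blackVertex_eq_iff
    · exact congrArg PNat.val (X.weight_dart hn j)
  · obtain ⟨⟨j, b⟩, rfl⟩ := (X.dart_bijective hn).2 a
    cases b
    · refine ⟨?_, fun h => (X.whiteVertex_notMem hn j h).elim⟩
      rintro ⟨k, hk⟩
      have := (X.dart_bijective hn).1 hk
      simp at this
    · exact ⟨fun _ => X.blackVertex_mem hn j, fun _ => ⟨j, rfl⟩⟩

theorem wt_whiteVertex (i : Fin n) : (X.toWBPTree hn).wt (X.whiteVertex i) = (X.lw i).1 := by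
  classical
  rw [← X.labeling_white.sum_cycle i, ← WBPTree.weight_sum (X.toWBPTree hn)
    (g := fun j => X.dart (j, false)) (P := fun v => v ∉ (X.toWBPTree hn).black)
    (fun a b h => by simpa using (X.dart_bijective hn).1 h)
    (fun u v h => by rw [not_not]; exact ((X.toWBPTree hn).bicolored v u h.symm).symm)
    (fun a => ?_) (X.whiteVertex_notMem hn i)]
  · refine Finset.sum_congr (Finset.filter_congr fun j _ => ?_) fun j _ => ?_
    · rw [Equiv.Perm.sameCycle_comm]; exact X.whiteVertex_eq_iff
    · refine congrArg PNat.val (Eq.trans ?_ (X.weight_dart hn j))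
      exact congrArg (X.toWBPTree hn).weight (Subtype.ext Sym2.eq_swap)
  · obtain ⟨⟨j, b⟩, rfl⟩ := (X.dart_bijective hn).2 a
    cases b
    · exact ⟨fun _ => X.whiteVertex_notMem hn j, fun _ => ⟨j, rfl⟩⟩
    · refine ⟨?_, fun h => (h (X.blackVertex_mem hn j)).elim⟩
      rintro ⟨k, hk⟩
      have := (X.dart_bijective hn).1 hk
      simp at this

/-- The labeled plane tree of a code. -/
noncomputable def toTree : LWBPTree Ξ where
  toWBPTree := X.toWBPTree hn
  lab := Sum.elim (fun i => X.lw i) fun i => X.lb i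
  lab_weight := X.vertex_cases (fun i => by
      rw [X.wt_whiteVertex hn]
      simp [whiteVertex, ← X.labeling_white.eq_of_sameCycle (top_sameCycle X.white i)])
    (fun i => by
      rw [X.wt_blackVertex hn]
      simp [blackVertex, ← X.labeling_black.eq_of_sameCycle (top_sameCycle (compl X.white) i)])
  lab_black x := by
    rw [← X.labeling_black.card_tops_label x, ← Set.ncard_coe_finset]
    symm
    refine Set.ncard_congr (fun i _ => X.blackVertex i) ?_ ?_ ?_
    · intro i hi
      simp only [coe_filter, mem_univ, true_and, Set.mem_ofPred_eq] at hi
      refine ⟨X.blackVertex_mem hn i, ?_⟩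
      simp [blackVertex, hi.1, hi.2]
    · intro i j hi hj hij
      simp only [coe_filter, mem_univ, true_and, Set.mem_ofPred_eq] at hi hj
      have h1 := top_eq_iff.2 (X.blackVertex_eq_iff.1 hij)
      rwa [hi.1, hj.1] at h1
    · rintro v ⟨⟨i, rfl⟩, hv⟩
      refine ⟨top (compl X.white) i, ?_, X.blackVertex_eq_iff.2 (top_sameCycle _ _).symm⟩
      simp only [coe_filter, mem_univ, true_and, Set.mem_ofPred_eq, top_top]
      simpa [blackVertex] using hv
  lab_white x := by
    rw [← X.labeling_white.card_tops_label x, ← Set.ncard_coe_finset]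
    symm
    refine Set.ncard_congr (fun i _ => X.whiteVertex i) ?_ ?_ ?_
    · intro i hi
      simp only [coe_filter, mem_univ, true_and, Set.mem_ofPred_eq] at hi
      refine ⟨X.whiteVertex_notMem hn i, ?_⟩
      simp [whiteVertex, hi.1, hi.2]
    · intro i j hi hj hij
      simp only [coe_filter, mem_univ, true_and, Set.mem_ofPred_eq] at hi hj
      have h1 := top_eq_iff.2 (X.whiteVertex_eq_iff.1 hij)
      rwa [hi.1, hj.1] at h1
    · rintro v ⟨hv1, hv⟩
      obtain ⟨i, rfl⟩ | ⟨i, rfl⟩ : (∃ i, X.whiteVertex i = v) ∨ ∃ i, X.blackVertex i = v :=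
        X.vertex_cases (p := fun v => (∃ i, X.whiteVertex i = v) ∨ ∃ i, X.blackVertex i = v)
          (fun i => Or.inl ⟨i, rfl⟩) (fun i => Or.inr ⟨i, rfl⟩) v
      · refine ⟨top X.white i, ?_, X.whiteVertex_eq_iff.2 (top_sameCycle _ _).symm⟩
        simp only [coe_filter, mem_univ, true_and, Set.mem_ofPred_eq, top_top]
        simpa [whiteVertex] using hv
      · exact (hv1 (X.blackVertex_mem hn i)).elim

theorem realizes_toTree : Realizes X (X.toTree hn) (fun i => X.dart (i, true)) where
  injective i j h := by simpa using (X.dart_bijective hn).1 h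
  range a := by
    obtain ⟨⟨j, b⟩, rfl⟩ := (X.dart_bijective hn).2 a
    cases b
    · refine ⟨?_, fun h => (X.whiteVertex_notMem hn j h).elim⟩
      rintro ⟨k, hk⟩
      have := (X.dart_bijective hn).1 hk
      simp at this
    · exact ⟨fun _ => X.blackVertex_mem hn j, fun _ => ⟨j, rfl⟩⟩
  rot_symm i := X.rot_dart hn (i, false)
  rot_white i := by
    have := X.rot_dart hn (X.white i, true)
    simp only [rotIndex, Equiv.coe_fn_mk, cond_true, compl_apply] at this
    exact this
  weight i := X.weight_dart hn i
  lab_fst i := (X.labeling_black.eq_of_sameCycle (top_sameCycle (compl X.white) i)).symm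
  lab_snd i := (X.labeling_white.eq_of_sameCycle (top_sameCycle X.white i)).symm

end TreeCode

end

/-! ### Plane trees as orbits of codes; Burnside's lemma. -/

section

open CyclePerm Finset

variable {S : Type} [DecidableEq S] {Ξ : LabeledPassport S} {n : ℕ} [NeZero n]

namespace Realizes

variable {X Y : TreeCode Ξ n} {T T' : LWBPTree Ξ} {ε : Fin n → T.graph.Dart}
  {ε' : Fin n → T'.graph.Dart}

theorem fst_eq_iff (h : Realizes X T ε) {i j : Fin n} :
    (ε i).fst = (ε j).fst ↔ (compl X.white).SameCycle i j := by
  rw [← T.rot_cycle]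
  exact Equiv.Perm.sameCycle_iff_of_semiconj h.injective fun i => by
    obtain ⟨k, rfl⟩ := X.white.surjective i
    rw [h.rot_white, compl_apply]

theorem snd_eq_iff (h : Realizes X T ε) {i j : Fin n} :
    (ε i).snd = (ε j).snd ↔ X.white.SameCycle i j := by
  have h1 := T.rot_cycle (ε i).symm (ε j).symm
  refine h1.symm.trans ?_
  exact Equiv.Perm.sameCycle_iff_of_semiconj (g := fun i => (ε i).symm)
    (SimpleGraph.Dart.symm_involutive.injective.comp h.injective) h.rot_symm

theorem fst_mem (h : Realizes X T ε) (i : Fin n) : (ε i).fst ∈ T.black := (h.range _).1 ⟨i, rfl⟩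

theorem snd_notMem (h : Realizes X T ε) (i : Fin n) : (ε i).snd ∉ T.black :=
  (T.bicolored _ _ (ε i).adj).1 (h.fst_mem i)

theorem exists_dart (h : Realizes X T ε) {u v : T.V} (huv : T.graph.Adj u v) :
    (∃ i, (ε i).fst = u ∧ (ε i).snd = v) ∨ ∃ i, (ε i).snd = u ∧ (ε i).fst = v := by
  by_cases hu : u ∈ T.black
  · obtain ⟨i, hi⟩ := (h.range ⟨(u, v), huv⟩).2 hu
    exact Or.inl ⟨i, by simp [hi], by simp [hi]⟩
  · have hv : v ∈ T.black := (T.bicolored _ _ huv.symm).2 hu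
    obtain ⟨i, hi⟩ := (h.range ⟨(v, u), huv.symm⟩).2 hv
    exact Or.inr ⟨i, by simp [hi], by simp [hi]⟩

theorem exists_vertex (h : Realizes X T ε) (v : T.V) :
    (∃ i, (ε i).fst = v) ∨ ∃ i, (ε i).snd = v := by
  obtain ⟨p⟩ := T.isTree.connected v (ε 0).fst
  cases p with
  | nil => exact Or.inl ⟨0, rfl⟩
  | cons hvw _ =>
    rcases h.exists_dart hvw with ⟨i, hi, -⟩ | ⟨i, hi, -⟩
    · exact Or.inl ⟨i, hi⟩
    · exact Or.inr ⟨i, hi⟩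

/-- The correspondence of vertices between two trees with the same code. -/
theorem exists_vertexMap (h : Realizes X T ε) (h' : Realizes X T' ε') : ∃ f : T.V → T'.V,
    (∀ i, f (ε i).fst = (ε' i).fst) ∧ ∀ i, f (ε i).snd = (ε' i).snd := by
  have hex : ∀ v, ∃ w, (∀ i, (ε i).fst = v → (ε' i).fst = w) ∧ ∀ i, (ε i).snd = v → (ε' i).snd = w := by
    intro v
    rcases h.exists_vertex v with ⟨i, rfl⟩ | ⟨i, rfl⟩
    · refine ⟨(ε' i).fst, fun j hj => ?_, fun j hj => ?_⟩
      · rw [h'.fst_eq_iff, ← h.fst_eq_iff, hj]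
      · exact absurd (hj ▸ h.fst_mem i) (h.snd_notMem j)
    · refine ⟨(ε' i).snd, fun j hj => ?_, fun j hj => ?_⟩
      · exact absurd (hj ▸ h.fst_mem j) (h.snd_notMem i)
      · rw [h'.snd_eq_iff, ← h.snd_eq_iff, hj]
  choose f hf1 hf2 using hex
  exact ⟨f, fun i => (hf1 _ i rfl).symm, fun i => (hf2 _ i rfl).symm⟩

/-- Vertices are cycles of the two permutations of the code, so matching darts with equal indices is
well defined on vertices and preserves all structure. -/
theorem same (h : Realizes X T ε) (h' : Realizes X T' ε') : LWBPTree.Same T T' := by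
  obtain ⟨f, hf1, hf2⟩ := h.exists_vertexMap h'
  obtain ⟨g, hg1, hg2⟩ := h'.exists_vertexMap h
  have hgf : ∀ v, g (f v) = v := fun v => by
    rcases h.exists_vertex v with ⟨i, rfl⟩ | ⟨i, rfl⟩
    · rw [hf1, hg1]
    · rw [hf2, hg2]
  have hfg : ∀ v, f (g v) = v := fun v => by
    rcases h'.exists_vertex v with ⟨i, rfl⟩ | ⟨i, rfl⟩
    · rw [hg1, hf1]
    · rw [hg2, hf2]
  let F : T.graph ≃g T'.graph :=
    { toFun := f
      invFun := g
      left_inv := hgf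
      right_inv := hfg
      map_rel_iff' := by
        intro u v
        change T'.graph.Adj (f u) (f v) ↔ T.graph.Adj u v
        constructor
        · intro huv
          rw [← hgf u, ← hgf v]
          rcases h'.exists_dart huv with ⟨i, h1, h2⟩ | ⟨i, h1, h2⟩
          · rw [← h1, ← h2, hg1, hg2]; exact (ε i).adj
          · rw [← h1, ← h2, hg1, hg2]; exact (ε i).adj.symm
        · intro huv
          rcases h.exists_dart huv with ⟨i, rfl, rfl⟩ | ⟨i, rfl, rfl⟩
          · rw [hf1, hf2]; exact (ε' i).adj
          · rw [hf1, hf2]; exact (ε' i).adj.symm }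
  have hF : ∀ v, F v = f v := fun _ => rfl
  have hε : ∀ i, F.toHom.mapDart (ε i) = ε' i := fun i => by
    ext
    · exact hf1 i
    · exact hf2 i
  have hε' : ∀ i, F.toHom.mapDart (ε i).symm = (ε' i).symm := fun i => by
    ext
    · exact hf2 i
    · exact hf1 i
  refine ⟨F, fun v => ?_, fun e => ?_, fun a => ?_, fun v => ?_⟩
  · rw [hF]
    rcases h.exists_vertex v with ⟨i, rfl⟩ | ⟨i, rfl⟩
    · rw [hf1]; exact iff_of_true (h'.fst_mem i) (h.fst_mem i)
    · rw [hf2]; exact iff_of_false (h'.snd_notMem i) (h.snd_notMem i)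
  · obtain ⟨e, he⟩ := e
    obtain ⟨i, rfl⟩ : ∃ i, (ε i).edge = e := by
      induction e using Sym2.ind with
      | _ u v =>
      rcases h.exists_dart he with ⟨i, rfl, rfl⟩ | ⟨i, rfl, rfl⟩
      · exact ⟨i, rfl⟩
      · exact ⟨i, Sym2.eq_swap⟩
    rw [h.weight i, ← h'.weight i]
    congr 1
    ext1
    rw [← hε i]
    rfl
  · by_cases ha : a.fst ∈ T.black
    · obtain ⟨i, rfl⟩ := (h.range a).2 ha
      obtain ⟨j, rfl⟩ := X.white.surjective i
      rw [h.rot_white, hε, hε, h'.rot_white]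
    · have hs : a.symm.fst ∈ T.black := (T.bicolored _ _ a.symm.adj).2 ha
      obtain ⟨i, hi⟩ := (h.range a.symm).2 hs
      have : a = (ε i).symm := by rw [hi, SimpleGraph.Dart.symm_symm]
      rw [this, h.rot_symm, hε', hε', h'.rot_symm]
  · rw [hF]
    rcases h.exists_vertex v with ⟨i, rfl⟩ | ⟨i, rfl⟩
    · rw [hf1, h.lab_fst, h'.lab_fst]
    · rw [hf2, h.lab_snd, h'.lab_snd]

theorem shift (h : Realizes X T ε) (s : Fin n) : Realizes (X.shift s) T fun i => ε (i + s) where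
  injective i j hij := add_right_cancel (h.injective hij)
  range a := by
    rw [← h.range]
    constructor
    · rintro ⟨i, rfl⟩; exact ⟨_, rfl⟩
    · rintro ⟨i, rfl⟩; exact ⟨i - s, by simp⟩
  rot_symm i := by rw [h.rot_symm, X.shift_white, sub_add_cancel]
  rot_white i := by rw [X.shift_white, sub_add_cancel, h.rot_white, add_right_comm]
  weight i := h.weight (i + s)
  lab_fst i := h.lab_fst (i + s)
  lab_snd i := h.lab_snd (i + s)

/-- The isomorphism sends dart `0` to some dart `s`. The successor in the numbering is obtained by
rotating once at the white and once at the black end, so every dart `i` is sent to dart `i + s`. -/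
theorem exists_shift_eq (h : Realizes X T ε) (h' : Realizes Y T' ε') (hs : LWBPTree.Same T T') :
    ∃ s, Y.shift s = X := by
  obtain ⟨f, hb, hw, hr, hl⟩ := hs
  obtain ⟨s, hs⟩ := (h'.range (f.toHom.mapDart (ε 0))).2 ((hb _).2 (h.fst_mem 0))
  have hsymm : ∀ a : T.graph.Dart, f.toHom.mapDart a.symm = (f.toHom.mapDart a).symm := fun a => rfl
  have step : ∀ i, f.toHom.mapDart (ε i) = ε' (i + s) →
      f.toHom.mapDart (ε (X.white i)) = ε' (Y.white (i + s)) := by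
    intro i hi
    have h1 := hr (ε i).symm
    rw [h.rot_symm, hsymm, hsymm, hi, h'.rot_symm] at h1
    exact SimpleGraph.Dart.symm_involutive.injective h1.symm
  have hk : ∀ k (hk : k < n), f.toHom.mapDart (ε ⟨k, hk⟩) = ε' (⟨k, hk⟩ + s) := by
    intro k
    induction k with
    | zero =>
      intro hk
      have : (⟨0, hk⟩ : Fin n) = 0 := by ext; simp
      rw [this, zero_add, hs]
    | succ k ih =>
      intro hk
      have h2 : (⟨k + 1, hk⟩ : Fin n) = ⟨k, by omega⟩ + 1 := by ext; rw [val_add_one]; exact hk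
      have h3 := step _ (ih (by omega))
      have h4 := hr (ε (X.white ⟨k, by omega⟩))
      rw [h.rot_white, h3, h'.rot_white] at h4
      rw [h2, ← h4, add_right_comm]
  have hall : ∀ i, f.toHom.mapDart (ε i) = ε' (i + s) := fun i => hk i i.isLt
  refine ⟨s, TreeCode.ext_apply (fun i => ?_) (fun i => ?_) (fun i => ?_) fun i => ?_⟩
  · rw [Y.shift_white, sub_eq_iff_eq_add]
    refine h'.injective ?_
    rw [← hall, step i (hall i)]
  · rw [Y.shift_wt, ← h.weight i, ← hw, ← h'.weight]
    congr 1
    ext1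
    rw [← hall]
    rfl
  · rw [Y.shift_lw, ← h'.lab_snd, ← hall, ← h.lab_snd]
    exact hl _
  · rw [Y.shift_lb, ← h'.lab_fst, ← hall, ← h.lab_fst]
    exact hl _

end Realizes

namespace TreeCode

/-- Plane trees are codes up to the choice of the root edge. -/
theorem card_tree (hn : Ξ.size = n + 1) :
    Nat.card Ξ.Tree = Nat.card (Quotient (AddAction.orbitRel (Fin n) (TreeCode Ξ n))) := by
  symm
  refine Nat.card_congr (Equiv.ofBijective (Quotient.lift
    (fun X : TreeCode Ξ n => (Quotient.mk (LWBPTree.setoid Ξ) (X.toTree hn))) ?_) ⟨?_, ?_⟩)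
  · rintro X Y ⟨s, hs⟩
    refine Quotient.sound ?_
    have h1 := (Y.realizes_toTree hn).shift s
    have h2 : Y.shift s = X := hs
    rw [h2] at h1
    exact (X.realizes_toTree hn).same h1
  · intro a b
    induction a using Quotient.inductionOn with | _ X =>
    induction b using Quotient.inductionOn with | _ Y =>
    intro h
    obtain ⟨s, hs⟩ := (X.realizes_toTree hn).exists_shift_eq (Y.realizes_toTree hn) (Quotient.exact h)
    exact Quotient.sound ⟨s, hs⟩
  · intro t
    induction t using Quotient.inductionOn with | _ T =>
    obtain ⟨X, ε, h⟩ := T.exists_realizes hn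
    exact ⟨Quotient.mk _ X, Quotient.sound ((X.realizes_toTree hn).same h)⟩

theorem card_tree_mul (hΞ : Ξ.IsPrimitive) (hn : Ξ.size = n + 1) :
    Nat.card Ξ.Tree * n = ∑ s : Fin n, Nat.card {X : TreeCode Ξ n // X.shift s = X} := by
  classical
  have := finite hΞ hn
  have := Fintype.ofFinite (TreeCode Ξ n)
  have := Fintype.ofFinite (Quotient (AddAction.orbitRel (Fin n) (TreeCode Ξ n)))
  have h := AddAction.sum_card_fixedBy_eq_card_orbits_mul_card_addGroup (Fin n) (TreeCode Ξ n)
  rw [card_tree hn, Nat.card_eq_fintype_card]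
  rw [Fintype.card_fin] at h
  rw [← h]
  exact Finset.sum_congr rfl fun s _ => by rw [← Nat.card_eq_fintype_card]; rfl

/-- With distinct labels there are `n!` codes and the action of `Fin n` is free. -/
theorem card_tree_of_nodup (hΞ : Ξ.IsPrimitive) (hn : Ξ.size = n + 1) (hp : Ξ.pos.Nodup)
    (hq : Ξ.neg.Nodup) : Nat.card Ξ.Tree = (n - 1)! := by
  have h1 := card_tree_mul hΞ hn
  have hpos := NeZero.pos n
  rw [Finset.sum_eq_single 0] at h1
  · have h2 : Nat.card {X : TreeCode Ξ n // X.shift 0 = X} = Nat.card (TreeCode Ξ n) :=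
      Nat.card_congr (Equiv.subtypeUnivEquiv fun X => zero_vadd (Fin n) X)
    have h3 := card_mul hΞ hn
    have h4 : Ξ.multFactorial = 1 := by
      unfold LabeledPassport.multFactorial
      rw [Finset.prod_eq_one, Finset.prod_eq_one, one_mul]
      · intro x hx
        rw [Multiset.count_eq_one_of_mem hq (by simpa using hx)]; rfl
      · intro x hx
        rw [Multiset.count_eq_one_of_mem hp (by simpa using hx)]; rfl
    rw [h4, mul_one] at h3
    rw [h2, h3] at h1
    have h5 : n * (n - 1)! = n ! := Nat.mul_factorial_pred hpos.ne'
    rw [← h5, mul_comm] at h1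
    exact Nat.eq_of_mul_eq_mul_left hpos h1
  · intro s _ hs
    have : IsEmpty {X : TreeCode Ξ n // X.shift s = X} :=
      ⟨fun X => hs (eq_zero_of_shift_eq hn hp hq X.2)⟩
    exact Nat.card_of_isEmpty
  · simp

end TreeCode

end

/-! ### Cyclic covers, reduction modulo `m`, and the numerical ramification argument. -/

section

open CyclePerm Finset

namespace CyclePerm

section Cover

variable {α β : Type} [AddCommGroup α] [AddCommGroup β] [Fintype α] [Fintype β] [DecidableEq α]
  [DecidableEq β] {π : α →+ β} {σ : Equiv.Perm α} {σ' : Equiv.Perm β}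

theorem pow_semiconj (hπ : ∀ i, π (σ i) = σ' (π i)) (r : ℕ) (i : α) :
    π ((σ ^ r) i) = (σ' ^ r) (π i) := by
  induction r with
  | zero => rfl
  | succ r ih => rw [pow_succ', pow_succ', Equiv.Perm.mul_apply, Equiv.Perm.mul_apply, hπ, ih]

theorem pow_apply_add {a : α} (ha : ∀ i, σ (i + a) = σ i + a) (r : ℕ) (i : α) :
    (σ ^ r) (i + a) = (σ ^ r) i + a := by
  induction r with
  | zero => rfl
  | succ r ih => rw [pow_succ', Equiv.Perm.mul_apply, Equiv.Perm.mul_apply, ih, ha]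

theorem sameCycle_add {a : α} (ha : ∀ i, σ (i + a) = σ i + a) {i j : α} (h : σ.SameCycle i j) :
    σ.SameCycle (i + a) (j + a) := by
  obtain ⟨r, -, rfl⟩ := h.exists_pow_eq'
  exact ⟨r, by rw [zpow_natCast, pow_apply_add ha]⟩

theorem sameCycle_map (hπ : ∀ i, π (σ i) = σ' (π i)) {i j : α} (h : σ.SameCycle i j) :
    σ'.SameCycle (π i) (π j) := by
  obtain ⟨r, -, rfl⟩ := h.exists_pow_eq'
  exact ⟨r, by rw [zpow_natCast, pow_semiconj hπ]⟩

theorem exists_sameCycle_lift (hπ : ∀ i, π (σ i) = σ' (π i)) {i : α} {b : β}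
    (h : σ'.SameCycle (π i) b) : ∃ j, σ.SameCycle i j ∧ π j = b := by
  obtain ⟨r, -, rfl⟩ := h.exists_pow_eq'
  exact ⟨(σ ^ r) i, ⟨r, by rw [zpow_natCast]⟩, pow_semiconj hπ r i⟩

/-- The translations along the fibres of `π` that preserve the cycle of `i`. -/
def deck (π : α →+ β) (hσ : ∀ a, π a = 0 → ∀ i, σ (i + a) = σ i + a) (i : α) : AddSubgroup α where
  carrier := {a | π a = 0 ∧ σ.SameCycle i (i + a)}
  zero_mem' := by simp [Equiv.Perm.SameCycle.refl]
  add_mem' := by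
    rintro a b ⟨h1, h2⟩ ⟨h3, h4⟩
    refine ⟨by simp [h1, h3], ?_⟩
    rw [← add_assoc]
    exact h4.trans (by simpa [add_right_comm] using sameCycle_add (hσ b h3) h2)
  neg_mem' := by
    rintro a ⟨h1, h2⟩
    have h3 : π (-a) = 0 := by simp [h1]
    refine ⟨h3, ?_⟩
    simpa using (sameCycle_add (hσ _ h3) h2).symm

variable (hσ : ∀ a, π a = 0 → ∀ i, σ (i + a) = σ i + a)

theorem card_deck_dvd (i : α) : Nat.card (deck π hσ i) ∣ Nat.card π.ker :=
  AddSubgroup.card_dvd_of_le fun _ h => h.1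

/-- The cycle of `i` covers its image with the same number of sheets everywhere. -/
theorem card_deck_mul_sum (hπ : ∀ i, π (σ i) = σ' (π i)) (w : β → ℕ) (i : α) :
    Nat.card (deck π hσ i) * ∑ b with σ'.SameCycle (π i) b, w b =
      ∑ j with σ.SameCycle i j, w (π j) := by
  rw [← Finset.sum_fiberwise_of_maps_to (g := π)
    (t := univ.filter fun b => σ'.SameCycle (π i) b)]
  · rw [Finset.mul_sum]
    refine Finset.sum_congr rfl fun b hb => ?_
    simp only [mem_filter, mem_univ, true_and] at hb
    obtain ⟨j₀, hj₀, rfl⟩ := exists_sameCycle_lift hπ hb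
    rw [Finset.sum_congr rfl (g := fun _ => w (π j₀))]
    · rw [Finset.sum_const, smul_eq_mul]
      congr 1
      obtain ⟨r, -, rfl⟩ := hj₀.exists_pow_eq'
      rw [← Nat.card_eq_finsetCard]
      refine Nat.card_congr
        { toFun := fun a => ⟨(σ ^ r) i + a, ?_⟩
          invFun := fun x => ⟨x - (σ ^ r) i, ?_⟩
          left_inv := fun a => by simp
          right_inv := fun x => by simp }
      · obtain ⟨a, h1, h2⟩ := a
        simp only [mem_filter, mem_univ, true_and, map_add, h1,
          add_zero, and_true]
        rw [← pow_apply_add (hσ a h1)]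
        exact h2.trans ⟨r, by rw [zpow_natCast]⟩
      · obtain ⟨x, hx⟩ := x
        simp only [mem_filter, mem_univ, true_and] at hx
        have h1 : π (x - (σ ^ r) i) = 0 := by simp [hx.2]
        refine ⟨h1, ?_⟩
        refine hx.1.trans (Equiv.Perm.SameCycle.symm ⟨r, ?_⟩)
        rw [zpow_natCast, pow_apply_add (hσ _ h1)]
        simp
    · intro j hj
      simp only [mem_filter] at hj
      rw [hj.2]
  · intro j hj
    simp only [mem_filter, mem_univ, true_and] at hj ⊢
    exact sameCycle_map hπ hj

theorem sum_comp_eq (hs : Function.Surjective π) (w : β → ℕ) :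
    ∑ j, w (π j) = Nat.card π.ker * ∑ b, w b := by
  rw [← Finset.sum_fiberwise_of_maps_to (g := π) (t := univ) (by simp), Finset.mul_sum]
  refine Finset.sum_congr rfl fun b _ => ?_
  obtain ⟨j₀, rfl⟩ := hs b
  rw [Finset.sum_congr rfl (g := fun _ => w (π j₀)) (fun j hj => by
    simp only [mem_filter] at hj; rw [hj.2]), Finset.sum_const, smul_eq_mul]
  congr 1
  rw [← Nat.card_eq_finsetCard]
  refine Nat.card_congr
    { toFun := fun x => ⟨x - j₀, ?_⟩
      invFun := fun a => ⟨j₀ + a, ?_⟩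
      left_inv := fun a => by simp
      right_inv := fun x => by simp }
  · obtain ⟨x, hx⟩ := x
    simp only [mem_filter, mem_univ, true_and] at hx
    simp [AddMonoidHom.mem_ker, hx]
  · obtain ⟨a, ha⟩ := a
    rw [AddMonoidHom.mem_ker] at ha
    simp [ha]

include hσ in
-- Since `σ` commutes with translations by the kernel, `π (σ i)` depends only on `π i`; the same for
-- the inverse of `σ` gives the inverse permutation.
theorem exists_quotient (hs : Function.Surjective π) :
    ∃ σ' : Equiv.Perm β, ∀ i, π (σ i) = σ' (π i) := by
  have hσ' : ∀ a, π a = 0 → ∀ i, σ⁻¹ (i + a) = σ⁻¹ i + a := fun a ha i => by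
    rw [Equiv.Perm.inv_eq_iff_eq, hσ a ha]; simp
  have key : ∀ σ : Equiv.Perm α, (∀ a, π a = 0 → ∀ i, σ (i + a) = σ i + a) → ∀ i,
      π (σ (Function.surjInv hs (π i))) = π (σ i) := fun σ hσ i => by
    have h1 : π (Function.surjInv hs (π i) - i) = 0 := by
      rw [map_sub, Function.surjInv_eq hs, sub_self]
    have h2 := hσ _ h1 i
    rw [add_sub_cancel] at h2
    rw [h2, map_add, h1, add_zero]
  refine ⟨⟨fun b => π (σ (Function.surjInv hs b)), fun b => π (σ⁻¹ (Function.surjInv hs b)), ?_, ?_⟩,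
    fun i => (key σ hσ i).symm⟩
  · intro b
    simp only
    rw [key _ hσ', Equiv.Perm.inv_def, Equiv.symm_apply_apply, Function.surjInv_eq hs]
  · intro b
    simp only
    rw [key _ hσ, Equiv.Perm.inv_def, Equiv.apply_symm_apply, Function.surjInv_eq hs]

end Cover

/-- Reduction modulo `m`. -/
def modHom (d m : ℕ) [NeZero d] [NeZero m] : Fin (d * m) →+ Fin m where
  toFun i := Fin.ofNat m i
  map_zero' := by ext; simp
  map_add' i j := by ext; simp [Fin.val_add, Nat.mod_mod_of_dvd]

variable {d m : ℕ} [NeZero d] [NeZero m]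

theorem val_modHom (i : Fin (d * m)) : (modHom d m i).val = i.val % m := rfl

theorem modHom_surjective : Function.Surjective (modHom d m) := fun b => by
  have hd := NeZero.pos d
  have hb := b.isLt
  refine ⟨⟨b, by nlinarith⟩, ?_⟩
  ext
  rw [val_modHom]
  exact Nat.mod_eq_of_lt hb

theorem modHom_one : modHom d m 1 = 1 := by
  ext
  rw [val_modHom]
  simp

theorem card_ker_modHom : Nat.card (modHom d m).ker = d := by
  have h := sum_comp_eq (modHom_surjective (d := d) (m := m)) (fun _ => 1)
  simp only [sum_const, card_univ, Fintype.card_fin, smul_eq_mul, mul_one] at h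
  exact (Nat.eq_of_mul_eq_mul_right (NeZero.pos m) h).symm

theorem val_nsmul {n : ℕ} [NeZero n] (k : ℕ) (a : Fin n) : (k • a).val = k * a.val % n := by
  induction k with
  | zero => simp
  | succ k ih => rw [succ_nsmul, Fin.val_add, ih, Nat.mod_add_mod, Nat.succ_mul]

theorem modHom_eq_zero_iff {a : Fin (d * m)} : modHom d m a = 0 ↔ d • a = 0 := by
  have hd := NeZero.pos d
  rw [Fin.ext_iff, Fin.ext_iff, val_modHom]
  rw [val_nsmul, Nat.mul_mod_mul_left]
  simp
  omega

theorem compl_semiconj {τ : Equiv.Perm (Fin (d * m))} {τ' : Equiv.Perm (Fin m)}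
    (h : ∀ i, modHom d m (τ i) = τ' (modHom d m i)) (i : Fin (d * m)) :
    modHom d m (compl τ i) = compl τ' (modHom d m i) := by
  obtain ⟨j, rfl⟩ := τ.surjective i
  rw [compl_apply, h, compl_apply, map_add, modHom_one]

theorem compl_apply_add {n : ℕ} [NeZero n] {τ : Equiv.Perm (Fin n)} {a : Fin n}
    (h : ∀ i, τ (i + a) = τ i + a) (i : Fin n) : compl τ (i + a) = compl τ i + a := by
  obtain ⟨j, rfl⟩ := τ.surjective i
  rw [← h, compl_apply, compl_apply, add_right_comm]

/-- Not all terms are `d`, since the sum is `1` modulo `d`. A proper divisor of `d` is at most `d /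
2`, so two exceptional terms would leave a sum of at most `d + (m - 1) d = d m`. The single
exceptional term is `1` modulo `d` and smaller than `d`. -/
theorem exists_unique_ramification {ι : Type*} {d m : ℕ} (hd : 1 < d) (s : Finset ι) (f : ι → ℕ)
    (hf : ∀ i ∈ s, f i ∣ d) (hs : ∑ i ∈ s, f i = d * m + 1) (hc : s.card ≤ m + 1) :
    ∃ i₀ ∈ s, f i₀ = 1 ∧ ∀ i ∈ s, i ≠ i₀ → f i = d := by
  classical
  have hle : ∀ i ∈ s, f i ≤ d := fun i hi => Nat.le_of_dvd (by omega) (hf i hi)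
  have hhalf : ∀ i ∈ s, f i ≠ d → 2 * f i ≤ d := fun i hi hne => by
    obtain ⟨c, hc⟩ := hf i hi
    have : 2 ≤ c := by
      rcases c with _ | _ | c
      · omega
      · omega
      · omega
    nlinarith
  obtain ⟨i₀, hi₀, hne⟩ : ∃ i₀ ∈ s, f i₀ ≠ d := by
    by_contra! hall
    rw [Finset.sum_congr rfl hall, sum_const, smul_eq_mul] at hs
    have h1 : d ∣ d * m + 1 := hs ▸ Dvd.intro_left _ rfl
    have := (Nat.dvd_add_right (Dvd.intro _ rfl)).1 h1
    have := Nat.le_of_dvd one_pos this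
    omega
  have hothers : ∀ i ∈ s, i ≠ i₀ → f i = d := by
    intro j hj hji
    by_contra hne'
    have hj' : j ∈ s.erase i₀ := mem_erase.2 ⟨hji, hj⟩
    rw [← Finset.add_sum_erase s f hi₀, ← Finset.add_sum_erase _ f hj'] at hs
    have h1 : ∑ i ∈ (s.erase i₀).erase j, f i ≤ _ := Finset.sum_le_card_nsmul _ f d
      (fun i hi => hle i (mem_of_mem_erase (mem_of_mem_erase hi)))
    rw [card_erase_of_mem hj', card_erase_of_mem hi₀, smul_eq_mul] at h1
    have h2 := hhalf _ hi₀ hne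
    have h3 := hhalf _ hj hne'
    have h4 : s.card - 1 - 1 + 1 ≤ m := by
      have : 0 < (s.erase i₀).card := card_pos.2 ⟨j, hj'⟩
      rw [card_erase_of_mem hi₀] at this
      omega
    have h5 : (s.card - 1 - 1) * d + d ≤ d * m := by nlinarith
    omega
  refine ⟨i₀, hi₀, ?_, hothers⟩
  rw [← Finset.add_sum_erase s f hi₀, Finset.sum_congr rfl (fun i hi =>
    hothers i (mem_of_mem_erase hi) (ne_of_mem_erase hi)), sum_const, smul_eq_mul] at hs
  have h1 : (f i₀ + (s.erase i₀).card * d) % d = (d * m + 1) % d := by rw [hs]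
  have h2 := hhalf _ hi₀ hne
  rw [Nat.add_mul_mod_self_right, Nat.mul_add_mod, Nat.mod_eq_of_lt hd,
    Nat.mod_eq_of_lt (by omega)] at h1
  exact h1

end CyclePerm

end

/-! ### Periodic codes and the unique fixed vertex. -/

section

open CyclePerm Finset

namespace CyclePerm

theorem sum_cycle_congr {α : Type} [Fintype α] [DecidableEq α] {σ : Equiv.Perm α} (w : α → ℕ)
    {i j : α} (h : σ.SameCycle i j) :
    ∑ k with σ.SameCycle i k, w k = ∑ k with σ.SameCycle j k, w k := by
  refine Finset.sum_congr ?_ fun _ _ => rfl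
  ext k
  simp only [mem_filter, mem_univ, true_and]
  exact ⟨h.symm.trans, h.trans⟩

theorem sum_tops {n : ℕ} (σ : Equiv.Perm (Fin n)) (w : Fin n → ℕ) :
    ∑ i with top σ i = i, ∑ j with σ.SameCycle i j, w j = ∑ j, w j := by
  rw [← Finset.sum_fiberwise_of_maps_to (s := univ) (g := top σ)
    (t := univ.filter fun i => top σ i = i) (by simp [top_top])]
  refine Finset.sum_congr rfl fun i hi => ?_
  simp only [mem_filter, mem_univ, true_and] at hi
  refine Finset.sum_congr ?_ fun _ _ => rfl
  ext j
  simp only [mem_filter, mem_univ, true_and]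
  rw [← top_eq_iff, hi, eq_comm]

theorem card_tops_add_le {n : ℕ} [NeZero n] (τ : Equiv.Perm (Fin n)) :
    (univ.filter fun i => top τ i = i).card + (univ.filter fun i => top (compl τ) i = i).card ≤
      n + 1 := by
  rw [← descents_card τ]
  gcongr with i _ i _
  · exact apply_le_of_top
  · exact apply_le_of_top

end CyclePerm

namespace TreeCode

variable {S : Type} [DecidableEq S] {Ξ : LabeledPassport S} {d m : ℕ} [NeZero d] [NeZero m]

/-- Invariance under the translations by multiples of `m`. -/
def Periodic (X : TreeCode Ξ (d * m)) : Prop := ∀ a, modHom d m a = 0 → X.shift a = X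

namespace Periodic

variable {X : TreeCode Ξ (d * m)} (hX : X.Periodic)
include hX

theorem white_add (a : Fin (d * m)) (ha : modHom d m a = 0) (i : Fin (d * m)) :
    X.white (i + a) = X.white i + a := by
  have h := X.shift_white a i
  rw [hX a ha] at h
  rw [h, sub_add_cancel]

theorem black_add (a : Fin (d * m)) (ha : modHom d m a = 0) (i : Fin (d * m)) :
    compl X.white (i + a) = compl X.white i + a :=
  compl_apply_add (hX.white_add a ha) i

theorem exists_quotient : ∃ (τ : Equiv.Perm (Fin m)) (w : Fin m → ℕ+),
    (∀ i, modHom d m (X.white i) = τ (modHom d m i)) ∧ ∀ i, X.wt i = w (modHom d m i) := by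
  obtain ⟨τ, h⟩ := CyclePerm.exists_quotient hX.white_add modHom_surjective
  refine ⟨τ, fun b => X.wt (Function.surjInv modHom_surjective b), h, fun i => ?_⟩
  have h1 : modHom d m (Function.surjInv modHom_surjective (modHom d m i) - i) = 0 := by
    rw [map_sub, Function.surjInv_eq modHom_surjective, sub_self]
  have h2 := X.shift_wt (Function.surjInv (modHom_surjective (d := d)) (modHom d m i) - i) i
  rw [hX _ h1, add_sub_cancel] at h2
  exact h2

theorem shift (s : Fin (d * m)) : (X.shift s).Periodic := fun a ha => by
  change a +ᵥ (s +ᵥ X) = s +ᵥ X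
  rw [vadd_comm]
  exact congrArg _ (hX a ha)

end Periodic

/-- The number `f` is that of the vertices above the vertex of `b`, namely `d` divided by the order
of the group of translations preserving one of them. -/
theorem exists_sheets {σ : Equiv.Perm (Fin (d * m))} {σ' : Equiv.Perm (Fin m)}
    (hσ : ∀ a, modHom d m a = 0 → ∀ i, σ (i + a) = σ i + a)
    (hπ : ∀ i, modHom d m (σ i) = σ' (modHom d m i)) {w : Fin (d * m) → ℕ+} {w' : Fin m → ℕ+}
    (hw : ∀ i, w i = w' (modHom d m i)) {K : ℕ}
    (hK : ∀ i, ∑ j with σ.SameCycle i j, (w j : ℕ) = K) (b : Fin m) :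
    ∃ f, f ∣ d ∧ f * K = d * ∑ j with σ'.SameCycle b j, (w' j : ℕ) := by
  obtain ⟨i, rfl⟩ := modHom_surjective (d := d) b
  have h1 := card_deck_mul_sum hσ hπ (fun b => (w' b : ℕ)) i
  simp only [← hw, hK] at h1
  obtain ⟨f, hf⟩ := card_ker_modHom (d := d) (m := m) ▸ card_deck_dvd hσ i
  refine ⟨f, Dvd.intro_left _ hf.symm, ?_⟩
  rw [← h1, ← mul_assoc, mul_comm f]
  exact congrArg (· * _) hf.symm

section Biregular

variable {p q : ℕ+} {n : ℕ} [NeZero n]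

theorem lw_eq (X : TreeCode (LabeledPassport.pq p q) n) (i : Fin n) : X.lw i = (p, 0) :=
  Multiset.eq_of_mem_replicate (X.labeling_white.mem i)

theorem lb_eq (X : TreeCode (LabeledPassport.pq p q) n) (i : Fin n) : X.lb i = (q, 0) :=
  Multiset.eq_of_mem_replicate (X.labeling_black.mem i)

theorem sum_white (X : TreeCode (LabeledPassport.pq p q) n) (i : Fin n) :
    ∑ j with X.white.SameCycle i j, (X.wt j : ℕ) = p := by
  rw [X.labeling_white.sum_cycle, lw_eq]

theorem sum_black (X : TreeCode (LabeledPassport.pq p q) n) (i : Fin n) :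
    ∑ j with (compl X.white).SameCycle i j, (X.wt j : ℕ) = q := by
  rw [X.labeling_black.sum_cycle, lb_eq]

theorem sum_wt (X : TreeCode (LabeledPassport.pq p q) n) : ∑ j, (X.wt j : ℕ) = p * q := by
  have h := X.labeling_white.sum_label (p, 0)
  simpa [lw_eq, LabeledPassport.pq] using h

/-- The values `f` and `g` count the vertices above the white and black vertices of the quotient.
They add up to `q + p = d m + 1` over at most `m + 1` vertices, so one vertex has a single preimage
and all others have `d`. If the exception is white, then `d ∣ p`; if it is black, then `d ∣ q`, and
weights upstairs and downstairs agree except at the exception, where they differ by the factor `d`.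
-/
theorem ramification {X : TreeCode (LabeledPassport.pq p q) (d * m)} (hX : X.Periodic)
    (hd : 1 < d) (hn : (p : ℕ) + q = d * m + 1) {τ : Equiv.Perm (Fin m)} {w : Fin m → ℕ+}
    (hτ : ∀ i, modHom d m (X.white i) = τ (modHom d m i)) (hw : ∀ i, X.wt i = w (modHom d m i)) :
    d ∣ (p : ℕ) ∨ d ∣ (q : ℕ) ∧ (∀ b, ∑ j with τ.SameCycle b j, (w j : ℕ) = p) ∧
      ∃ b₀, d * ∑ j with (compl τ).SameCycle b₀ j, (w j : ℕ) = q ∧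
        ∀ b, ¬ (compl τ).SameCycle b₀ b → ∑ j with (compl τ).SameCycle b j, (w j : ℕ) = q := by
  have hd0 : 0 < d := by omega
  choose f hf hfK using exists_sheets hX.white_add hτ hw X.sum_white
  choose g hg hgK using exists_sheets hX.black_add (compl_semiconj hτ) hw X.sum_black
  have htot : d * ∑ j, (w j : ℕ) = p * q := by
    rw [← X.sum_wt]
    simp only [hw]
    rw [sum_comp_eq modHom_surjective (fun b => (w b : ℕ)), card_ker_modHom]
  -- The number of white vertices upstairs, obtained by comparing total weights: all of them weigh
  -- `p`.
  have hsf : ∑ b with top τ b = b, f b = q := by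
    have h1 : (∑ b with top τ b = b, f b) * (p : ℕ) = q * p := by
      rw [Finset.sum_mul, Finset.sum_congr rfl fun b _ => hfK b, ← Finset.mul_sum, sum_tops, htot,
        mul_comm]
    exact Nat.eq_of_mul_eq_mul_right p.pos h1
  have hsg : ∑ b with top (compl τ) b = b, g b = p := by
    have h1 : (∑ b with top (compl τ) b = b, g b) * (q : ℕ) = p * q := by
      rw [Finset.sum_mul, Finset.sum_congr rfl fun b _ => hgK b, ← Finset.mul_sum, sum_tops, htot]
    exact Nat.eq_of_mul_eq_mul_right q.pos h1
  obtain ⟨c, hc, hc1, hcd⟩ := exists_unique_ramification (m := m) hd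
    ((univ.filter fun b => top τ b = b).disjSum (univ.filter fun b => top (compl τ) b = b))
    (Sum.elim f g) (by rintro (b | b) _ <;> simp [hf, hg])
    (by rw [Finset.sum_disjSum]; simp only [Sum.elim_inl, Sum.elim_inr, hsf, hsg]; omega)
    (by rw [Finset.card_disjSum]; exact card_tops_add_le τ)
  rcases c with c | c
  · left
    rw [← hsg]
    refine Finset.dvd_sum fun b hb => ?_
    have := hcd (Sum.inr b) (by simpa using hb) (by simp)
    simp only [Sum.elim_inr] at this
    rw [this]
  · right
    have h1 : ∀ b, f (top τ b) = d := fun b =>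
      hcd (Sum.inl (top τ b)) (by simp [top_top]) (by simp)
    refine ⟨?_, fun b => ?_, c, ?_, fun b hb => ?_⟩
    · rw [← hsf]
      refine Finset.dvd_sum fun b hb => ?_
      simp only [mem_filter, mem_univ, true_and] at hb
      rw [← hb, h1]
    · have h2 := hfK (top τ b)
      rw [h1, ← sum_cycle_congr _ (top_sameCycle τ b)] at h2
      exact (Nat.eq_of_mul_eq_mul_left hd0 h2).symm
    · have := hgK c
      simp only [Sum.elim_inr] at hc1
      rw [← this, hc1, one_mul]
    · have h2 := hgK (top (compl τ) b)
      rw [← sum_cycle_congr _ (top_sameCycle (compl τ) b)] at h2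
      have h3 := hcd (Sum.inr (top (compl τ) b)) (by simp [top_top]) (fun h => hb (by
        simp only [Sum.inr.injEq] at h
        rw [← h]
        exact (top_sameCycle _ _).symm))
      simp only [Sum.elim_inr] at h3
      rw [h3] at h2
      exact (Nat.eq_of_mul_eq_mul_left hd0 h2).symm

end Biregular

end TreeCode

end

/-! ### Quotients of periodic codes have the divided passport and determine the cover. -/

section

open CyclePerm Finset

/-- The divided passport of `(q ^ p, p ^ q)` with a black centre. -/
def LabeledPassport.starBlack (p q K : ℕ+) (a : ℕ) : LabeledPassport (Option ℕ) :=
  ⟨(K, none) ::ₘ Multiset.replicate a (q, some 0), Multiset.replicate K (p, some 0)⟩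

open LabeledPassport

namespace CyclePerm

theorem isLabeling_const {S : Type} [DecidableEq S] {n : ℕ} {σ : Equiv.Perm (Fin n)}
    {wt : Fin n → ℕ+} {x : ℕ+ × S} {k : ℕ}
    (h : ∀ i, ∑ j with σ.SameCycle i j, (wt j : ℕ) = x.1) (hs : ∑ j, (wt j : ℕ) = x.1 * k) :
    IsLabeling σ wt (fun _ => x) (Multiset.replicate k x) where
  apply_eq _ := rfl
  sum_cycle := h
  sum_label y := by
    rw [Multiset.count_replicate]
    split_ifs with hy
    · subst hy
      simpa using hs
    · simp [hy]

end CyclePerm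

namespace TreeCode

section

variable {p q K : ℕ+} {a m : ℕ} [NeZero m]

theorem lw_eq_of_starBlack (Y : TreeCode (starBlack p q K a) m) (i : Fin m) :
    Y.lw i = (p, some 0) :=
  Multiset.eq_of_mem_replicate (Y.labeling_white.mem i)

theorem lb_eq_of_starBlack (Y : TreeCode (starBlack p q K a) m) (i : Fin m) :
    Y.lb i = (K, none) ∨ Y.lb i = (q, some 0) := by
  have := Y.labeling_black.mem i
  simp only [starBlack, Multiset.mem_cons] at this
  exact this.imp_right Multiset.eq_of_mem_replicate

theorem exists_lb_eq_star (Y : TreeCode (starBlack p q K a) m) : ∃ i, Y.lb i = (K, none) := by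
  have h := Y.labeling_black.card_tops_label (K, none)
  have h1 : 0 < (starBlack p q K a).pos.count (K, none) := by simp [starBlack]
  rw [← h, Finset.card_pos] at h1
  obtain ⟨i, hi⟩ := h1
  exact ⟨i, by simpa using (mem_filter.1 hi).2.2⟩

theorem sameCycle_of_lb_eq_star (Y : TreeCode (starBlack p q K a) m) {i j : Fin m}
    (hi : Y.lb i = (K, none)) (hj : Y.lb j = (K, none)) : (compl Y.white).SameCycle i j := by
  have h := Y.labeling_black.card_tops_label (K, none)
  have h1 : (starBlack p q K a).pos.count (K, none) = 1 := by
    simp [starBlack, Multiset.count_replicate]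
  rw [h1] at h
  have h2 := Finset.card_le_one.1 h.le (top (compl Y.white) i)
    (by simp [top_top, ← Y.labeling_black.eq_of_sameCycle (top_sameCycle _ i), hi])
    (top (compl Y.white) j)
    (by simp [top_top, ← Y.labeling_black.eq_of_sameCycle (top_sameCycle _ j), hj])
  exact top_eq_iff.1 h2

end

variable {p q K : ℕ+} {a d m : ℕ} [NeZero d] [NeZero m]

/-- The plane tree of `X` is the `d`-fold cyclic covering of that of `Y`. -/
def Covers (X : TreeCode (pq p q) (d * m)) (Y : TreeCode (starBlack p q K a) m) : Prop :=
  (∀ i, modHom d m (X.white i) = Y.white (modHom d m i)) ∧ ∀ i, X.wt i = Y.wt (modHom d m i)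

/-- The fixed vertex is black because `p` is `1` modulo `d`. In the quotient it has weight `q / d =
K` and gets the star label; all other vertices keep their weights. -/
theorem Periodic.exists_covers {X : TreeCode (pq p q) (d * m)} (hX : X.Periodic) (hd : 1 < d)
    (hK : (q : ℕ) = d * K) (hp : (p : ℕ) = 1 + d * a) (hm : m = a + K) :
    ∃ Y : TreeCode (starBlack p q K a) m, X.Covers Y := by
  obtain ⟨τ, w, hτ, hw⟩ := hX.exists_quotient
  have hn : (p : ℕ) + q = d * m + 1 := by rw [hK, hp, hm]; ring
  have hndvd : ¬ d ∣ (p : ℕ) := fun h => by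
    rw [hp, Nat.dvd_add_left (Dvd.intro _ rfl)] at h
    have := Nat.le_of_dvd one_pos h
    omega
  obtain ⟨-, hwhite, b₀, hb₀, hblack⟩ := (ramification hX hd hn hτ hw).resolve_left hndvd
  have hsum₀ : ∑ j with (compl τ).SameCycle b₀ j, (w j : ℕ) = K := by
    rw [hK] at hb₀
    exact Nat.eq_of_mul_eq_mul_left (by omega) hb₀
  have htot : ∑ j, (w j : ℕ) = p * K := by
    have h1 := sum_comp_eq (modHom_surjective (d := d)) (fun b => (w b : ℕ))
    simp only [← hw] at h1
    rw [X.sum_wt, card_ker_modHom, hK] at h1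
    refine Nat.eq_of_mul_eq_mul_left (show 0 < d by omega) ?_
    rw [← h1]
    ring
  have hsplit : ∑ j with ¬ (compl τ).SameCycle b₀ j, (w j : ℕ) = q * a := by
    have h1 := Finset.sum_filter_add_sum_filter_not univ (fun j => (compl τ).SameCycle b₀ j)
      (fun j => (w j : ℕ))
    rw [htot, hsum₀, hp] at h1
    rw [hK]
    have : (1 + d * a) * (K : ℕ) = K + d * K * a := by ring
    omega
  refine ⟨⟨τ, w, fun _ => (p, some 0),
    fun b => if (compl τ).SameCycle b₀ b then (K, none) else (q, some 0),
    isLabeling_const hwhite htot, ⟨fun i => ?_, fun i => ?_, fun x => ?_⟩⟩, hτ, hw⟩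
  · simp only [Equiv.Perm.sameCycle_apply_right]
  · by_cases h : (compl τ).SameCycle b₀ i
    · simp only [if_pos h]
      rw [← sum_cycle_congr _ h, hsum₀]
    · simp only [if_neg h]
      exact hblack i h
  · by_cases h1 : x = (K, none)
    · subst h1
      simp only [starBlack, Multiset.count_cons_self, Multiset.count_replicate]
      rw [if_neg (by simp), zero_add, mul_one, ← hsum₀]
      refine Finset.sum_congr (Finset.filter_congr fun j _ => ?_) fun _ _ => rfl
      split_ifs with h <;> simp [h]
    · simp only [starBlack, Multiset.count_cons_of_ne h1, Multiset.count_replicate]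
      by_cases h2 : (q, some 0) = x
      · subst h2
        rw [if_pos rfl, ← hsplit]
        refine Finset.sum_congr (Finset.filter_congr fun j _ => ?_) fun _ _ => rfl
        split_ifs with h <;> simp [h]
      · rw [if_neg h2, mul_zero]
        refine Finset.sum_eq_zero fun j hj => ?_
        simp only [mem_filter, mem_univ, true_and] at hj
        split_ifs at hj
        · exact absurd hj.symm h1
        · exact absurd hj h2

/-- Since `K ≠ q`, the weight of a black vertex tells whether it is the star. -/
theorem Covers.unique_right {X : TreeCode (pq p q) (d * m)} {Y Y' : TreeCode (starBlack p q K a) m}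
    (hK : K ≠ q) (h : X.Covers Y) (h' : X.Covers Y') : Y = Y' := by
  have h1 : Y.white = Y'.white := Equiv.ext fun b => by
    obtain ⟨i, rfl⟩ := modHom_surjective (d := d) b
    rw [← h.1, ← h'.1]
  have h2 : Y.wt = Y'.wt := funext fun b => by
    obtain ⟨i, rfl⟩ := modHom_surjective (d := d) b
    rw [← h.2, ← h'.2]
  refine TreeCode.ext h1 h2 (funext fun i => ?_) (funext fun i => ?_)
  · rw [lw_eq_of_starBlack, lw_eq_of_starBlack]
  · have h3 : (Y.lb i).1 = (Y'.lb i).1 := PNat.eq (by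
      rw [← Y.labeling_black.sum_cycle, ← Y'.labeling_black.sum_cycle, h1, h2])
    rcases Y.lb_eq_of_starBlack i with h4 | h4 <;> rcases Y'.lb_eq_of_starBlack i with h5 | h5 <;>
      rw [h4, h5] at h3 ⊢ <;> simp_all

theorem Covers.shift {X : TreeCode (pq p q) (d * m)} {Y : TreeCode (starBlack p q K a) m}
    (h : X.Covers Y) (s : Fin (d * m)) : (X.shift s).Covers (Y.shift (modHom d m s)) :=
  ⟨fun i => by rw [shift_white, shift_white, map_sub, h.1, map_add],
    fun i => by rw [shift_wt, shift_wt, h.2, map_add]⟩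

/-- The `d` sheets of a covering are cut along the edge `0` at the centre. -/
theorem Covers.div_white {X : TreeCode (pq p q) (d * m)} {Y : TreeCode (starBlack p q K a) m}
    (h : X.Covers Y) (hX : X.Periodic) (hK : (q : ℕ) = d * K)
    (hn : (pq p q).size = d * m + 1) (h0 : Y.lb 0 = (K, none)) (i : Fin (d * m)) :
    (X.white i).val / m = i.val / m := by
  have hm := NeZero.pos m
  -- The black vertex of `0` weighs `q = d K` and its image weighs `K`, so it is preserved by all
  -- `d` translations and contains every multiple of `m`.
  have hdeck : ∀ a, modHom d m a = 0 → (compl X.white).SameCycle 0 a := by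
    have h1 := card_deck_mul_sum hX.black_add (compl_semiconj h.1) (fun b => (Y.wt b : ℕ)) 0
    simp only [← h.2] at h1
    rw [X.sum_black, map_zero, Y.labeling_black.sum_cycle, h0, hK] at h1
    have h2 := Nat.eq_of_mul_eq_mul_right K.pos h1
    have h3 : deck (modHom d m) hX.black_add 0 = (modHom d m).ker :=
      AddSubgroup.eq_of_le_of_card_ge (fun _ h => h.1) (by rw [h2, card_ker_modHom])
    intro a ha
    have h4 : a ∈ deck (modHom d m) hX.black_add 0 := by rw [h3]; exact ha
    simpa using h4.2
  -- All multiples of `m` lie at one black vertex, so by noncrossing no white cycle straddles any of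
  -- them.
  have hlt : ∀ i : Fin (d * m), (top X.white i).val / m ≤ i.val / m := by
    intro i
    rw [← Nat.lt_succ_iff, Nat.div_lt_iff_lt_mul hm]
    by_cases hk : (i.val / m + 1) * m < d * m
    · refine (X.noncrossing hn).top_lt (k := ⟨(i.val / m + 1) * m, hk⟩) (y := 0)
        (hdeck _ ?_).symm (Fin.zero_le _) ?_
      · ext
        rw [val_modHom]
        simp
      · rw [Fin.lt_def]
        simp only
        rw [← Nat.div_lt_iff_lt_mul hm]
        omega
    · exact lt_of_lt_of_le (top X.white i).isLt (not_lt.1 hk)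
  refine le_antisymm ((Nat.div_le_div_right ?_).trans (hlt i))
    ((Nat.div_le_div_right ?_).trans (hlt (X.white i)))
  · rw [← top_apply]
    exact self_le_top _ _
  · rw [top_apply]
    exact self_le_top _ _

/-- Once the root edge is at the centre, `white i` has its residue modulo `m` from `Y` and its
quotient by `m` from `div_white`. -/
theorem Covers.unique_left {X X' : TreeCode (pq p q) (d * m)} {Y : TreeCode (starBlack p q K a) m}
    (h : X.Covers Y) (h' : X'.Covers Y) (hX : X.Periodic) (hX' : X'.Periodic)
    (hK : (q : ℕ) = d * K) (hn : (pq p q).size = d * m + 1) : X = X' := by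
  obtain ⟨b, hb⟩ := Y.exists_lb_eq_star
  obtain ⟨s, rfl⟩ := modHom_surjective (d := d) b
  have h0 : (Y.shift (modHom d m s)).lb 0 = (K, none) := by rw [shift_lb, zero_add, hb]
  have key : X.shift s = X'.shift s := by
    refine ext_apply (fun i => ?_) (fun i => ?_) (fun i => ?_) (fun i => ?_)
    · have h1 := (h.shift s).div_white (hX.shift s) hK hn h0 i
      have h2 := (h'.shift s).div_white (hX'.shift s) hK hn h0 i
      have h3 := congrArg Fin.val (((h.shift s).1 i).trans ((h'.shift s).1 i).symm)
      rw [val_modHom, val_modHom] at h3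
      ext
      rw [← Nat.div_add_mod ((X.shift s).white i).val m, h1, h3, ← h2, Nat.div_add_mod]
    · rw [(h.shift s).2, (h'.shift s).2]
    · rw [lw_eq, lw_eq]
    · rw [lb_eq, lb_eq]
  have h5 : s +ᵥ X = s +ᵥ X' := key
  exact (vadd_left_cancel_iff s).1 h5

end TreeCode

end

/-! ### Construction of the cyclic cover. -/

section

open CyclePerm Finset LabeledPassport

namespace CyclePerm

variable {d m : ℕ} [NeZero d] [NeZero m]

theorem eq_of_div_eq {i j : Fin (d * m)} (h : modHom d m i = modHom d m j)
    (h' : i.val / m = j.val / m) : i = j := by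
  have h1 := congrArg Fin.val h
  rw [val_modHom, val_modHom] at h1
  ext
  rw [← Nat.div_add_mod i.val m, h1, h', Nat.div_add_mod]

theorem div_add_one {i : Fin (d * m)} (h : modHom d m (i + 1) ≠ 0) :
    (i + 1).val / m = i.val / m := by
  have hm := NeZero.pos m
  rcases Nat.lt_or_ge (i.val + 1) (d * m) with h1 | h1
  · rw [val_add_one h1, Nat.succ_div, if_neg, add_zero]
    intro h2
    refine h ?_
    ext
    rw [val_modHom, val_add_one h1, Nat.mod_eq_zero_of_dvd h2]
    rfl
  · refine absurd ?_ h
    ext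
    rw [val_modHom, val_add_one_last (by omega)]
    simp

theorem val_add_one_eq {i : Fin (d * m)} (h : modHom d m (i + 1) = 0) (hd : i.val / m + 1 < d) :
    (i + 1).val = (i.val / m + 1) * m := by
  have hm := NeZero.pos m
  have h1 : i.val + 1 < d * m := by
    have h2 := Nat.div_add_mod i.val m
    have h3 := Nat.mod_lt i.val hm
    nlinarith
  have h2 := congrArg Fin.val h
  rw [val_modHom, val_add_one h1] at h2
  rw [val_add_one h1]
  have h3 := Nat.dvd_of_mod_eq_zero (h2.trans (by rfl))
  have h4 : (i.val + 1) / m = i.val / m + 1 := by rw [Nat.succ_div, if_pos h3]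
  rw [← h4, Nat.div_mul_cancel h3]

/-- The action of `τ` on each of `d` consecutive blocks of length `m`. -/
def blocks (d : ℕ) (τ : Equiv.Perm (Fin m)) : Equiv.Perm (Fin (d * m)) :=
  finProdFinEquiv.permCongr ((Equiv.refl (Fin d)).prodCongr τ)

theorem val_blocks (τ : Equiv.Perm (Fin m)) (i : Fin (d * m)) :
    (blocks d τ i).val = (τ (modHom d m i)).val + m * (i.val / m) := rfl

theorem modHom_blocks (τ : Equiv.Perm (Fin m)) (i : Fin (d * m)) :
    modHom d m (blocks d τ i) = τ (modHom d m i) := by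
  ext
  rw [val_modHom, val_blocks, Nat.add_mul_mod_self_left, Nat.mod_eq_of_lt (τ _).isLt]

theorem div_blocks (τ : Equiv.Perm (Fin m)) (i : Fin (d * m)) :
    (blocks d τ i).val / m = i.val / m := by
  rw [val_blocks, Nat.add_mul_div_left _ _ (NeZero.pos m), Nat.div_eq_of_lt (τ _).isLt, zero_add]

theorem div_add_congr {i j a : Fin (d * m)} (ha : modHom d m a = 0) (h : i.val / m = j.val / m) :
    (i + a).val / m = (j + a).val / m := by
  have h1 := congrArg Fin.val ha
  rw [val_modHom] at h1
  obtain ⟨c, hc⟩ := Nat.dvd_of_mod_eq_zero (h1.trans (by rfl))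
  rw [Fin.val_add, Fin.val_add, Nat.mod_mul_left_div_self, Nat.mod_mul_left_div_self, hc, Nat.add_mul_div_left _ _ (NeZero.pos m),
    Nat.add_mul_div_left _ _ (NeZero.pos m), h]

theorem blocks_add (τ : Equiv.Perm (Fin m)) (a : Fin (d * m)) (ha : modHom d m a = 0)
    (i : Fin (d * m)) : blocks d τ (i + a) = blocks d τ i + a := by
  refine eq_of_div_eq ?_ ?_
  · rw [modHom_blocks, map_add (modHom d m), map_add (modHom d m), ha, modHom_blocks, add_zero,
      add_zero]
  · rw [div_blocks]
    exact div_add_congr ha (div_blocks τ i).symm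

theorem div_compl_blocks {τ : Equiv.Perm (Fin m)} {i : Fin (d * m)}
    (h : compl τ (modHom d m i) ≠ 0) : (compl (blocks d τ) i).val / m = i.val / m := by
  rw [← compl_semiconj (modHom_blocks τ)] at h
  obtain ⟨j, rfl⟩ := (blocks d τ).surjective i
  rw [compl_apply] at h ⊢
  rw [div_add_one h, div_blocks]

theorem val_compl_blocks {τ : Equiv.Perm (Fin m)} {i : Fin (d * m)}
    (h : compl τ (modHom d m i) = 0) (hd : i.val / m + 1 < d) :
    (compl (blocks d τ) i).val = (i.val / m + 1) * m := by
  rw [← compl_semiconj (modHom_blocks τ)] at h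
  obtain ⟨j, rfl⟩ := (blocks d τ).surjective i
  rw [compl_apply] at h ⊢
  rw [div_blocks] at hd ⊢
  exact val_add_one_eq h hd

/-- The cycle stays in one block of length `m`, and a block contains each residue only once. -/
theorem deck_eq_bot {σ : Equiv.Perm (Fin (d * m))}
    (hσ : ∀ a, modHom d m a = 0 → ∀ i, σ (i + a) = σ i + a) {i : Fin (d * m)}
    (h : ∀ j, σ.SameCycle i j → (σ j).val / m = j.val / m) : deck (modHom d m) hσ i = ⊥ := by
  have key : ∀ j, σ.SameCycle i j → j.val / m = i.val / m := by
    intro j hj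
    obtain ⟨r, -, rfl⟩ := hj.exists_pow_eq'
    clear hj
    induction r with
    | zero => rfl
    | succ r ih =>
      rw [pow_succ', Equiv.Perm.mul_apply, h _ ⟨r, by rw [zpow_natCast]⟩, ih]
  rw [eq_bot_iff]
  rintro a ⟨h1, h2⟩
  have h3 : i + a = i := eq_of_div_eq (by rw [map_add, h1, add_zero]) (key _ h2)
  simpa using h3

/-- Follow the black rotation from the start of a block. It stays in the block until its residue
returns to `0`, and then it is at the start of the next block; so the starts of all blocks are in
one cycle. -/
theorem sameCycle_zero_compl_blocks (τ : Equiv.Perm (Fin m)) {a : Fin (d * m)}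
    (ha : modHom d m a = 0) : (compl (blocks d τ)).SameCycle 0 a := by
  have hm := NeZero.pos m
  have step : ∀ r : ℕ, ∀ i : Fin (d * m), i.val / m + 1 < d → ((compl τ) ^ (r + 1)) (modHom d m i) = 0 →
      ∃ j, (compl (blocks d τ)).SameCycle i j ∧ j.val = (i.val / m + 1) * m := by
    intro r
    induction r with
    | zero =>
      intro i hi h
      rw [zero_add, pow_one] at h
      exact ⟨_, ⟨1, rfl⟩, val_compl_blocks h hi⟩
    | succ r ih =>
      intro i hi h
      by_cases h0 : compl τ (modHom d m i) = 0
      · exact ⟨_, ⟨1, rfl⟩, val_compl_blocks h0 hi⟩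
      · have h1 := div_compl_blocks h0
        rw [pow_succ, Equiv.Perm.mul_apply, ← compl_semiconj (modHom_blocks τ)] at h
        obtain ⟨j, h2, h3⟩ := ih (compl (blocks d τ) i) (by rw [h1]; exact hi) h
        exact ⟨j, Equiv.Perm.SameCycle.trans ⟨1, rfl⟩ h2, by rw [h3, h1]⟩
  have main : ∀ t : ℕ, ∀ a : Fin (d * m), a.val = t * m → (compl (blocks d τ)).SameCycle 0 a := by
    intro t
    induction t with
    | zero =>
      intro a ha
      rw [zero_mul] at ha
      rw [show a = 0 from Fin.ext ha]
    | succ t ih =>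
      intro a ha
      have hlt : (t + 1) * m < d * m := ha ▸ a.isLt
      have hd : t + 1 < d := lt_of_mul_lt_mul_right hlt hm.le
      have h1 : t * m < d * m := by nlinarith
      have h2 := ih ⟨t * m, h1⟩ rfl
      have h3 : (⟨t * m, h1⟩ : Fin (d * m)).val / m = t := Nat.mul_div_cancel _ hm
      have h4 : modHom d m ⟨t * m, h1⟩ = 0 := by ext; rw [val_modHom]; simp
      have hord := orderOf_pos (compl τ)
      obtain ⟨j, h5, h6⟩ := step (orderOf (compl τ) - 1) ⟨t * m, h1⟩ (by rw [h3]; exact hd) (by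
        rw [Nat.sub_add_cancel hord, pow_orderOf_eq_one, h4]; rfl)
      rw [h3] at h6
      rw [show a = j from Fin.ext (ha.trans h6.symm)]
      exact h2.trans h5
  have h1 := congrArg Fin.val ha
  rw [val_modHom] at h1
  obtain ⟨c, hc⟩ := Nat.dvd_of_mod_eq_zero (h1.trans (by rfl))
  exact main c a (by rw [hc, mul_comm])

end CyclePerm

namespace TreeCode

variable {p q K : ℕ+} {a d m : ℕ} [NeZero d] [NeZero m]

/-- Glue `d` copies of `Y`, cut at the star just before edge `0`. White cycles and the other black
cycles stay within one copy and keep their weights `p` and `q`; the copies of the star join into one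
vertex of weight `d K = q`. -/
theorem exists_covering_of_star_zero (Y : TreeCode (starBlack p q K a) m)
    (hK : (q : ℕ) = d * K) (h0 : Y.lb 0 = (K, none)) :
    ∃ X : TreeCode (pq p q) (d * m), X.Periodic ∧ X.Covers Y := by
  have hsemi := modHom_blocks (d := d) Y.white
  have htot : ∑ i, (Y.wt (modHom d m i) : ℕ) = d * (p * K) := by
    rw [sum_comp_eq modHom_surjective (fun b => (Y.wt b : ℕ)), card_ker_modHom]
    have h := Y.labeling_white.sum_label (p, some 0)
    simp only [lw_eq_of_starBlack, starBlack, filter_true, Multiset.count_replicate_self] at h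
    rw [h]
  have hβ : ∀ a, modHom d m a = 0 → ∀ i, compl (blocks d Y.white) (i + a) =
      compl (blocks d Y.white) i + a := fun a ha => compl_apply_add (blocks_add _ a ha)
  have hwhite : ∀ i, ∑ j with (blocks d Y.white).SameCycle i j,
      (Y.wt (modHom d m j) : ℕ) = p := by
    intro i
    rw [← card_deck_mul_sum (blocks_add Y.white) hsemi (fun b => (Y.wt b : ℕ)) i,
      Y.labeling_white.sum_cycle, lw_eq_of_starBlack, deck_eq_bot _ fun j _ => div_blocks _ _]
    simp
  have hblack : ∀ i, ∑ j with (compl (blocks d Y.white)).SameCycle i j,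
      (Y.wt (modHom d m j) : ℕ) = q := by
    intro i
    by_cases hi : (compl Y.white).SameCycle (modHom d m i) 0
    · obtain ⟨j, hj, hj0⟩ := exists_sameCycle_lift (compl_semiconj hsemi) hi
      have hdeck : deck (modHom d m) hβ 0 = (modHom d m).ker :=
        le_antisymm (fun _ h => h.1) fun a ha =>
          ⟨ha, by rw [zero_add]; exact sameCycle_zero_compl_blocks _ ha⟩
      rw [sum_cycle_congr _ hj, ← sum_cycle_congr _ (sameCycle_zero_compl_blocks Y.white hj0),
        ← card_deck_mul_sum hβ (compl_semiconj hsemi)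
          (fun b => (Y.wt b : ℕ)) 0, map_zero, Y.labeling_black.sum_cycle, h0, hK, hdeck,
        card_ker_modHom]
    · have hbot : deck (modHom d m) hβ i = ⊥ := deck_eq_bot _ fun j hj =>
        div_compl_blocks fun h => hi ((sameCycle_map (compl_semiconj hsemi) hj).trans
          ⟨1, by rw [zpow_one, h]⟩)
      have hlb : Y.lb (modHom d m i) = (q, some 0) :=
        (Y.lb_eq_of_starBlack _).resolve_left fun h => hi (Y.sameCycle_of_lb_eq_star h h0)
      rw [← card_deck_mul_sum hβ (compl_semiconj hsemi) (fun b => (Y.wt b : ℕ)) i,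
        Y.labeling_black.sum_cycle, hlb, hbot]
      simp
  refine ⟨⟨blocks d Y.white, fun i => Y.wt (modHom d m i), fun _ => (p, 0), fun _ => (q, 0),
    isLabeling_const hwhite (by rw [htot, hK]; ring),
    isLabeling_const hblack (by rw [htot, hK]; ring)⟩, fun a ha => ?_, hsemi, fun _ => rfl⟩
  refine ext_apply (fun i => ?_) (fun i => ?_) (fun i => rfl) (fun i => rfl)
  · rw [shift_white]
    simp only
    rw [blocks_add _ _ ha, add_sub_cancel_right]
  · rw [shift_wt]
    simp only [map_add, ha, add_zero]

theorem exists_covering (Y : TreeCode (starBlack p q K a) m) (hK : (q : ℕ) = d * K) :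
    ∃ X : TreeCode (pq p q) (d * m), X.Periodic ∧ X.Covers Y := by
  obtain ⟨b, hb⟩ := Y.exists_lb_eq_star
  obtain ⟨s, rfl⟩ := modHom_surjective (d := d) b
  obtain ⟨X, hX, hXY⟩ := (Y.shift (modHom d m s)).exists_covering_of_star_zero hK
    (by rw [shift_lb, zero_add, hb])
  refine ⟨X.shift (-s), hX.shift _, ?_⟩
  have h := hXY.shift (-s)
  rw [map_neg] at h
  have h1 : (Y.shift (modHom d m s)).shift (-modHom d m s) = Y :=
    neg_vadd_vadd (modHom d m s) Y
  rwa [h1] at h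

theorem card_periodic (hd : 1 < d) (hK : (q : ℕ) = d * K) (hp : (p : ℕ) = 1 + d * a)
    (hm : m = a + K) :
    Nat.card {X : TreeCode (pq p q) (d * m) // X.Periodic} =
      Nat.card (TreeCode (starBlack p q K a) m) := by
  have hn : (pq p q).size = d * m + 1 := by
    simp only [LabeledPassport.size, pq, Multiset.card_replicate]
    rw [hK, hp, hm]
    ring
  have hKq : K ≠ q := fun h => by
    have := K.pos
    rw [← h] at hK
    nlinarith
  choose Y hY using fun X : {X : TreeCode (pq p q) (d * m) // X.Periodic} =>
    X.2.exists_covers (K := K) hd hK hp hm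
  refine Nat.card_congr (Equiv.ofBijective Y ⟨fun X X' h => ?_, fun Z => ?_⟩)
  · exact Subtype.ext ((hY X).unique_left (h ▸ hY X') X.2 X'.2 hK hn)
  · obtain ⟨X, hX, hXZ⟩ := Z.exists_covering hK
    exact ⟨⟨X, hX⟩, (hY ⟨X, hX⟩).unique_right hKq hXZ⟩

end TreeCode

end

/-! ### Reflection with exchange of colors; shifts of given order. -/

section

open CyclePerm Finset LabeledPassport

/-- Exchanging the two colors. -/
def LabeledPassport.swap {S : Type} (Ξ : LabeledPassport S) : LabeledPassport S := ⟨Ξ.neg, Ξ.pos⟩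

namespace CyclePerm

theorem IsLabeling.inv {S : Type} [DecidableEq S] {n : ℕ} {σ : Equiv.Perm (Fin n)}
    {wt : Fin n → ℕ+} {l : Fin n → ℕ+ × S} {M : Multiset (ℕ+ × S)} (h : IsLabeling σ wt l M) :
    IsLabeling σ⁻¹ wt l M where
  apply_eq i := by rw [← h.apply_eq (σ⁻¹ i), Equiv.Perm.inv_def, Equiv.apply_symm_apply]
  sum_cycle i := by simpa only [Equiv.Perm.sameCycle_inv] using h.sum_cycle i
  sum_label := h.sum_label

/-- The reflection `i ↦ -1 - i` conjugates the rotation `i ↦ i + 1` to its inverse; inverting both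
permutations of a code then exchanges their roles. -/
theorem compl_conj_subLeft {n : ℕ} [NeZero n] (τ : Equiv.Perm (Fin n)) :
    compl ((Equiv.subLeft (-1))⁻¹ * (compl τ)⁻¹ * Equiv.subLeft (-1)) =
      (Equiv.subLeft (-1))⁻¹ * τ⁻¹ * Equiv.subLeft (-1) := by
  ext i
  simp [compl, Equiv.subLeft, mul_assoc, add_comm]

instance {n : ℕ} [NeZero n] : IsAddCyclic (Fin n) :=
  ⟨1, fun i => ⟨i.val, by ext; simp [val_nsmul, Nat.mod_eq_of_lt]⟩⟩

theorem card_addOrderOf_eq {n d : ℕ} [NeZero n] (hd : d ∣ n) :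
    (univ.filter fun s : Fin n => addOrderOf s = d).card = φ d := by
  exact IsAddCyclic.card_addOrderOf_eq_totient (by simpa using hd)

end CyclePerm

namespace TreeCode

variable {S : Type} [DecidableEq S] {Ξ : LabeledPassport S} {n : ℕ} [NeZero n]

/-- The mirror image with the colors exchanged. -/
def mirror (X : TreeCode Ξ n) : TreeCode Ξ.swap n where
  white := (Equiv.subLeft (-1))⁻¹ * (compl X.white)⁻¹ * Equiv.subLeft (-1)
  wt := X.wt ∘ Equiv.subLeft (-1)
  lw := X.lb ∘ Equiv.subLeft (-1)
  lb := X.lw ∘ Equiv.subLeft (-1)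
  labeling_white := X.labeling_black.inv.conj _
  labeling_black := compl_conj_subLeft X.white ▸ X.labeling_white.inv.conj _

theorem mirror_mirror (X : TreeCode Ξ n) : X.mirror.mirror = X := by
  refine TreeCode.ext ?_ ?_ ?_ ?_
  · change (Equiv.subLeft (-1))⁻¹ * (CyclePerm.compl ((Equiv.subLeft (-1))⁻¹ * (compl X.white)⁻¹ *
      Equiv.subLeft (-1)))⁻¹ * Equiv.subLeft (-1) = X.white
    rw [compl_conj_subLeft]
    ext i
    simp [Equiv.subLeft]
  all_goals
    funext i
    simp [mirror]

theorem mirror_shift (X : TreeCode Ξ n) (s : Fin n) : (X.shift s).mirror = X.mirror.shift (-s) := by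
  refine TreeCode.ext ?_ ?_ ?_ ?_
  · change (Equiv.subLeft (-1))⁻¹ * (CyclePerm.compl ((Equiv.addRight s)⁻¹ * X.white *
      Equiv.addRight s))⁻¹ * Equiv.subLeft (-1) = (Equiv.addRight (-s))⁻¹ *
        ((Equiv.subLeft (-1))⁻¹ * (CyclePerm.compl X.white)⁻¹ * Equiv.subLeft (-1)) *
          Equiv.addRight (-s)
    rw [compl_conj_addRight]
    ext i
    simp [Equiv.subLeft]
    abel_nf
  all_goals
    funext i
    simp [mirror, shift]
    abel_nf

theorem Periodic.mirror {d m : ℕ} [NeZero d] [NeZero m] {X : TreeCode Ξ (d * m)} (h : X.Periodic) :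
    X.mirror.Periodic := fun a ha => by
  rw [← neg_neg a, ← mirror_shift, h _ (by rw [map_neg, ha, neg_zero])]

theorem card_periodic_swap {d m : ℕ} [NeZero d] [NeZero m] :
    Nat.card {X : TreeCode Ξ.swap (d * m) // X.Periodic} =
      Nat.card {X : TreeCode Ξ (d * m) // X.Periodic} :=
  Nat.card_congr
    { toFun := fun X => ⟨X.1.mirror, X.2.mirror⟩
      invFun := fun X => ⟨X.1.mirror, X.2.mirror⟩
      left_inv := fun X => Subtype.ext X.1.mirror_mirror
      right_inv := fun X => Subtype.ext X.1.mirror_mirror }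

/-- An element of order `d` generates the kernel of reduction modulo `m`, so being fixed by it is
being fixed by the whole kernel. -/
theorem shift_eq_iff_periodic {d m : ℕ} [NeZero d] [NeZero m] {s : Fin (d * m)}
    (hs : addOrderOf s = d) {X : TreeCode Ξ (d * m)} : X.shift s = X ↔ X.Periodic := by
  have h1 : AddSubgroup.zmultiples s = (modHom d m).ker := by
    refine AddSubgroup.eq_of_le_of_card_ge ?_ ?_
    · rw [AddSubgroup.zmultiples_le, AddMonoidHom.mem_ker, modHom_eq_zero_iff]
      exact addOrderOf_dvd_iff_nsmul_eq_zero.1 hs.dvd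
    · rw [card_ker_modHom, Nat.card_zmultiples, hs]
  constructor
  · intro h a ha
    have h2 : a ∈ AddSubgroup.zmultiples s := by rw [h1]; exact ha
    have h3 : AddSubgroup.zmultiples s ≤ AddAction.stabilizer (Fin (d * m)) X := by
      rw [AddSubgroup.zmultiples_le]
      exact h
    exact h3 h2
  · intro h
    refine h s ?_
    have : s ∈ (modHom d m).ker := h1 ▸ AddSubgroup.mem_zmultiples s
    exact this

end TreeCode

end

/-! ### Primitive passports, decomposability and fillings. -/

section

open CyclePerm Finset LabeledPassport

namespace LabeledPassport

variable {S : Type} {Ξ : LabeledPassport S}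

theorem weightSum_cons (x : ℕ+ × S) (M : Multiset (ℕ+ × S)) :
    weightSum (x ::ₘ M) = x.1 + weightSum M := by simp [weightSum]

theorem weightSum_replicate (k : ℕ) (x : ℕ+ × S) :
    weightSum (Multiset.replicate k x) = k * x.1 := by simp [weightSum]

theorem IsPrimitive.swap (h : Ξ.IsPrimitive) : Ξ.swap.IsPrimitive where
  balanced := h.balanced.symm
  trivial A hA B hB hAB := (h.trivial B hB A hA hAB.symm).imp And.symm And.symm

theorem IsPrimitive.not_decomposable (h : Ξ.IsPrimitive) : ¬ Ξ.Decomposable := by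
  rintro ⟨n, hn, P, hpos, hneg, hP⟩
  let i₀ : Fin n := ⟨0, by omega⟩
  let i₁ : Fin n := ⟨1, hn⟩
  have hi : i₁ ∈ univ.erase i₀ := by simp [i₀, i₁, Fin.ext_iff]
  rw [← Finset.add_sum_erase _ _ (mem_univ i₀), ← Finset.add_sum_erase _ _ hi] at hpos hneg
  have h0 := (hP i₀).1
  have h1 := (hP i₁).1
  unfold size at h0 h1
  rcases h.trivial (P i₀).pos (hpos ▸ Multiset.le_add_right _ _) (P i₀).neg
    (hneg ▸ Multiset.le_add_right _ _) (hP i₀).2 with ⟨h2, h3⟩ | ⟨h2, h3⟩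
  · simp [h2, h3] at h0
  · have h4 := congrArg Multiset.card hpos
    have h5 := congrArg Multiset.card hneg
    rw [h2, Multiset.card_add, Multiset.card_add] at h4
    rw [h3, Multiset.card_add, Multiset.card_add] at h5
    omega

/-- A balanced part with `a` black and `b` white vertices has `a q = b p`, so `p ∣ a` and `a` is `0`
or `p`. -/
theorem isPrimitive_biregular {p q : ℕ+} (h : Nat.Coprime p q) (s : S) :
    IsPrimitive (⟨Multiset.replicate p (q, s), Multiset.replicate q (p, s)⟩ : LabeledPassport S) where
  balanced := by simp only [weightSum_replicate]; exact mul_comm _ _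
  trivial := by
    intro A hA B hB hAB
    obtain ⟨a, ha, rfl⟩ := Multiset.le_replicate_iff.1 hA
    obtain ⟨b, hb, rfl⟩ := Multiset.le_replicate_iff.1 hB
    simp only [weightSum_replicate] at hAB
    have hp := p.pos
    have hq := q.pos
    obtain ⟨c, rfl⟩ : (p : ℕ) ∣ a := h.dvd_of_dvd_mul_right (hAB ▸ Dvd.intro_left _ rfl)
    have hbc : b = c * q := Nat.eq_of_mul_eq_mul_right hp (by rw [← hAB]; ring)
    subst hbc
    rcases c with _ | c
    · left; simp
    · have : c = 0 := by nlinarith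
      subst this
      right; simp

theorem le_cons_replicate {α : Type} {A : Multiset α} {x y : α} {a : ℕ}
    (h : A ≤ x ::ₘ Multiset.replicate a y) :
    ∃ k ≤ a, A = Multiset.replicate k y ∨ A = x ::ₘ Multiset.replicate k y := by
  by_cases hx : x ∈ A
  · obtain ⟨A, rfl⟩ := Multiset.exists_cons_of_mem hx
    obtain ⟨k, hk, rfl⟩ := Multiset.le_replicate_iff.1 ((Multiset.cons_le_cons_iff x).1 h)
    exact ⟨k, hk, Or.inr rfl⟩
  · obtain ⟨k, hk, rfl⟩ := Multiset.le_replicate_iff.1 ((Multiset.le_cons_of_notMem hx).1 h)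
    exact ⟨k, hk, Or.inl rfl⟩

section Star

variable {p q K : ℕ+} {a d m : ℕ}

/-- In units of `K` the star weighs `1` and every other black vertex `d`, in all `p`. A balanced
part has black weight `K e = b p` with `p` prime to `K`, so `e` is `0` or `p`; without the star `e =
d k` cannot be `p = 1 + d a`. -/
theorem isPrimitive_starBlack (h : Nat.Coprime p q) (hd : 1 < d) (hK : (q : ℕ) = d * K)
    (hp : (p : ℕ) = 1 + d * a) : (starBlack p q K a).IsPrimitive where
  balanced := by
    simp only [starBlack, weightSum_cons, weightSum_replicate]
    rw [hK, hp]; ring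
  trivial := by
    intro A hA B hB hAB
    obtain ⟨b, hb, rfl⟩ := Multiset.le_replicate_iff.1 hB
    have hK0 := K.pos
    have hcop : Nat.Coprime p K := Nat.Coprime.coprime_dvd_right (Dvd.intro_left _ hK.symm) h
    have key : ∀ e : ℕ, K * e = b * p → e ≤ p → (e = 0 ∧ b = 0) ∨ (e = p ∧ b = K) := by
      intro e h1 h2
      obtain ⟨c, rfl⟩ : (p : ℕ) ∣ e := hcop.dvd_of_dvd_mul_left (h1 ▸ Dvd.intro_left _ rfl)
      have hp0 := p.pos
      have hbc : b = K * c := Nat.eq_of_mul_eq_mul_right hp0 (by rw [← h1]; ring)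
      rcases c with _ | c
      · left; simpa using hbc
      · have : c = 0 := by nlinarith
        subst this
        right; simpa using hbc
    obtain ⟨k, hk, rfl | rfl⟩ := le_cons_replicate hA
    · simp only [weightSum_replicate] at hAB
      rcases key (d * k) (by rw [← hAB, hK]; ring) (by rw [hp]; nlinarith) with ⟨h1, rfl⟩ | ⟨h1, -⟩
      · left
        have : k = 0 := by
          rcases Nat.mul_eq_zero.1 h1 with h | h
          · omega
          · exact h
        subst this
        simp
      · exfalso
        rw [hp] at h1
        have h2 : d ∣ 1 + d * a := h1 ▸ Dvd.intro _ rfl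
        have h3 := (Nat.dvd_add_left (Dvd.intro _ rfl)).1 h2
        have := Nat.le_of_dvd one_pos h3
        omega
    · simp only [weightSum_cons, weightSum_replicate] at hAB
      rcases key (1 + d * k) (by rw [← hAB, hK]; ring) (by rw [hp]; nlinarith) with ⟨h1, -⟩ | ⟨h1, rfl⟩
      · omega
      · right
        have h2 : d * k = d * a := by omega
        have : k = a := Nat.eq_of_mul_eq_mul_left (by omega) h2
        subst this
        exact ⟨rfl, rfl⟩

theorem size_starBlack : (starBlack p q K a).size = a + K + 1 := by
  simp only [size, starBlack, Multiset.card_cons, Multiset.card_replicate]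
  omega

theorem multFactorial_starBlack : (starBlack p q K a).multFactorial = a ! * (K : ℕ)! := by
  have hK0 := K.pos
  have h1 : ∏ x ∈ (starBlack p q K a).neg.toFinset, ((starBlack p q K a).neg.count x)! = (K : ℕ)! := by
    simp only [starBlack]
    rw [Multiset.toFinset_replicate, if_neg hK0.ne', prod_singleton, Multiset.count_replicate_self]
  have h2 : ∏ x ∈ (starBlack p q K a).pos.toFinset, ((starBlack p q K a).pos.count x)! = a ! := by
    simp only [starBlack, Multiset.toFinset_cons]
    rw [Finset.prod_insert]
    · rw [Multiset.count_cons_self, Multiset.count_replicate, if_neg (by simp)]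
      rcases a with _ | a
      · simp
      · rw [Multiset.toFinset_replicate, if_neg (by simp), prod_singleton,
          Multiset.count_cons_of_ne (by simp), Multiset.count_replicate_self]
        simp
    · rw [Multiset.toFinset_replicate]
      split_ifs <;> simp
  rw [multFactorial, h1, h2]

theorem multFactorial_swap [DecidableEq S] : Ξ.swap.multFactorial = Ξ.multFactorial :=
  mul_comm _ _

theorem size_swap : Ξ.swap.size = Ξ.size := Nat.add_comm _ _

theorem multFactorial_biregular [DecidableEq S] (s : S) :
    (⟨Multiset.replicate p (q, s), Multiset.replicate q (p, s)⟩ : LabeledPassport S).multFactorial =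
      (p : ℕ)! * (q : ℕ)! := by
  simp only [multFactorial]
  rw [Multiset.toFinset_replicate, if_neg p.pos.ne', prod_singleton, Multiset.count_replicate_self,
    Multiset.toFinset_replicate, if_neg q.pos.ne', prod_singleton, Multiset.count_replicate_self]

/-- The star has multiplicity one, so `card_mul` gives `m! / (a! K!)` with `m = a + K`. -/
theorem card_treeCode_starBlack (h : Nat.Coprime p q) (hd : 1 < d) (hK : (q : ℕ) = d * K)
    (hp : (p : ℕ) = 1 + d * a) [NeZero m] (hm : m = a + K) :
    Nat.card (TreeCode (starBlack p q K a) m) = m.choose K := by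
  subst hm
  have h1 := TreeCode.card_mul (isPrimitive_starBlack h hd hK hp) size_starBlack
  have h2 := Nat.add_choose_mul_factorial_mul_factorial a K
  rw [multFactorial_starBlack, ← h2, mul_assoc] at h1
  exact Nat.eq_of_mul_eq_mul_right (by positivity) h1

end Star

section Fill

variable [DecidableEq S]

theorem map_forget_fillSide (M : Multiset (ℕ+ × S)) :
    (fillSide M).map (fun x => (x.1, x.2.1)) = M := by
  rw [fillSide, Multiset.map_map]
  exact Multiset.map_toEnumFinset_fst M

theorem card_fillSide (M : Multiset (ℕ+ × S)) : Multiset.card (fillSide M) = Multiset.card M := by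
  conv_rhs => rw [← map_forget_fillSide M, Multiset.card_map]

theorem nodup_fillSide (M : Multiset (ℕ+ × S)) : (fillSide M).Nodup := by
  refine Multiset.Nodup.map ?_ M.toEnumFinset.nodup
  rintro ⟨⟨a, b⟩, c⟩ ⟨⟨a', b'⟩, c'⟩ h
  simpa [and_assoc] using h

theorem size_fill : Ξ.fill.size = Ξ.size := by
  simp only [size, fill, card_fillSide]

theorem weightSum_map_forget (A : Multiset (ℕ+ × (S × ℕ))) :
    weightSum (A.map fun x => (x.1, x.2.1)) = weightSum A := by
  rw [weightSum, Multiset.map_map]; rfl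

/-- Forgetting the added indices preserves weights and cardinalities, so a balanced part of the
filling projects to one of `Ξ`. -/
theorem IsPrimitive.fill (h : Ξ.IsPrimitive) : Ξ.fill.IsPrimitive where
  balanced := by
    rw [← weightSum_map_forget, ← weightSum_map_forget]
    simp only [LabeledPassport.fill, map_forget_fillSide]
    exact h.balanced
  trivial A hA B hB hAB := by
    rw [← weightSum_map_forget A, ← weightSum_map_forget B] at hAB
    have key : ∀ {A : Multiset (ℕ+ × (S × ℕ))} {M : Multiset (ℕ+ × S)}, A ≤ fillSide M →
        A.map (fun x => (x.1, x.2.1)) = M → A = fillSide M := fun {A M} h1 h2 => by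
      refine Multiset.eq_of_le_of_card_le h1 ?_
      rw [card_fillSide, ← h2, Multiset.card_map]
    rcases h.trivial _ (map_forget_fillSide Ξ.pos ▸ Multiset.map_le_map hA) _
      (map_forget_fillSide Ξ.neg ▸ Multiset.map_le_map hB) hAB with ⟨h1, h2⟩ | ⟨h1, h2⟩
    · left
      exact ⟨Multiset.map_eq_zero.1 h1, Multiset.map_eq_zero.1 h2⟩
    · right
      exact ⟨key hA h1, key hB h2⟩

theorem IsPrimitive.card_fTree (h : Ξ.IsPrimitive) {n : ℕ} [NeZero n] (hn : Ξ.size = n + 1) :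
    Nat.card Ξ.FTree = (n - 1)! :=
  TreeCode.card_tree_of_nodup h.fill (by rw [size_fill, hn]) (nodup_fillSide _) (nodup_fillSide _)

theorem exists_le_fillSide_replicate {k l : ℕ} (hk : k ≤ l) (w : ℕ+) (s : S) :
    ∃ A B : Multiset (ℕ+ × (S × ℕ)), fillSide (Multiset.replicate l (w, s)) = A + B ∧
      Multiset.card A = k ∧ weightSum A = k * w ∧ weightSum B = (l - k) * w := by
  have h1 : 0 < Multiset.card (Multiset.powersetCard k (fillSide (Multiset.replicate l (w, s)))) := by
    rw [Multiset.card_powersetCard, card_fillSide, Multiset.card_replicate]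
    exact Nat.choose_pos hk
  obtain ⟨A, hA⟩ := Multiset.card_pos_iff_exists_mem.1 h1
  rw [Multiset.mem_powersetCard] at hA
  obtain ⟨B, hB⟩ := Multiset.le_iff_exists_add.1 hA.1
  have h2 : ∀ C ≤ fillSide (Multiset.replicate l (w, s)), weightSum C = Multiset.card C * w := by
    intro C hC
    have h3 := Multiset.map_le_map (f := fun x : ℕ+ × (S × ℕ) => (x.1, x.2.1)) hC
    rw [map_forget_fillSide] at h3
    obtain ⟨c, -, hc⟩ := Multiset.le_replicate_iff.1 h3
    have h4 := congrArg Multiset.card hc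
    rw [Multiset.card_map, Multiset.card_replicate] at h4
    rw [← weightSum_map_forget, hc, weightSum_replicate, h4]
  have h5 := congrArg Multiset.card hB
  rw [card_fillSide, Multiset.card_replicate, Multiset.card_add, hA.2] at h5
  refine ⟨A, B, hB, hA.2, ?_, ?_⟩
  · rw [h2 A hA.1, hA.2]
  · rw [h2 B (hB ▸ Multiset.le_add_left _ _)]
    congr 1
    omega

/-- With `g = gcd p q`, any `p / g` black and `q / g` white vertices have the same total weight `p q
/ g`, and so do the remaining ones. -/
theorem decomposable_fill_biregular {p q : ℕ+} (h : ¬ Nat.Coprime p q) (s : S) :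
    (⟨Multiset.replicate p (q, s), Multiset.replicate q (p, s)⟩ :
      LabeledPassport S).fill.Decomposable := by
  have hp := p.pos
  have hq := q.pos
  have hg : 0 < Nat.gcd p q := Nat.gcd_pos_of_pos_left _ hp
  have hg1 : 1 < Nat.gcd p q := by unfold Nat.Coprime at h; omega
  obtain ⟨p', hp'⟩ := Nat.gcd_dvd_left p q
  obtain ⟨q', hq'⟩ := Nat.gcd_dvd_right p q
  generalize Nat.gcd p q = g at *
  have hp0 : 0 < p' := Nat.pos_of_ne_zero fun h => by rw [h] at hp'; omega
  have hlp : p' < p := by rw [hp']; nlinarith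
  have hlq : q' ≤ q := by rw [hq']; nlinarith
  obtain ⟨A, B, h1, h2, h3, h4⟩ := exists_le_fillSide_replicate hlp.le q s
  obtain ⟨A', B', h1', h2', h3', h4'⟩ := exists_le_fillSide_replicate hlq p s
  have h5 : p' * (q : ℕ) = q' * p := by rw [hp', hq']; ring
  refine ⟨2, one_lt_two, ![⟨A, A'⟩, ⟨B, B'⟩], ?_, ?_, ?_⟩
  · simp [LabeledPassport.fill, h1]
  · simp [LabeledPassport.fill, h1']
  · intro i
    fin_cases i
    · simp only [size]
      refine ⟨?_, ?_⟩
      · change 0 < Multiset.card A + Multiset.card A'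
        omega
      · change weightSum A = weightSum A'
        rw [h3, h3', h5]
    · refine ⟨?_, ?_⟩
      · change 0 < Multiset.card B + Multiset.card B'
        have := congrArg Multiset.card h1
        rw [card_fillSide, Multiset.card_replicate, Multiset.card_add] at this
        omega
      · change weightSum B = weightSum B'
        rw [h4, h4', Nat.sub_mul, Nat.sub_mul, h5, mul_comm (p : ℕ)]

end Fill

end LabeledPassport

end

/-! ### Divided passports of `(q ^ p, p ^ q)` and the values of `G`. -/

section

open CyclePerm Finset LabeledPassport

namespace LabeledPassport

variable {p q : ℕ+} {d : ℕ}

/-- Each side has a single labeled weight, so the centre and the divided multisets are forced once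
the color of the centre is chosen. -/
theorem isDivided_pq_iff {Δ : LabeledPassport (Option ℕ)} :
    (pq p q).IsDivided d Δ ↔
      (d = 1 ∧ Δ = ⟨Multiset.replicate p (q, some 0), Multiset.replicate q (p, some 0)⟩) ∨
      (1 < d ∧ ∃ (K : ℕ+) (a : ℕ), (q : ℕ) = d * K ∧ (p : ℕ) = 1 + d * a ∧
        Δ = starBlack p q K a) ∨
      (1 < d ∧ ∃ (K : ℕ+) (a : ℕ), (p : ℕ) = d * K ∧ (q : ℕ) = 1 + d * a ∧
        Δ = (starBlack q p K a).swap) := by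
  have hcons : ∀ {x y : ℕ+ × ℕ} {k : ℕ} {M : Multiset (ℕ+ × ℕ)},
      Multiset.replicate k y = x ::ₘ d • M →
      x = y ∧ ∃ a, k = 1 + d * a ∧ (1 < d → M = Multiset.replicate a y) := by
    intro x y k M h
    have hx : x = y := Multiset.eq_of_mem_replicate (h ▸ Multiset.mem_cons_self x _)
    subst hx
    refine ⟨rfl, Multiset.card M, ?_, fun hd => ?_⟩
    · have := congrArg Multiset.card h
      rw [Multiset.card_replicate, Multiset.card_cons, Multiset.card_nsmul] at this
      omega
    · refine Multiset.eq_replicate_card.2 fun z hz => ?_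
      refine Multiset.eq_of_mem_replicate (n := k) (h ▸ Multiset.mem_cons_of_mem ?_)
      exact (Multiset.mem_nsmul_of_ne_zero (by omega)).2 hz
  have hsmul : ∀ {y : ℕ+ × ℕ} {k : ℕ} {M : Multiset (ℕ+ × ℕ)}, 1 < d →
      Multiset.replicate k y = d • M → M = Multiset.replicate (Multiset.card M) y ∧
        k = d * Multiset.card M := by
    intro y k M hd h
    refine ⟨Multiset.eq_replicate_card.2 fun z hz => ?_, ?_⟩
    · exact Multiset.eq_of_mem_replicate (n := k)
        (h ▸ (Multiset.mem_nsmul_of_ne_zero (by omega)).2 hz)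
    · simpa using congrArg Multiset.card h
  unfold IsDivided
  refine or_congr ?_ (or_congr ?_ ?_)
  · simp [pq, starLift]
  · refine and_congr_right fun hd => ⟨?_, ?_⟩
    · rintro ⟨x, K, M, N, hx, hM, hN, rfl⟩
      obtain ⟨rfl, a, ha, hMa⟩ := hcons hM
      obtain ⟨hN1, hN2⟩ := hsmul hd hN
      have hKN : Multiset.card N = K :=
        Nat.eq_of_mul_eq_mul_left (by omega : 0 < d) (hN2.symm.trans hx)
      refine ⟨K, a, hx, ha, ?_⟩
      rw [hMa hd, hN1, hKN]
      simp [starBlack, starLift]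
    · rintro ⟨K, a, hq, hp, rfl⟩
      refine ⟨(q, 0), K, Multiset.replicate a (q, 0), Multiset.replicate K (p, 0), hq, ?_, ?_, ?_⟩
      · rw [Multiset.nsmul_replicate, ← Multiset.replicate_succ, pq, hp, Nat.add_comm]
      · rw [Multiset.nsmul_replicate, pq, hq]
      · simp [starBlack, starLift]
  · refine and_congr_right fun hd => ⟨?_, ?_⟩
    · rintro ⟨x, K, M, N, hx, hM, hN, rfl⟩
      obtain ⟨rfl, a, ha, hMa⟩ := hcons hN
      obtain ⟨hN1, hN2⟩ := hsmul hd hM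
      have hKN : Multiset.card M = K :=
        Nat.eq_of_mul_eq_mul_left (by omega : 0 < d) (hN2.symm.trans hx)
      refine ⟨K, a, hx, ha, ?_⟩
      rw [hMa hd, hN1, hKN]
      simp [starBlack, starLift, swap]
    · rintro ⟨K, a, hp, hq, rfl⟩
      refine ⟨(p, 0), K, Multiset.replicate K (q, 0), Multiset.replicate a (p, 0), hp, ?_, ?_, ?_⟩
      · rw [Multiset.nsmul_replicate, pq, hp]
      · rw [Multiset.nsmul_replicate, ← Multiset.replicate_succ, pq, hq, Nat.add_comm]
      · simp [starBlack, starLift, swap]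

theorem dvd_gcd_sub_one_iff : d ∣ Nat.gcd ((p : ℕ) - 1) q ↔
    ∃ (K : ℕ+) (a : ℕ), (q : ℕ) = d * K ∧ (p : ℕ) = 1 + d * a := by
  have hp := p.pos
  have hq := q.pos
  rw [Nat.dvd_gcd_iff]
  constructor
  · rintro ⟨⟨a, ha⟩, ⟨k, hk⟩⟩
    have hk0 : 0 < k := Nat.pos_of_ne_zero fun h => by rw [h] at hk; omega
    exact ⟨⟨k, hk0⟩, a, hk, by omega⟩
  · rintro ⟨K, a, hK, ha⟩
    exact ⟨⟨a, by omega⟩, ⟨K, hK⟩⟩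

theorem exists_isDivided_pq_iff : (∃ Δ, (pq p q).IsDivided d Δ) ↔
    d ∣ Nat.gcd ((p : ℕ) - 1) q ∨ d ∣ Nat.gcd p ((q : ℕ) - 1) := by
  have hp := p.pos
  have hq := q.pos
  rcases Nat.lt_trichotomy d 1 with hd | rfl | hd
  · obtain rfl : d = 0 := by omega
    simp only [zero_dvd_iff, Nat.gcd_eq_zero_iff]
    refine ⟨?_, fun h => by omega⟩
    rintro ⟨Δ, h⟩
    rw [isDivided_pq_iff] at h
    rcases h with ⟨h, -⟩ | ⟨h, -⟩ | ⟨h, -⟩ <;> omega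
  · exact ⟨fun _ => Or.inl (one_dvd _), fun _ => ⟨_, isDivided_pq_iff.2 (Or.inl ⟨rfl, rfl⟩)⟩⟩
  · rw [Nat.gcd_comm p, dvd_gcd_sub_one_iff, dvd_gcd_sub_one_iff]
    constructor
    · rintro ⟨Δ, h⟩
      rw [isDivided_pq_iff] at h
      rcases h with ⟨h, -⟩ | ⟨-, K, a, h1, h2, -⟩ | ⟨-, K, a, h1, h2, -⟩
      · omega
      · exact Or.inl ⟨K, a, h1, h2⟩
      · exact Or.inr ⟨K, a, h1, h2⟩
    · rintro (⟨K, a, h1, h2⟩ | ⟨K, a, h1, h2⟩)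
      · exact ⟨_, isDivided_pq_iff.2 (Or.inr (Or.inl ⟨hd, K, a, h1, h2, rfl⟩))⟩
      · exact ⟨_, isDivided_pq_iff.2 (Or.inr (Or.inr ⟨hd, K, a, h1, h2, rfl⟩))⟩

theorem isPrimitive_of_isDivided (h : Nat.Coprime p q) {Δ : LabeledPassport (Option ℕ)}
    (hΔ : (pq p q).IsDivided d Δ) :
    Δ.IsPrimitive ∧ ∃ m, 0 < m ∧ Δ.size = m + 1 ∧ (p : ℕ) + q - 1 = d * m := by
  have hp0 := p.pos
  have hq0 := q.pos
  rw [isDivided_pq_iff] at hΔ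
  rcases hΔ with ⟨rfl, rfl⟩ | ⟨hd, K, a, hq, hp, rfl⟩ | ⟨hd, K, a, hp, hq, rfl⟩
  · refine ⟨isPrimitive_biregular h _, (p : ℕ) + q - 1, by omega, ?_, by omega⟩
    simp only [size, Multiset.card_replicate]
    omega
  · refine ⟨isPrimitive_starBlack h hd hq hp, a + K, by have := K.pos; omega, size_starBlack, ?_⟩
    rw [mul_add, ← hq, hp]
    omega
  · refine ⟨(isPrimitive_starBlack h.symm hd hp hq).swap, a + K, by have := K.pos; omega,
      by rw [size_swap, size_starBlack], ?_⟩
    rw [mul_add, ← hp, hq]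
    omega

theorem card_fTree_of_isDivided (h : Nat.Coprime p q) {Δ : LabeledPassport (Option ℕ)}
    (hΔ : (pq p q).IsDivided d Δ) :
    d ∣ (p : ℕ) + q - 1 ∧ Nat.card Δ.FTree = (((p : ℕ) + q - 1) / d - 1)! := by
  obtain ⟨h1, m, hm, hsize, hdm⟩ := isPrimitive_of_isDivided h hΔ
  have : NeZero m := ⟨hm.ne'⟩
  have hd : 0 < d := Nat.pos_of_ne_zero fun h => by
    have := p.pos
    have := q.pos
    rw [h] at hdm
    omega
  refine ⟨hdm ▸ Dvd.intro _ rfl, ?_⟩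
  rw [h1.card_fTree hsize, hdm, Nat.mul_div_cancel_left _ hd]

theorem G_eq_of_isDivided {S : Type} [DecidableEq S] {Ξ : LabeledPassport S}
    {Δ : LabeledPassport (Option S)} (hΔ : Ξ.IsDivided d Δ) :
    Ξ.G d = (Nat.card Δ.FTree : ℚ) / ((d : ℚ) * (Δ.multFactorial : ℚ)) := by
  have h : ∃ Δ, Ξ.IsDivided d Δ := ⟨Δ, hΔ⟩
  rw [G, dif_pos h, IsDivided.unique h.choose_spec hΔ]

/-- Here `d * m` will be `p + q - 1`, and `a`, `k` the two multiplicities of `Ξ / d` apart from the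
star. -/
theorem factorial_div_eq {a k d m : ℕ} (hd : 0 < d) (hm : 0 < m) (h : m = a + k) :
    (((m - 1)! : ℕ) : ℚ) / ((d : ℚ) * ((a ! * k ! : ℕ) : ℚ)) = 1 / ((d * m : ℕ) : ℚ) * (m.choose k : ℚ) := by
  have h1 := Nat.add_choose_mul_factorial_mul_factorial a k
  rw [← h, ← Nat.mul_factorial_pred hm.ne'] at h1
  have h2 : ((m.choose k : ℕ) : ℚ) * a ! * k ! = m * (m - 1)! := by exact_mod_cast h1
  have ha : ((a ! : ℕ) : ℚ) ≠ 0 := by positivity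
  have hk : ((k ! : ℕ) : ℚ) ≠ 0 := by positivity
  have hd' : (d : ℚ) ≠ 0 := by positivity
  have hm' : (m : ℚ) ≠ 0 := by positivity
  push_cast
  field_simp
  linear_combination -h2

theorem cast_add_sub_one : (((p : ℕ) : ℚ) + ((q : ℕ) : ℚ) - 1) = (((p : ℕ) + q - 1 : ℕ) : ℚ) := by
  have := p.pos
  rw [Nat.cast_sub (by omega)]
  push_cast
  ring

theorem G_pq_one (h : Nat.Coprime p q) :
    (pq p q).G 1 = (((p : ℕ) + q - 2)! : ℚ) / (((p : ℕ)! : ℚ) * ((q : ℕ)! : ℚ)) := by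
  have hΔ := (isDivided_pq_iff (p := p) (q := q) (d := 1)).2 (Or.inl ⟨rfl, rfl⟩)
  rw [G_eq_of_isDivided hΔ, (card_fTree_of_isDivided h hΔ).2, multFactorial_biregular,
    Nat.div_one, Nat.sub_sub, Nat.cast_one, one_mul]
  push_cast
  rfl

theorem G_pq_of_dvd (h : Nat.Coprime p q) (hd : 1 < d) (hdvd : d ∣ Nat.gcd ((p : ℕ) - 1) q) :
    (pq p q).G d = 1 / (((p : ℕ) : ℚ) + ((q : ℕ) : ℚ) - 1) *
      (Nat.choose (((p : ℕ) + q - 1) / d) ((q : ℕ) / d) : ℚ) := by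
  obtain ⟨K, a, hq, hp⟩ := dvd_gcd_sub_one_iff.1 hdvd
  have hΔ := (isDivided_pq_iff (p := p) (q := q) (d := d)).2 (Or.inr (Or.inl ⟨hd, K, a, hq, hp, rfl⟩))
  have hK := K.pos
  have hn : (p : ℕ) + q - 1 = d * (a + K) := by rw [mul_add, ← hq, hp]; omega
  rw [G_eq_of_isDivided hΔ, (card_fTree_of_isDivided h hΔ).2, multFactorial_starBlack,
    cast_add_sub_one, hn, hq, Nat.mul_div_cancel_left _ (by omega), Nat.mul_div_cancel_left _ (by omega)]
  exact factorial_div_eq (by omega) (by omega) rfl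

theorem G_pq_of_dvd' (h : Nat.Coprime p q) (hd : 1 < d) (hdvd : d ∣ Nat.gcd p ((q : ℕ) - 1)) :
    (pq p q).G d = 1 / (((p : ℕ) : ℚ) + ((q : ℕ) : ℚ) - 1) *
      (Nat.choose (((p : ℕ) + q - 1) / d) ((p : ℕ) / d) : ℚ) := by
  rw [Nat.gcd_comm] at hdvd
  obtain ⟨K, a, hp, hq⟩ := dvd_gcd_sub_one_iff.1 hdvd
  have hΔ := (isDivided_pq_iff (p := p) (q := q) (d := d)).2 (Or.inr (Or.inr ⟨hd, K, a, hp, hq, rfl⟩))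
  have hK := K.pos
  have hn : (p : ℕ) + q - 1 = d * (a + K) := by rw [mul_add, ← hp, hq]; omega
  rw [G_eq_of_isDivided hΔ, (card_fTree_of_isDivided h hΔ).2, multFactorial_swap,
    multFactorial_starBlack, cast_add_sub_one, hn, hp, Nat.mul_div_cancel_left _ (by omega),
    Nat.mul_div_cancel_left _ (by omega)]
  exact factorial_div_eq (by omega) (by omega) rfl

theorem coprime_iff_not_decomposable : Nat.gcd p q = 1 ↔
    ∀ (d : ℕ) (Δ : LabeledPassport (Option ℕ)),
      (pq p q).IsDivided d Δ → ¬ Δ.fill.Decomposable := by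
  constructor
  · intro h d Δ hΔ
    exact (isPrimitive_of_isDivided h hΔ).1.fill.not_decomposable
  · intro h
    by_contra hg
    exact h 1 _ (isDivided_pq_iff.2 (Or.inl ⟨rfl, rfl⟩)) (decomposable_fill_biregular hg _)

end LabeledPassport

end

/-! ### Fixed points of the shifts and the number of trees. -/

section

open CyclePerm Finset LabeledPassport

namespace TreeCode

variable {p q : ℕ+} {n : ℕ} [NeZero n]

/-- The order `d` divides `n = (p - 1) + q`, hence also `p - 1`, so the divided passport with a
black centre exists and its codes count the fixed ones. -/
theorem card_fixed_of_dvd (h : Nat.Coprime p q) (hn : (p : ℕ) + q = n + 1) {d : ℕ} (hd : 1 < d)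
    (hdq : d ∣ (q : ℕ)) {s : Fin n} (hs : addOrderOf s = d) :
    Nat.card {X : TreeCode (pq p q) n // X.shift s = X} = (n / d).choose (q / d) := by
  obtain ⟨m, rfl⟩ : d ∣ n := by
    have h1 := addOrderOf_dvd_card (x := s)
    rwa [hs, Fintype.card_fin] at h1
  have hp0 := p.pos
  have : NeZero d := ⟨by omega⟩
  have : NeZero m := ⟨fun h => NeZero.ne (d * m) (by rw [h, mul_zero])⟩
  have hdp : d ∣ (p : ℕ) - 1 := by
    have h1 : d ∣ ((p : ℕ) - 1) + q := by
      rw [show (p : ℕ) - 1 + q = d * m by omega]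
      exact Dvd.intro _ rfl
    exact (Nat.dvd_add_left hdq).1 h1
  obtain ⟨K, a, hK, ha⟩ := (dvd_gcd_sub_one_iff (p := p) (q := q)).1 (Nat.dvd_gcd hdp hdq)
  have hm : m = a + K := by
    refine Nat.eq_of_mul_eq_mul_left (show 0 < d by omega) ?_
    rw [mul_add, ← hK]
    omega
  rw [hK, Nat.mul_div_cancel_left _ (by omega), Nat.mul_div_cancel_left _ (by omega),
    ← card_treeCode_starBlack h hd hK ha hm, ← card_periodic hd hK ha hm]
  exact Nat.card_congr (Equiv.subtypeEquivRight fun X => shift_eq_iff_periodic hs)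

theorem card_fixed_swap {S : Type} [DecidableEq S] {Ξ : LabeledPassport S} {d : ℕ} (hd : 0 < d)
    {s : Fin n} (hs : addOrderOf s = d) :
    Nat.card {X : TreeCode Ξ.swap n // X.shift s = X} =
      Nat.card {X : TreeCode Ξ n // X.shift s = X} := by
  obtain ⟨m, rfl⟩ : d ∣ n := by
    have h1 := addOrderOf_dvd_card (x := s)
    rwa [hs, Fintype.card_fin] at h1
  have : NeZero d := ⟨by omega⟩
  have : NeZero m := ⟨fun h => NeZero.ne (d * m) (by rw [h, mul_zero])⟩
  simp only [shift_eq_iff_periodic hs]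
  exact card_periodic_swap

/-- At most one summand is nonzero, because `p` and `q` are coprime. If `d` divides neither,
`ramification` excludes fixed codes. -/
theorem card_fixed (h : Nat.Coprime p q) (hn : (p : ℕ) + q = n + 1) {d : ℕ} (hd : 1 < d)
    {s : Fin n} (hs : addOrderOf s = d) :
    Nat.card {X : TreeCode (pq p q) n // X.shift s = X} =
      (if d ∣ (q : ℕ) then (n / d).choose (q / d) else 0) +
        if d ∣ (p : ℕ) then (n / d).choose (p / d) else 0 := by
  by_cases hdq : d ∣ (q : ℕ)
  · have hdp : ¬ d ∣ (p : ℕ) := fun hdp => by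
      have h1 := Nat.dvd_gcd hdp hdq
      rw [h] at h1
      have := Nat.le_of_dvd one_pos h1
      omega
    rw [if_pos hdq, if_neg hdp, add_zero, card_fixed_of_dvd h hn hd hdq hs]
  · by_cases hdp : d ∣ (p : ℕ)
    · rw [if_neg hdq, if_pos hdp, zero_add]
      have h1 := card_fixed_of_dvd (p := q) (q := p) h.symm (by omega) hd hdp hs
      rw [← h1]
      exact card_fixed_swap (Ξ := pq q p) (by omega) hs
    · rw [if_neg hdq, if_neg hdp]
      obtain ⟨m, rfl⟩ : d ∣ n := by
        have h1 := addOrderOf_dvd_card (x := s)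
        rwa [hs, Fintype.card_fin] at h1
      have : NeZero d := ⟨by omega⟩
      have : NeZero m := ⟨fun h => NeZero.ne (d * m) (by rw [h, mul_zero])⟩
      have : IsEmpty {X : TreeCode (pq p q) (d * m) // X.shift s = X} := ⟨fun X => by
        have hX := (shift_eq_iff_periodic hs).1 X.2
        obtain ⟨τ, w, hτ, hw⟩ := hX.exists_quotient
        rcases ramification hX hd hn hτ hw with h1 | ⟨h1, -⟩
        · exact hdp h1
        · exact hdq h1⟩
      exact Nat.card_of_isEmpty

end TreeCode

namespace LabeledPassport

theorem card_tree_pq {p q : ℕ+} (h : Nat.Coprime p q) :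
    (Nat.card (pq p q).Tree : ℚ) =
      (((p : ℕ) + q - 2)! : ℚ) / (((p : ℕ)! : ℚ) * ((q : ℕ)! : ℚ)) +
      1 / (((p : ℕ) : ℚ) + ((q : ℕ) : ℚ) - 1) *
        ((∑ d ∈ (Nat.gcd ((p : ℕ) - 1) q).divisors with 1 < d,
            (Nat.totient d : ℚ) * (Nat.choose (((p : ℕ) + q - 1) / d) ((q : ℕ) / d) : ℚ)) +
          (∑ d ∈ (Nat.gcd p ((q : ℕ) - 1)).divisors with 1 < d,
            (Nat.totient d : ℚ) * (Nat.choose (((p : ℕ) + q - 1) / d) ((p : ℕ) / d) : ℚ))) := by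
  have hp0 := p.pos
  have hq0 := q.pos
  rw [cast_add_sub_one]
  obtain ⟨n, hn⟩ : ∃ n, (p : ℕ) + q = n + 1 := ⟨p + q - 1, by omega⟩
  have hn0 : 0 < n := by omega
  have : NeZero n := ⟨hn0.ne'⟩
  have hn1 : (p : ℕ) + q - 1 = n := by omega
  have hn2 : (p : ℕ) + q - 2 = n - 1 := by omega
  rw [hn1, hn2]
  have hprim : (pq p q).IsPrimitive := isPrimitive_biregular h 0
  have hsize : (pq p q).size = n + 1 := by
    simp only [size, pq, Multiset.card_replicate]
    exact hn
  have hcard := TreeCode.card_mul hprim hsize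
  have hmf : (pq p q).multFactorial = (p : ℕ)! * (q : ℕ)! := multFactorial_biregular 0
  rw [hmf] at hcard
  have hburn := TreeCode.card_tree_mul hprim hsize
  -- Shifts are grouped by their order: the trivial one fixes all codes, and there are `φ d` shifts
  -- of each order `d ∣ n`.
  have hfib : ∑ s : Fin n, Nat.card {X : TreeCode (pq p q) n // X.shift s = X} =
      Nat.card (TreeCode (pq p q) n) + ∑ d ∈ n.divisors with 1 < d, φ d *
        ((if d ∣ (q : ℕ) then (n / d).choose (q / d) else 0) +
          if d ∣ (p : ℕ) then (n / d).choose (p / d) else 0) := by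
    rw [← Finset.sum_fiberwise_of_maps_to (g := addOrderOf) (t := n.divisors),
      ← Finset.sum_filter_add_sum_filter_not _ (fun d => 1 < d), add_comm]
    · congr 1
      · rw [show (n.divisors.filter fun d => ¬ 1 < d) = {1} by
          ext d
          simp only [mem_filter, Nat.mem_divisors, mem_singleton]
          constructor
          · rintro ⟨⟨h1, h2⟩, h3⟩
            have := Nat.pos_of_dvd_of_pos h1 hn0
            omega
          · rintro rfl
            simp [hn0.ne']]
        simp only [sum_singleton, AddMonoid.addOrderOf_eq_one_iff]
        rw [Finset.filter_eq' univ (0 : Fin n), if_pos (mem_univ _), sum_singleton]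
        exact Nat.card_congr (Equiv.subtypeUnivEquiv fun X => zero_vadd (Fin n) X)
      · refine Finset.sum_congr rfl fun d hd => ?_
        simp only [mem_filter, Nat.mem_divisors] at hd
        rw [Finset.sum_congr rfl fun s hs => TreeCode.card_fixed h hn hd.2 (mem_filter.1 hs).2,
          sum_const, card_addOrderOf_eq hd.1.1, smul_eq_mul]
    · intro s _
      have h1 := addOrderOf_dvd_card (x := s)
      rw [Fintype.card_fin] at h1
      exact Nat.mem_divisors.2 ⟨h1, hn0.ne'⟩
  -- As `n = (k - 1) + l`, the divisors of `n` that divide `l` are those of `gcd (k - 1) l`. It is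
  -- used for both orders of `p` and `q`.
  have hsets : ∀ k l : ℕ, 0 < k → 0 < l → k + l = n + 1 → ∀ f : ℕ → ℕ,
      ∑ d ∈ n.divisors with 1 < d, φ d * (if d ∣ l then f d else 0) =
        ∑ d ∈ (Nat.gcd (k - 1) l).divisors with 1 < d, φ d * f d := by
    intro k l hk hl hkl f
    simp only [mul_ite, mul_zero]
    rw [← Finset.sum_filter]
    refine Finset.sum_congr ?_ fun _ _ => rfl
    ext d
    have hkl' : n = (k - 1) + l := by omega
    have hg : Nat.gcd (k - 1) l ≠ 0 := (Nat.gcd_pos_of_pos_right _ hl).ne'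
    simp only [mem_filter, Nat.mem_divisors, Nat.dvd_gcd_iff]
    constructor
    · rintro ⟨⟨⟨h1, -⟩, h2⟩, h3⟩
      rw [hkl'] at h1
      exact ⟨⟨⟨(Nat.dvd_add_left h3).1 h1, h3⟩, hg⟩, h2⟩
    · rintro ⟨⟨⟨h1, h2⟩, -⟩, h3⟩
      exact ⟨⟨⟨hkl' ▸ Nat.dvd_add h1 h2, hn0.ne'⟩, h3⟩, h2⟩
  simp only [mul_add, sum_add_distrib] at hfib
  rw [hsets p q hp0 hq0 hn (fun d => (n / d).choose (q / d)),
    hsets q p hq0 hp0 (by omega) (fun d => (n / d).choose (p / d)), Nat.gcd_comm _ (p : ℕ)] at hfib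
  rw [hfib] at hburn
  have hburn' : (Nat.card (pq p q).Tree : ℚ) * n = Nat.card (TreeCode (pq p q) n) +
      ((∑ d ∈ (Nat.gcd ((p : ℕ) - 1) q).divisors with 1 < d,
          (Nat.totient d : ℚ) * (Nat.choose (n / d) ((q : ℕ) / d) : ℚ)) +
        (∑ d ∈ (Nat.gcd p ((q : ℕ) - 1)).divisors with 1 < d,
          (Nat.totient d : ℚ) * (Nat.choose (n / d) ((p : ℕ) / d) : ℚ))) := by
    exact_mod_cast hburn
  have hn' : (n : ℚ) ≠ 0 := by positivity
  have hX : (Nat.card (TreeCode (pq p q) n) : ℚ) =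
      n * (((n - 1)! : ℚ) / (((p : ℕ)! : ℚ) * ((q : ℕ)! : ℚ))) := by
    rw [← mul_div_assoc, eq_div_iff (by positivity)]
    rw [← Nat.mul_factorial_pred hn0.ne'] at hcard
    exact_mod_cast hcard
  rw [hX] at hburn'
  rw [eq_comm, ← mul_right_cancel_iff_of_pos (show (0 : ℚ) < n by positivity), hburn']
  field_simp

end LabeledPassport

end

theorem proposition4p2 (p q : ℕ+) (hpq : q < p) :
    (∀ d : ℕ, (∃ Δ, (LabeledPassport.pq p q).IsDivided d Δ) ↔
      d ∣ Nat.gcd ((p : ℕ) - 1) q ∨ d ∣ Nat.gcd p ((q : ℕ) - 1)) ∧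
    (Nat.gcd p q = 1 ↔
      ∀ (d : ℕ) (Δ : LabeledPassport (Option ℕ)),
        (LabeledPassport.pq p q).IsDivided d Δ → ¬ Δ.fill.Decomposable) ∧
    (Nat.gcd p q = 1 →
      (∀ (d : ℕ) (Δ : LabeledPassport (Option ℕ)), (LabeledPassport.pq p q).IsDivided d Δ →
        d ∣ (p : ℕ) + q - 1 ∧ Nat.card Δ.FTree = (((p : ℕ) + q - 1) / d - 1)!) ∧
      (LabeledPassport.pq p q).G 1 = (((p : ℕ) + q - 2)! : ℚ) / (((p : ℕ)! : ℚ) * ((q : ℕ)! : ℚ)) ∧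
      (∀ d : ℕ, 1 < d → d ∣ Nat.gcd ((p : ℕ) - 1) q →
        (LabeledPassport.pq p q).G d =
          1 / (((p : ℕ) : ℚ) + ((q : ℕ) : ℚ) - 1) *
            (Nat.choose (((p : ℕ) + q - 1) / d) ((q : ℕ) / d) : ℚ)) ∧
      (∀ d : ℕ, 1 < d → d ∣ Nat.gcd p ((q : ℕ) - 1) →
        (LabeledPassport.pq p q).G d =
          1 / (((p : ℕ) : ℚ) + ((q : ℕ) : ℚ) - 1) *
            (Nat.choose (((p : ℕ) + q - 1) / d) ((p : ℕ) / d) : ℚ)) ∧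
      (Nat.card (LabeledPassport.pq p q).Tree : ℚ) =
        (((p : ℕ) + q - 2)! : ℚ) / (((p : ℕ)! : ℚ) * ((q : ℕ)! : ℚ)) +
        1 / (((p : ℕ) : ℚ) + ((q : ℕ) : ℚ) - 1) *
          ((∑ d ∈ (Nat.gcd ((p : ℕ) - 1) q).divisors with 1 < d,
              (Nat.totient d : ℚ) * (Nat.choose (((p : ℕ) + q - 1) / d) ((q : ℕ) / d) : ℚ)) +
            (∑ d ∈ (Nat.gcd p ((q : ℕ) - 1)).divisors with 1 < d,
              (Nat.totient d : ℚ) * (Nat.choose (((p : ℕ) + q - 1) / d) ((p : ℕ) / d) : ℚ)))) := by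
  exact ⟨fun _ => LabeledPassport.exists_isDivided_pq_iff,
    LabeledPassport.coprime_iff_not_decomposable, fun h =>
    ⟨fun _ _ => LabeledPassport.card_fTree_of_isDivided h, LabeledPassport.G_pq_one h,
      fun _ => LabeledPassport.G_pq_of_dvd h, fun _ => LabeledPassport.G_pq_of_dvd' h,
      LabeledPassport.card_tree_pq h⟩⟩
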